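/- Let $(X,\mathsf d)$ be a complete separable metric space and $\mathfrak m$ a non-negative, non-zero Borel measure on $X$ giving finite mass to bounded sets. Assume that $(X,\mathsf d,\mathfrak m)$ is uniformly locally doubling: for every $R>0$ there is a constant $\mathsf{Doub}(R)>0$ with $$\mathfrak m(B_{2r}(x))\le \mathsf{Doub}(R)\,\mathfrak m(B_r(x))\qquad\forall x\in X,\ r\in(0,R).$$ Let $(Y,\mathsf d_Y,\bar y)$ be a pointed complete metric space and $p\in(1,\infty)$, $\frac1p+\frac1q=1$. Definitions. $L^p(X,Y_{\bar y})$ is the set of ($\mathfrak m$-a.e. equivalence classes of) Borel maps $u:X\to Y$ with separable range and $\int \mathsf d_Y^p(u(x),\bar y)\,d\mathfrak m(x)<\infty$. For such $u$ and $r>0$ put $$\mathsf{ks}_{p,r}[u](x):=\Big(\frac1{\mathfrak m(B_r(x))}\int_{B_r(x)}\frac{\mathsf d_Y^p(u(x),u(y))}{r^p}\,d\mathfrak m(y)\Big)^{1/p},$$ and let $\mathsf{KS}^{1,p}(X,Y_{\bar y})$ be the set of $u\in L^p(X,Y_{\bar y})$ with $\liminf_{r\downarrow0}\int \mathsf{ks}_{p,r}^p[u]\,d\mathfrak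 m<\infty$. A $q$-test plan is a Borel probability measure $\pi$ on $C([0,1],X)$ with $\iint_0^1|\dot\gamma_t|^q\,dt\,d\pi(\gamma)<\infty$ (the inner integral being $+\infty$ if $\gamma$ is not absolutely continuous) and $(\mathrm e_t)_*\pi\le C_\pi\,\mathfrak m$ for every $t\in[0,1]$ and some constant $C_\pi$, where $\mathrm e_t(\gamma)=\gamma_t$ and $|\dot\gamma_t|$ is the metric speed. A function $0\le G\in L^p(X)$ is a $p$-weak upper gradient of a (class of a) Borel function $f:X\to\mathbb R$ if $\int|f(\gamma_1)-f(\gamma_0)|\,d\pi(\gamma)\le\iint_0^1G(\gamma_t)|\dot\gamma_t|\,dt\,d\pi(\gamma)$ for every $q$-test plan $\pi$; $|Df|$ denotes the $\mathfrak m$-a.e. minimal one. A function $0\le G\in L^p(X)$ is a $p$-weak upper gradient of $u\in L^p(X,Y_{\bar y})$ if for every $1$-Lipschitz $\varphi:Y\to\mathbb R$ the function $\varphi\circ u$ has a $p$-weak upper gradient and $|D(\varphi\circ u)|\le G$ $\mathfrak m$-a.e.; $W^{1,p}(X,Y_{\bar y})$ is the set of $u\in L^p(X,Y_{\bar y})$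 having such a $G$, and $|Du|$ denotes the $\mathfrak m$-a.e. minimal one. Proposition. One has $\mathsf{KS}^{1,p}(X,Y_{\bar y})\subset W^{1,p}(X,Y_{\bar y})$. Moreover, there is a constant $C>0$ depending only on $\inf_{R>0}\mathsf{Doub}(R)$ such that for every $u\in\mathsf{KS}^{1,p}(X,Y_{\bar y})$ $$|Du|\le C\,G\qquad\mathfrak m\text{-a.e.}$$ whenever $G$ is the weak $L^p(X)$-limit of $\mathsf{ks}_{p,\varepsilon_n}[u]$ along some sequence $\varepsilon_n\downarrow0$; and for every such $u$ at least one such sequence and weak limit $G$ exist. -/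

import Mathlib

open MeasureTheory Filter Topology
open scoped ENNReal NNReal unitInterval

noncomputable section

section Curves

variable {X : Type*} [MetricSpace X]

/-- The space of continuous curves `γ : [0,1] → X`, with the topology of uniform convergence,
carries its Borel σ-algebra. -/
instance instMeasurableSpaceCurves : MeasurableSpace C(I, X) := borel C(I, X)

instance instBorelSpaceCurves : BorelSpace C(I, X) := ⟨rfl⟩

/-- `γ` is absolutely continuous: there is `f ∈ L¹(0,1)` with `d(γ_s, γ_t) ≤ ∫_s^t f` for all
`s ≤ t` in `[0,1]`. -/
def IsACCurve (γ : C(I, X)) : Prop :=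
  ∃ f : ℝ → ℝ, IntervalIntegrable f volume 0 1 ∧
    ∀ s t : I, s ≤ t → dist (γ s) (γ t) ≤ ∫ r in (s : ℝ)..(t : ℝ), f r

open Classical in
/-- The metric speed functional `ms(γ, t) = lim_{h → 0} d(γ_{t+h}, γ_t) / |h|`, when `γ` is
absolutely continuous and the limit exists, and `∞` otherwise. -/
def metricSpeed (γ : C(I, X)) (t : I) : ℝ≥0∞ :=
  if IsACCurve γ ∧
      ∃ L : ℝ, Tendsto (fun s : I => dist (γ s) (γ t) / |(s : ℝ) - t|) (𝓝[≠] t) (𝓝 L) then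
    ENNReal.ofReal (limUnder (𝓝[≠] t) fun s : I => dist (γ s) (γ t) / |(s : ℝ) - t|)
  else ∞

variable [MeasurableSpace X]

/-- `q`-test plans: Borel probability measures on the space of curves, with finite `q`-energy and
with time marginals bounded by a multiple of `m`. -/
structure IsTestPlan (q : ℝ) (m : Measure X) (π : Measure C(I, X)) : Prop where
  isProbabilityMeasure : IsProbabilityMeasure π
  energy_lt_top : ∫⁻ γ, (∫⁻ t : I, metricSpeed γ t ^ q) ∂π < ∞
  exists_marginal_le : ∃ C : ℝ≥0, ∀ t : I, π.map (fun γ => γ t) ≤ C • m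

/-- `G` is a `p`-weak upper gradient of the real-valued function `f`. The exponent of the test
plans is the conjugate exponent of `p`. The class `S^p(X)` consists of the functions `f` that have
some `p`-weak upper gradient. -/
structure IsWeakUpperGradient (p : ℝ) (m : Measure X) (f G : X → ℝ) : Prop where
  aemeasurable : AEMeasurable f m
  memLp : MemLp G (ENNReal.ofReal p) m
  nonneg : 0 ≤ᵐ[m] G
  le_of_testPlan : ∀ π : Measure C(I, X), IsTestPlan p.conjExponent m π →
    ∫⁻ γ, ENNReal.ofReal |f (γ 1) - f (γ 0)| ∂π ≤
      ∫⁻ γ, (∫⁻ t : I, ENNReal.ofReal (G (γ t)) * metricSpeed γ t) ∂π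

/-- `g` is (a representative of) `|Df|`, the `m`-a.e. minimal `p`-weak upper gradient of `f`. -/
def IsMinimalWeakUpperGradient (p : ℝ) (m : Measure X) (f g : X → ℝ) : Prop :=
  IsWeakUpperGradient p m f g ∧ ∀ G, IsWeakUpperGradient p m f G → g ≤ᵐ[m] G

variable {Y : Type*} [MetricSpace Y]

/-- `u ∈ L^p(X, Y_ȳ)`: up to `m`-negligible sets `u` is Borel with separable range, and
`∫ d_Y(u, ȳ)^p dm < ∞`. -/
def MemLpPointed (p : ℝ) (m : Measure X) (ybar : Y) (u : X → Y) : Prop :=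
  AEStronglyMeasurable u m ∧ ∫⁻ x, edist (u x) ybar ^ p ∂m < ∞

/-- `G` is a `p`-weak upper gradient of the metric-valued map `u`: `G ∈ L^p(X)`, `G ≥ 0`, and for
every `1`-Lipschitz `φ : Y → ℝ` one has `φ ∘ u ∈ S^p(X)` with `|D(φ ∘ u)| ≤ G` a.e. -/
structure IsMetricWeakUpperGradient (p : ℝ) (m : Measure X) (u : X → Y) (G : X → ℝ) : Prop where
  memLp : MemLp G (ENNReal.ofReal p) m
  nonneg : 0 ≤ᵐ[m] G
  comp_lipschitz : ∀ φ : Y → ℝ, LipschitzWith 1 φ →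
    ∃ g, IsMinimalWeakUpperGradient p m (φ ∘ u) g ∧ g ≤ᵐ[m] G

/-- `u ∈ W^{1,p}(X, Y_ȳ)`. -/
def MemSobolev (p : ℝ) (m : Measure X) (ybar : Y) (u : X → Y) : Prop :=
  MemLpPointed p m ybar u ∧ ∃ G, IsMetricWeakUpperGradient p m u G

/-- `g` is (a representative of) `|Du|`, the `m`-a.e. minimal `p`-weak upper gradient of `u`. -/
def IsMinimalMetricWeakUpperGradient (p : ℝ) (m : Measure X) (u : X → Y) (g : X → ℝ) : Prop :=
  IsMetricWeakUpperGradient p m u g ∧ ∀ G, IsMetricWeakUpperGradient p m u G → g ≤ᵐ[m] G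

/-- The Korevaar-Schoen `p`-energy density `ks_{p,r}[u]` at scale `r`. For `u ∈ L^p(X, Y_ȳ)` and
`m` finite on balls the integrand is integrable on the ball, for every `x`. -/
def ksDensity (p : ℝ) (m : Measure X) (u : X → Y) (r : ℝ) (x : X) : ℝ :=
  (⨍ y in Metric.ball x r, dist (u x) (u y) ^ p / r ^ p ∂m) ^ (1 / p)

/-- The Korevaar-Schoen energy `E_p(u) = liminf_{r ↓ 0} ∫ ks_{p,r}[u]^p dm`. -/
def ksEnergy (p : ℝ) (m : Measure X) (u : X → Y) : ℝ≥0∞ :=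
  liminf (fun r : ℝ => ∫⁻ x, ENNReal.ofReal (ksDensity p m u r x ^ p) ∂m) (𝓝[>] 0)

/-- `u ∈ KS^{1,p}(X, Y_ȳ)`. -/
def MemKorevaarSchoen (p : ℝ) (m : Measure X) (ybar : Y) (u : X → Y) : Prop :=
  MemLpPointed p m ybar u ∧ ksEnergy p m u < ∞

/-- `f n` converges to `G` weakly in the Banach space `L^p(m)`, `1 < p < ∞`. -/
def TendstoWeakLp {p : ℝ} (hp : 1 < p) (m : Measure X) (f : ℕ → X → ℝ) (G : X → ℝ) : Prop :=
  haveI : Fact (1 ≤ ENNReal.ofReal p) := ⟨ENNReal.one_le_ofReal.2 hp.le⟩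
  ∃ (hf : ∀ n, MemLp (f n) (ENNReal.ofReal p) m) (hG : MemLp G (ENNReal.ofReal p) m),
    Tendsto (fun n => toWeakSpace ℝ (Lp ℝ (ENNReal.ofReal p) m) (hf n).toLp) atTop
      (𝓝 (toWeakSpace ℝ (Lp ℝ (ENNReal.ofReal p) m) hG.toLp))

/-- `m` is uniformly locally doubling with doubling constants `Doub R`, `R > 0`. -/
def IsUniformlyLocallyDoubling (m : Measure X) (Doub : ℝ → ℝ) : Prop :=
  ∀ R, 0 < R → 0 < Doub R ∧ ∀ x : X, ∀ r, 0 < r → r < R →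
    m (Metric.ball x (2 * r)) ≤ ENNReal.ofReal (Doub R) * m (Metric.ball x r)

end Curves

end

/-!
Write `ks_r` for the Korevaar-Schoen density of `u` at scale `r` and `D` for a constant strictly
larger than the infimum of the doubling constants, so that the doubling inequality holds with `D` at
all small scales (`IsUniformlyLocallyDoubling.isDoublingBelow`).

The heart of the matter is a chain argument along an absolutely continuous curve `γ`. Replace
`d(u(x), u(y))` by its average `ballDist` over balls of radius `s = r / 4` around `x` and `y`: this
satisfies the triangle inequality, it differs from `d(u(x), u(y))` by at most
`D ^ 2 * r * (ks_r(x) + ks_r(y))`, and if `x`, `y`, `v` are `s`-close then it is at most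
`D ^ 5 * r * g(v)`, where `g` is the average of `ks_r` over balls of radius `r / 2`
(`ballDist_le`). Cutting `γ` into pieces of length comparable to `s` gives
`d(u(γ_0), u(γ_1)) ≤ 8 * D ^ 5 * ∫ g(γ_t) |γ'_t| dt` plus boundary terms of size `r`
(`chain_le`, `edist_le_of_isACCurve`).

Now integrate over a test plan `π`. The measure `h ↦ ∬ h(γ_t) |γ'_t| dt dπ` has a density `ρ ∈ L^q`
with respect to `m` (`IsTestPlan.exists_density`), so the main term becomes `∫ g ρ`. Averaging over
balls is self-adjoint up to the factor `D`, hence `∫ g ρ ≤ D * ∫ ks_r * ρ_r`, where `ρ_r` is the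
average of `ρ`, and `ρ_r - ρ` tends to zero in `L^q` (`tendsto_lintegral_meanOsc`). If `ks_{ε_n}`
converges weakly to `G`, the limit `n → ∞` gives `∫ d(u(γ_0), u(γ_1)) dπ ≤ 8 * D ^ 6 * ∬ G(γ_t)
|γ'_t| dt dπ` (`IsTestPlan.lintegral_edist_le_of_tendstoWeakLp`), that is, `8 * D ^ 6 * G` is a weak
upper gradient of `φ ∘ u` for every `1`-Lipschitz `φ`.

Three general facts are needed besides. Bounded sequences in `L^p` have weakly convergent
subsequences, because `L^p` is the dual of the separable space `L^q` (`exists_memLp_dual_repr`,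
`exists_subseq_tendstoWeakLp`). The metric speed is a Borel function of curve and time, which makes
Fubini's theorem available for test plans (`measurable_localSpeed`, `IsTestPlan.ae_isACCurve`).
Finally, minimal weak upper gradients exist, since weak upper gradients are stable under pointwise
minima and decreasing limits (`IsWeakUpperGradient.inf`, `exists_ae_least`).
-/

noncomputable section

/-! ### Duality of `L^p` and `L^q` -/

section LpDuality

variable {α : Type*} [MeasurableSpace α] {m : Measure α} {p q : ℝ}

theorem eLpNorm_ofReal_eq {E : Type*} [NormedAddCommGroup E] (hp : 0 < p) (f : α → E) :
    eLpNorm f (ENNReal.ofReal p) m = (∫⁻ x, ‖f x‖ₑ ^ p ∂m) ^ (1 / p) := by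
  rw [eLpNorm_eq_lintegral_rpow_enorm_toReal (by simpa using hp) ENNReal.ofReal_ne_top,
    ENNReal.toReal_ofReal hp.le]

theorem memLp_ofReal_iff {E : Type*} [NormedAddCommGroup E] (hp : 0 < p) {f : α → E} :
    MemLp f (ENNReal.ofReal p) m ↔ AEStronglyMeasurable f m ∧ ∫⁻ x, ‖f x‖ₑ ^ p ∂m < ∞ := by
  rw [MemLp, eLpNorm_ofReal_eq hp, ENNReal.rpow_lt_top_iff_of_pos (by positivity)]

/-- Dominated convergence in `L^p`. -/
theorem tendsto_eLpNorm_sub_of_dominated (hp : 0 < p) {ι : Type*} {l : Filter ι}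
    [l.IsCountablyGenerated] {F : ι → α → ℝ} {f : α → ℝ} {b : α → ℝ}
    (hF : ∀ i, AEStronglyMeasurable (F i) m) (hf : AEStronglyMeasurable f m)
    (hb : MemLp b (ENNReal.ofReal p) m)
    (hFb : ∀ i, ∀ᵐ x ∂m, |F i x| ≤ b x) (hfb : ∀ᵐ x ∂m, |f x| ≤ b x)
    (h : ∀ᵐ x ∂m, Tendsto (fun i => F i x) l (𝓝 (f x))) :
    Tendsto (fun i => eLpNorm (F i - f) (ENNReal.ofReal p) m) l (𝓝 0) := by
  simp_rw [eLpNorm_ofReal_eq hp]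
  have hb2 : MemLp (fun x => 2 * b x) (ENNReal.ofReal p) m := hb.const_mul 2
  have key : Tendsto (fun i => ∫⁻ x, ‖(F i - f) x‖ₑ ^ p ∂m) l (𝓝 (∫⁻ _, 0 ∂m)) := by
    have := ((memLp_ofReal_iff hp).1 hb2).2
    have hmeas : ∀ i, AEMeasurable (fun x => ‖(F i - f) x‖ₑ ^ p) m := fun i =>
      (((hF i).sub hf).enorm).pow_const p
    refine tendsto_lintegral_filter_of_dominated_convergence' (fun x => ‖2 * b x‖ₑ ^ p)
      (Eventually.of_forall hmeas) (Eventually.of_forall fun i => ?_) this.ne ?_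
    · filter_upwards [hFb i, hfb] with x h1 h2
      gcongr
      rw [enorm_le_iff_norm_le]
      have hb0 : 0 ≤ b x := (abs_nonneg _).trans h1
      rw [Real.norm_eq_abs, Real.norm_eq_abs, abs_of_nonneg (a := 2 * b x) (by positivity),
        Pi.sub_apply]
      linarith [abs_sub (F i x) (f x)]
    · filter_upwards [h] with x hx
      have h1 : Tendsto (fun i => ‖(F i - f) x‖ₑ) l (𝓝 0) := by
        have := (hx.sub_const (f x)).enorm
        simpa using this
      have := (ENNReal.continuous_rpow_const (y := p)).tendsto 0 |>.comp h1
      simpa [ENNReal.zero_rpow_of_pos hp, Function.comp_def] using this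
  have := (ENNReal.continuous_rpow_const (y := 1 / p)).tendsto _ |>.comp key
  simpa [ENNReal.zero_rpow_of_pos, hp, Function.comp_def] using this

/-- The converse of Hölder's inequality, tested against the truncated powers `(min ρ k) ^ (q - 1)`
only. -/
theorem lintegral_rpow_le_of_truncation (hpq : p.HolderConjugate q) {ρ : α → ℝ≥0∞}
    (hρ : Measurable ρ) {K : ℝ≥0∞} {S : ℕ → Set α} (hS : ∀ k, MeasurableSet (S k))
    (hSm : Monotone S) (hSU : ⋃ k, S k = Set.univ) (hSf : ∀ k, m (S k) < ∞)
    (h : ∀ k : ℕ, ∫⁻ x in S k, (min (ρ x) k) ^ (q - 1) * ρ x ∂m ≤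
      K * (∫⁻ x in S k, (min (ρ x) k) ^ q ∂m) ^ (1 / p)) :
    ∫⁻ x, ρ x ^ q ∂m ≤ K ^ q := by
  have hq : 0 < q := hpq.symm.pos
  have hq1 : 0 < q - 1 := by linarith [hpq.symm.lt]
  have bound : ∀ k : ℕ, ∫⁻ x in S k, (min (ρ x) k) ^ q ∂m ≤ K ^ q := by
    intro k
    set J := ∫⁻ x in S k, (min (ρ x) k) ^ q ∂m with hJ
    have hJfin : J < ∞ := by
      calc J ≤ ∫⁻ x in S k, (k : ℝ≥0∞) ^ q ∂m := by
            apply lintegral_mono; intro x; dsimp only; gcongr; exact min_le_right _ _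
        _ = (k : ℝ≥0∞) ^ q * m (S k) := by simp
        _ < ∞ := ENNReal.mul_lt_top (ENNReal.rpow_lt_top_of_nonneg hq.le (by simp)) (hSf k)
    have h1 : J ≤ K * J ^ (1 / p) := by
      refine le_trans ?_ (h k)
      apply lintegral_mono; intro x
      dsimp only
      calc (min (ρ x) k) ^ q = (min (ρ x) k) ^ (q - 1) * (min (ρ x) k) ^ (1 : ℝ) := by
            rw [← ENNReal.rpow_add_of_nonneg _ _ hq1.le zero_le_one]; simp
        _ ≤ _ := by rw [ENNReal.rpow_one]; gcongr; exact min_le_left _ _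
    rcases eq_or_ne J 0 with h0 | h0
    · rw [h0]; exact zero_le
    have h2 : J ^ (1 / q) ≤ K := by
      have hJp : J ^ (1 / p) ≠ 0 := by
        simp [ENNReal.rpow_eq_zero_iff, h0, hJfin.ne]
      have hJp' : J ^ (1 / p) ≠ ∞ :=
        (ENNReal.rpow_lt_top_of_nonneg (by have := hpq.pos; positivity) hJfin.ne).ne
      have h3 : J = J ^ (1 / q) * J ^ (1 / p) := by
        rw [← ENNReal.rpow_add _ _ h0 hJfin.ne]
        have : 1 / q + 1 / p = 1 := by
          have := hpq.symm.inv_add_inv_eq_one; simpa [one_div] using this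
        rw [this, ENNReal.rpow_one]
      conv at h1 => lhs; rw [h3]
      exact (ENNReal.mul_le_mul_iff_left hJp hJp').1 h1
    calc J = (J ^ (1 / q)) ^ q := by
          rw [← ENNReal.rpow_mul, one_div_mul_cancel hq.ne', ENNReal.rpow_one]
      _ ≤ K ^ q := by gcongr
  have hlim : Tendsto (fun k : ℕ => ∫⁻ x, (S k).indicator (fun x => (min (ρ x) k) ^ q) x ∂m) atTop
      (𝓝 (∫⁻ x, ρ x ^ q ∂m)) := by
    refine lintegral_tendsto_of_tendsto_of_monotone (fun k => ?_) (.of_forall fun x => ?_)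
      (.of_forall fun x => ?_)
    · exact (((hρ.min measurable_const).pow_const q).indicator (hS k)).aemeasurable
    · intro i j hij
      dsimp only
      by_cases hx : x ∈ S i
      · rw [Set.indicator_of_mem hx, Set.indicator_of_mem (hSm hij hx)]
        gcongr
      · rw [Set.indicator_of_notMem hx]; exact zero_le
    · obtain ⟨i, hi⟩ : ∃ i, x ∈ S i := by
        have : x ∈ ⋃ k, S k := hSU ▸ Set.mem_univ x
        simpa using this
      have h1 : Tendsto (fun k : ℕ => (min (ρ x) k) ^ q) atTop (𝓝 (ρ x ^ q)) := by
        refine (ENNReal.continuous_rpow_const.tendsto _).comp ?_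
        have := (tendsto_const_nhds (x := ρ x) (f := atTop (α := ℕ))).min
          ENNReal.tendsto_nat_nhds_top
        simpa using this
      refine h1.congr' ?_
      filter_upwards [eventually_ge_atTop i] with k hk
      rw [Set.indicator_of_mem (hSm hk hi)]
  refine le_of_tendsto' hlim fun k => ?_
  rw [lintegral_indicator (hS k)]
  exact bound k

/-- On a `σ`-finite measure space there is an everywhere positive weight in `L^p`. -/
theorem exists_pos_memLp [SigmaFinite m] (hp : 0 < p) :
    ∃ w : α → ℝ, (∀ x, 0 < w x) ∧ Measurable w ∧ MemLp w (ENNReal.ofReal p) m := by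
  obtain ⟨g, hg0, hgm, hg⟩ := exists_pos_lintegral_lt_of_sigmaFinite m (ε := 1) one_ne_zero
  refine ⟨fun x => (g x : ℝ) ^ (1 / p), fun x => Real.rpow_pos_of_pos (by exact_mod_cast hg0 x) _,
    (hgm.coe_nnreal_real).pow_const _, ?_⟩
  rw [memLp_ofReal_iff hp]
  refine ⟨((hgm.coe_nnreal_real).pow_const _).aestronglyMeasurable, ?_⟩
  refine lt_of_le_of_lt (lintegral_mono fun x => ?_) (hg.trans ENNReal.one_lt_top)
  have h0 : (0 : ℝ) ≤ g x := (g x).2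
  rw [Real.enorm_eq_ofReal (by positivity), ENNReal.ofReal_rpow_of_nonneg (by positivity) hp.le,
    ← Real.rpow_mul h0, one_div_mul_cancel hp.ne', Real.rpow_one, ENNReal.ofReal_coe_nnreal]

theorem toLp_eq_zero_of_ae {P : ℝ≥0∞} {f : α → ℝ} (hf : MemLp f P m) (h : f =ᵐ[m] 0) :
    hf.toLp = 0 := by
  rw [MemLp.toLp_congr hf MemLp.zero h, MemLp.toLp_zero]

/-- A bounded functional on `L^p(m)` is represented on the functions `w * h`, with `w ∈ L^p` fixed
and `h` bounded, by an integrable function: the Radon-Nikodym density of the signed measure `A ↦ T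
(w 1_A)`. -/
theorem exists_integrable_repr [SigmaFinite m] (hp : 0 < p) [Fact (1 ≤ ENNReal.ofReal p)]
    (T : Lp ℝ (ENNReal.ofReal p) m →L[ℝ] ℝ) {w : α → ℝ} (hw : MemLp w (ENNReal.ofReal p) m) :
    ∃ g : α → ℝ, Measurable g ∧ Integrable g m ∧ ∀ (h : α → ℝ) (c : ℝ), Measurable h →
      (∀ x, |h x| ≤ c) → ∀ hh : MemLp (fun x => w x * h x) (ENNReal.ofReal p) m,
        T hh.toLp = ∫ x, g x * h x ∂m := by
  classical
  have hmem : ∀ {h : α → ℝ} {c : ℝ}, Measurable h → (∀ x, |h x| ≤ c) →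
      MemLp (fun x => w x * h x) (ENNReal.ofReal p) m := by
    intro h c hm hc
    refine MemLp.of_le_mul (c := c) hw (hw.1.mul hm.aestronglyMeasurable) (.of_forall fun x => ?_)
    rw [norm_mul, mul_comm]
    exact mul_le_mul_of_nonneg_right (hc x) (norm_nonneg _)
  have hind : ∀ {A : Set α}, MeasurableSet A →
      MemLp (fun x => w x * A.indicator 1 x) (ENNReal.ofReal p) m := fun {A} hA =>
    hmem (c := 1) (measurable_one.indicator hA) (fun x => by
      by_cases hx : x ∈ A <;> simp [hx])
  have hcont : ∀ {ι : Type} {l : Filter ι} [l.IsCountablyGenerated] {F : ι → α → ℝ} {f : α → ℝ}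
      {c : ℝ}, (∀ i, Measurable (F i)) → Measurable f → (∀ i x, |F i x| ≤ c) → (∀ x, |f x| ≤ c) →
      (∀ᵐ x ∂m, Tendsto (fun i => F i x) l (𝓝 (f x))) →
      ∀ (hF : ∀ i, MemLp (fun x => w x * F i x) (ENNReal.ofReal p) m)
        (hf : MemLp (fun x => w x * f x) (ENNReal.ofReal p) m),
      Tendsto (fun i => T (hF i).toLp) l (𝓝 (T hf.toLp)) := by
    intro ι l _ F f c hFm hfm hFc hfc hlim hF hf
    refine (T.continuous.tendsto _).comp ?_
    rw [Lp.tendsto_Lp_iff_tendsto_eLpNorm'']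
    refine tendsto_eLpNorm_sub_of_dominated hp (fun i => (hF i).1) hf.1
      (b := fun x => c * ‖w x‖) (hw.norm.const_mul c) (fun i => .of_forall fun x => ?_)
      (.of_forall fun x => ?_) ?_
    · rw [abs_mul, mul_comm, Real.norm_eq_abs]
      exact mul_le_mul_of_nonneg_right (hFc i x) (abs_nonneg _)
    · rw [abs_mul, mul_comm, Real.norm_eq_abs]
      exact mul_le_mul_of_nonneg_right (hfc x) (abs_nonneg _)
    · filter_upwards [hlim] with x hx using hx.const_mul _
  -- the signed measure `A ↦ T (w 1_A)`
  let V : SignedMeasure α :=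
    { measureOf' := fun A => if hA : MeasurableSet A then T (hind hA).toLp else 0
      empty' := by
        have : (hind (A := ∅) MeasurableSet.empty).toLp = 0 := by
          exact toLp_eq_zero_of_ae _ (.of_forall fun x => by simp)
        rw [dif_pos MeasurableSet.empty, this, map_zero]
      not_measurable' := fun A hA => by simp [hA]
      m_iUnion' := by
        intro A hA hd
        simp only [hA, MeasurableSet.iUnion hA, dif_pos]
        rw [HasSum]
        have hsum : ∀ (s : Finset ℕ) (x : α), ∑ i ∈ s, (A i).indicator (1 : α → ℝ) x =
            (⋃ i ∈ s, A i).indicator 1 x := fun s x => by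
          rw [Finset.indicator_biUnion_apply]
          intro i _ j _ hij; exact hd hij
        have heq : ∀ s : Finset ℕ, ∑ i ∈ s, T (hind (hA i)).toLp =
            T (hind (s.measurableSet_biUnion fun i _ => hA i)).toLp := fun s => by
          rw [← map_sum]
          congr 1
          apply Lp.ext
          refine (Lp.coeFn_finsetSum s _).trans ?_
          have h1 : ∀ᵐ x : α ∂m, ∀ i : ℕ,
              (MemLp.toLp _ (hind (hA i)) : Lp ℝ (ENNReal.ofReal p) m) x =
                w x * (A i).indicator (1 : α → ℝ) x :=
            ae_all_iff.2 fun i => (hind (hA i)).coeFn_toLp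
          filter_upwards [h1, (hind (s.measurableSet_biUnion fun i _ => hA i)).coeFn_toLp]
            with x hx hx2
          rw [hx2, Finset.sum_apply, ← hsum s x, Finset.mul_sum]
          exact Finset.sum_congr rfl fun i _ => hx i
        simp_rw [heq]
        refine hcont (c := 1) (fun s => measurable_one.indicator
          (s.measurableSet_biUnion fun i _ => hA i)) (measurable_one.indicator (.iUnion hA))
          (fun s x => ?_) (fun x => ?_) (.of_forall fun x => ?_) _ _
        · by_cases hx : x ∈ ⋃ i ∈ s, A i <;> simp only [hx, Set.indicator_of_mem,
            Set.indicator_of_notMem, not_false_eq_true] <;> simp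
        · by_cases hx : x ∈ ⋃ i, A i <;> simp only [hx, Set.indicator_of_mem,
            Set.indicator_of_notMem, not_false_eq_true] <;> simp
        · apply tendsto_const_nhds.congr'
          by_cases hx : x ∈ ⋃ i, A i
          · obtain ⟨i, hi⟩ := Set.mem_iUnion.1 hx
            filter_upwards [eventually_ge_atTop {i}] with s hs
            have : x ∈ ⋃ i ∈ s, A i := Set.mem_biUnion (x := i) (by simpa using hs) hi
            rw [Set.indicator_of_mem hx, Set.indicator_of_mem this]
          · filter_upwards with s
            have : x ∉ ⋃ i ∈ s, A i := fun h => hx (Set.iUnion₂_subset_iUnion _ _ h)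
            rw [Set.indicator_of_notMem hx, Set.indicator_of_notMem this] }
  have hV : ∀ {A : Set α} (hA : MeasurableSet A), V A = T (hind hA).toLp := fun {A} hA =>
    dif_pos hA
  have hac : V ≪ᵥ m.toENNRealVectorMeasure := by
    refine VectorMeasure.AbsolutelyContinuous.mk fun A hA h0 => ?_
    rw [Measure.toENNRealVectorMeasure_apply_measurable hA] at h0
    rw [hV hA]
    have : (hind hA).toLp = 0 := by
      refine toLp_eq_zero_of_ae _ ?_
      filter_upwards [measure_eq_zero_iff_ae_notMem.1 h0] with x hx
      simp [hx]
    rw [this, map_zero]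
  have hg := SignedMeasure.withDensityᵥ_rnDeriv_eq V m hac
  have hgi := SignedMeasure.integrable_rnDeriv V m
  set g := V.rnDeriv m with hgdef
  have hgA : ∀ {A : Set α} (hA : MeasurableSet A), T (hind hA).toLp = ∫ x in A, g x ∂m := by
    intro A hA
    rw [← hV hA, ← withDensityᵥ_apply hgi hA, hg]
  have hgmeas : Measurable g := SignedMeasure.measurable_rnDeriv V m
  refine ⟨g, hgmeas, hgi, ?_⟩
  have hsimple : ∀ (s : SimpleFunc α ℝ) (hh : MemLp (fun x => w x * s x) (ENNReal.ofReal p) m),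
      T hh.toLp = ∫ x, g x * s x ∂m := by
    intro s
    induction s using SimpleFunc.induction with
    | const c hs =>
      rename_i A
      intro hh
      have h1 : hh.toLp = c • (hind hs).toLp := by
        rw [← MemLp.toLp_const_smul]
        apply MemLp.toLp_congr
        refine .of_forall fun x => ?_
        rw [SimpleFunc.coe_piecewise, Pi.smul_apply, smul_eq_mul]
        by_cases hx : x ∈ A
        · simp only [Set.piecewise_eq_of_mem _ _ _ hx, Set.indicator_of_mem hx,
            Pi.one_apply, SimpleFunc.coe_const, Function.const_apply]
          ring
        · simp only [Set.piecewise_eq_of_notMem _ _ _ hx, Set.indicator_of_notMem hx,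
            SimpleFunc.coe_const, Function.const_apply, mul_zero]
      rw [h1, map_smul, hgA hs, ← integral_indicator hs, ← integral_smul]
      congr 1; ext x
      rw [SimpleFunc.coe_piecewise]
      by_cases hx : x ∈ A
      · simp only [Set.piecewise_eq_of_mem _ _ _ hx, Set.indicator_of_mem hx, smul_eq_mul,
          SimpleFunc.coe_const, Function.const_apply]
        ring
      · simp only [Set.piecewise_eq_of_notMem _ _ _ hx, Set.indicator_of_notMem hx, smul_eq_mul,
          SimpleFunc.coe_const, Function.const_apply, mul_zero]
    | @add f₁ f₂ _ h₁ h₂ =>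
      intro hh
      obtain ⟨c₁, hc₁⟩ := f₁.exists_forall_norm_le
      obtain ⟨c₂, hc₂⟩ := f₂.exists_forall_norm_le
      have m₁ := hmem f₁.measurable hc₁
      have m₂ := hmem f₂.measurable hc₂
      have h1 : hh.toLp = m₁.toLp + m₂.toLp := by
        rw [← MemLp.toLp_add]
        apply MemLp.toLp_congr
        exact .of_forall fun x => by simp [mul_add]
      rw [h1, map_add, h₁ m₁, h₂ m₂, ← integral_add]
      · congr 1; ext x; simp [mul_add]
      · exact hgi.mul_bdd (c := c₁) f₁.measurable.aestronglyMeasurable (.of_forall hc₁)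
      · exact hgi.mul_bdd (c := c₂) f₂.measurable.aestronglyMeasurable (.of_forall hc₂)
  intro h c hm hc hh
  rcases isEmpty_or_nonempty α with he | ⟨⟨x₀⟩⟩
  · have : hh.toLp = 0 := toLp_eq_zero_of_ae _ (.of_forall fun x => isEmptyElim x)
    rw [this, map_zero, integral_eq_zero_of_ae (.of_forall fun x => isEmptyElim x)]
  have hc0 : 0 ≤ c := (abs_nonneg _).trans (hc x₀)
  set s := hm.stronglyMeasurable.approxBounded c with hs
  have hsc : ∀ n x, ‖s n x‖ ≤ c := hm.stronglyMeasurable.norm_approxBounded_le hc0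
  have hsl : ∀ᵐ x ∂m, Tendsto (fun n => s n x) atTop (𝓝 (h x)) :=
    hm.stronglyMeasurable.tendsto_approxBounded_ae (.of_forall hc)
  have l1 := hcont (c := c) (fun n => (s n).measurable) hm hsc hc hsl
    (fun n => hmem (s n).measurable (hsc n)) hh
  have l2 : Tendsto (fun n => ∫ x, g x * s n x ∂m) atTop (𝓝 (∫ x, g x * h x ∂m)) := by
    refine tendsto_integral_of_dominated_convergence (fun x => c * ‖g x‖)
      (fun n => (hgmeas.mul (s n).measurable).aestronglyMeasurable) (hgi.norm.const_mul c)
      (fun n => .of_forall fun x => ?_) ?_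
    · rw [norm_mul, mul_comm]
      exact mul_le_mul_of_nonneg_right (hsc n x) (norm_nonneg _)
    · filter_upwards [hsl] with x hx using hx.const_mul _
  refine tendsto_nhds_unique l1 (l2.congr fun n => ?_)
  exact (hsimple (s n) _).symm

/-- Riesz representation: for `1 < p < ∞` and `σ`-finite `m`, every bounded functional on `L^p(m)`
is integration against a function of `L^q(m)`. The density of the weighted functional is divided by
the weight, and the quotient is in `L^q` by the converse of Hölder's inequality. -/
theorem exists_memLp_dual_repr [SigmaFinite m] (hpq : p.HolderConjugate q)
    [Fact (1 ≤ ENNReal.ofReal p)] (T : Lp ℝ (ENNReal.ofReal p) m →L[ℝ] ℝ) :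
    ∃ ρ : α → ℝ, MemLp ρ (ENNReal.ofReal q) m ∧ ∀ (f : α → ℝ)
      (hf : MemLp f (ENNReal.ofReal p) m), T hf.toLp = ∫ x, f x * ρ x ∂m := by
  have hp : 0 < p := hpq.pos
  have hq : 0 < q := hpq.symm.pos
  have hq1 : 0 < q - 1 := by linarith [hpq.symm.lt]
  obtain ⟨w, hw0, hwm, hw⟩ := exists_pos_memLp (m := m) hp
  obtain ⟨g, hgm, hgi, hT⟩ := exists_integrable_repr hp T hw
  set ρ : α → ℝ := fun x => g x / w x with hρ
  have hρm : Measurable ρ := hgm.div hwm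
  have hgρ : ∀ x, g x = w x * ρ x := fun x => by
    rw [hρ]; field_simp [(hw0 x).ne']
  have hholder : ENNReal.HolderTriple (ENNReal.ofReal p) (ENNReal.ofReal q) 1 := by
    have := hpq.ennrealOfReal
    exact this
  -- the sets where the weight is bounded below
  let S : ℕ → Set α := fun k => {x | 1 ≤ (k : ℝ) * w x}
  have hSmeas : ∀ k, MeasurableSet (S k) := fun k =>
    measurableSet_le measurable_const (hwm.const_mul _)
  have hSmono : Monotone S := fun i j hij x (hx : 1 ≤ (i : ℝ) * w x) => by
    have : (i : ℝ) ≤ j := by exact_mod_cast hij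
    exact hx.trans (mul_le_mul_of_nonneg_right this (hw0 x).le)
  have hSU : ⋃ k, S k = Set.univ := by
    refine Set.eq_univ_of_forall fun x => Set.mem_iUnion.2 ?_
    obtain ⟨k, hk⟩ := exists_nat_ge (1 / w x)
    exact ⟨k, by have := hw0 x; rw [div_le_iff₀ this] at hk; exact hk⟩
  have hSfin : ∀ k, m (S k) < ∞ := by
    intro k
    have h1 := ((memLp_ofReal_iff hp).1 (hw.const_mul (k : ℝ))).2
    refine lt_of_le_of_lt ?_ h1
    rw [← lintegral_indicator_one (hSmeas k)]
    refine lintegral_mono fun x => ?_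
    by_cases hx : x ∈ S k
    · rw [Set.indicator_of_mem hx, Pi.one_apply]
      refine ENNReal.one_le_rpow ?_ hp
      rw [Real.enorm_eq_ofReal (mul_nonneg k.cast_nonneg (hw0 x).le)]
      exact ENNReal.one_le_ofReal.2 hx
    · rw [Set.indicator_of_notMem hx]; exact zero_le
  have hρq : ∫⁻ x, ‖ρ x‖ₑ ^ q ∂m ≤ ‖T‖ₑ ^ q := by
    refine lintegral_rpow_le_of_truncation hpq hρm.enorm hSmeas hSmono hSU hSfin fun k => ?_
    set v : α → ℝ := fun x => (S k).indicator (fun x => (min |ρ x| k) ^ (q - 1)) x with hv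
    have hvm : Measurable v :=
      ((hρm.abs.min measurable_const).pow_const _).indicator (hSmeas k)
    have hv0 : ∀ x, 0 ≤ v x := fun x => Set.indicator_nonneg (fun x _ =>
      Real.rpow_nonneg (le_min (abs_nonneg _) k.cast_nonneg) _) x
    -- a bounded `h` with `w * h = sign ρ * (min |ρ| k) ^ (q - 1)` on `S k`
    set h : α → ℝ := fun x => SignType.sign (ρ x) * v x / w x with hh
    have hsm : Measurable fun x => ((SignType.sign (ρ x) : SignType) : ℝ) := by
      have : (fun x => ((SignType.sign (ρ x) : SignType) : ℝ)) = fun x =>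
          {x | 0 < ρ x}.indicator 1 x - {x | ρ x < 0}.indicator 1 x := by
        ext x
        rcases lt_trichotomy (ρ x) 0 with h0 | h0 | h0
        · simp [h0, h0.not_gt]
        · simp [h0]
        · simp [h0, h0.not_gt]
      rw [this]
      exact (measurable_one.indicator (measurableSet_lt measurable_const hρm)).sub
        (measurable_one.indicator (measurableSet_lt hρm measurable_const))
    have hhm : Measurable h := (hsm.mul hvm).div hwm
    have hsle : ∀ x, |((SignType.sign (ρ x) : SignType) : ℝ)| ≤ 1 := fun x => by
      rcases lt_trichotomy (ρ x) 0 with h0 | h0 | h0 <;> simp [h0]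
    have hwh : ∀ x, w x * h x = SignType.sign (ρ x) * v x := fun x => by
      rw [hh]; field_simp [(hw0 x).ne']
    have hhc : ∀ x, |h x| ≤ (k : ℝ) ^ (q - 1) * k := fun x => by
      have h1 : v x ≤ (k : ℝ) ^ (q - 1) * (k * w x) := by
        by_cases hx : x ∈ S k
        · rw [hv]; dsimp only; rw [Set.indicator_of_mem hx]
          have h2 : (min |ρ x| k) ^ (q - 1) ≤ (k : ℝ) ^ (q - 1) :=
            Real.rpow_le_rpow (le_min (abs_nonneg _) k.cast_nonneg) (min_le_right _ _) hq1.le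
          have h3 : (1 : ℝ) ≤ k * w x := hx
          have h4 : (0 : ℝ) ≤ (k : ℝ) ^ (q - 1) := Real.rpow_nonneg k.cast_nonneg _
          nlinarith
        · rw [hv]; dsimp only; rw [Set.indicator_of_notMem hx]
          have := hw0 x
          positivity
      rw [hh]; dsimp only
      rw [abs_div, abs_mul, abs_of_pos (hw0 x), abs_of_nonneg (hv0 x), div_le_iff₀ (hw0 x)]
      calc _ ≤ 1 * v x := mul_le_mul_of_nonneg_right (hsle x) (hv0 x)
        _ ≤ _ := by linarith
    have hvnorm : ∀ x, ‖v x‖ₑ ^ p = (S k).indicator (fun x => (min ‖ρ x‖ₑ k) ^ q) x := fun x => by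
      by_cases hx : x ∈ S k
      · rw [hv]; dsimp only; rw [Set.indicator_of_mem hx, Set.indicator_of_mem hx]
        have h5 : 0 ≤ min |ρ x| (k : ℝ) := le_min (abs_nonneg _) k.cast_nonneg
        rw [Real.enorm_eq_ofReal (Real.rpow_nonneg h5 _),
          ← ENNReal.ofReal_rpow_of_nonneg h5 hq1.le, ← ENNReal.rpow_mul,
          hpq.symm.sub_one_mul_conj, ENNReal.ofReal_min, Real.enorm_eq_ofReal_abs,
          ENNReal.ofReal_natCast]
      · rw [hv]; dsimp only; rw [Set.indicator_of_notMem hx, Set.indicator_of_notMem hx]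
        simp [hp]
    have hvLp : MemLp v (ENNReal.ofReal p) m := by
      rw [memLp_ofReal_iff hp]
      refine ⟨hvm.aestronglyMeasurable, ?_⟩
      simp_rw [hvnorm]
      rw [lintegral_indicator (hSmeas k)]
      calc _ ≤ ∫⁻ x in S k, (k : ℝ≥0∞) ^ q ∂m := by
            apply lintegral_mono; intro x; dsimp only; gcongr; exact min_le_right _ _
        _ = (k : ℝ≥0∞) ^ q * m (S k) := by simp
        _ < ∞ := ENNReal.mul_lt_top (ENNReal.rpow_lt_top_of_nonneg hq.le (by simp)) (hSfin k)
    have hwhLp : MemLp (fun x => w x * h x) (ENNReal.ofReal p) m := by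
      refine hvLp.mono (hwm.mul hhm).aestronglyMeasurable (.of_forall fun x => ?_)
      rw [hwh, norm_mul]
      calc _ ≤ 1 * ‖v x‖ := mul_le_mul_of_nonneg_right (hsle x) (norm_nonneg _)
        _ = _ := one_mul _
    have hTh := hT h _ hhm hhc hwhLp
    have e1 : ∀ x, g x * h x = |ρ x| * v x := fun x => by
      rw [hgρ, mul_right_comm, hwh]
      rw [mul_right_comm, sign_mul_self]
    have e2 : ∫⁻ x in S k, (min ‖ρ x‖ₑ k) ^ (q - 1) * ‖ρ x‖ₑ ∂m =
        ∫⁻ x, ENNReal.ofReal (g x * h x) ∂m := by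
      rw [← lintegral_indicator (hSmeas k)]
      congr 1; ext x
      rw [e1]
      by_cases hx : x ∈ S k
      · rw [hv]; dsimp only; rw [Set.indicator_of_mem hx, Set.indicator_of_mem hx]
        have h5 : 0 ≤ min |ρ x| (k : ℝ) := le_min (abs_nonneg _) k.cast_nonneg
        rw [ENNReal.ofReal_mul (abs_nonneg _), mul_comm, ← ENNReal.ofReal_rpow_of_nonneg h5 hq1.le,
          ENNReal.ofReal_min, Real.enorm_eq_ofReal_abs, ENNReal.ofReal_natCast]
      · rw [hv]; dsimp only; rw [Set.indicator_of_notMem hx, Set.indicator_of_notMem hx]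
        simp
    rw [e2, ← ofReal_integral_eq_lintegral_ofReal
      (hgi.mul_bdd (c := (k : ℝ) ^ (q - 1) * k) hhm.aestronglyMeasurable (.of_forall hhc))
      (.of_forall fun x => (mul_nonneg (abs_nonneg _) (hv0 x)).trans_eq (e1 x).symm), ← hTh]
    have e3 : ENNReal.ofReal (T hwhLp.toLp) ≤ ‖T‖ₑ * ‖hwhLp.toLp‖ₑ := by
      refine (Real.ofReal_le_enorm _).trans ?_
      exact T.le_opENorm _
    refine e3.trans ?_
    gcongr
    rw [Lp.enorm_toLp, eLpNorm_ofReal_eq hp]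
    refine ENNReal.rpow_le_rpow ?_ (by positivity)
    rw [← lintegral_indicator (hSmeas k)]
    refine lintegral_mono fun x => ?_
    rw [← hvnorm]
    gcongr
    rw [hwh, enorm_le_iff_norm_le, norm_mul]
    calc _ ≤ 1 * ‖v x‖ := mul_le_mul_of_nonneg_right (hsle x) (norm_nonneg _)
        _ = _ := one_mul _
  have hρLp : MemLp ρ (ENNReal.ofReal q) m :=
    (memLp_ofReal_iff hq).2 ⟨hρm.aestronglyMeasurable,
      hρq.trans_lt (ENNReal.rpow_lt_top_of_nonneg hq.le enorm_ne_top)⟩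
  refine ⟨ρ, hρLp, fun f hf => ?_⟩
  -- both sides are continuous in `f`, and agree on the functions bounded by a multiple of `w`
  wlog hfm : StronglyMeasurable f generalizing f
  · have h1 := hf.1.ae_eq_mk
    have hf' : MemLp (hf.1.mk f) (ENNReal.ofReal p) m := hf.ae_eq h1
    rw [MemLp.toLp_congr hf hf' h1, this _ hf' hf.1.stronglyMeasurable_mk]
    exact integral_congr_ae (h1.symm.mul .rfl)
  set A : ℕ → Set α := fun k => {x | |f x| ≤ k * w x} with hA
  have hAm : ∀ k, MeasurableSet (A k) := fun k =>
    measurableSet_le hfm.measurable.abs (hwm.const_mul _)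
  set F : ℕ → α → ℝ := fun k x => (A k).indicator f x with hF
  have hFm : ∀ k, Measurable (F k) := fun k => hfm.measurable.indicator (hAm k)
  have hFle : ∀ k x, |F k x| ≤ |f x| := fun k x => by
    by_cases hx : x ∈ A k <;> simp [hF, hx]
  have hFLp : ∀ k, MemLp (F k) (ENNReal.ofReal p) m := fun k =>
    hf.mono (hFm k).aestronglyMeasurable (.of_forall (hFle k))
  have hFlim : ∀ x, Tendsto (fun k => F k x) atTop (𝓝 (f x)) := fun x => by
    obtain ⟨k₀, hk₀⟩ := exists_nat_ge (|f x| / w x)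
    refine tendsto_const_nhds.congr' ?_
    filter_upwards [eventually_ge_atTop k₀] with k hk
    have : x ∈ A k := by
      rw [div_le_iff₀ (hw0 x)] at hk₀
      have hk' : (k₀ : ℝ) ≤ k := by exact_mod_cast hk
      exact hk₀.trans (mul_le_mul_of_nonneg_right hk' (hw0 x).le)
    rw [hF]; dsimp only; rw [Set.indicator_of_mem this]
  have hfρ : Integrable (fun x => f x * ρ x) m := by
    have := hρLp.mul hf (r := 1)
    exact memLp_one_iff_integrable.1 this
  have l1 : Tendsto (fun k => T (hFLp k).toLp) atTop (𝓝 (T hf.toLp)) := by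
    refine (T.continuous.tendsto _).comp ?_
    rw [Lp.tendsto_Lp_iff_tendsto_eLpNorm'']
    exact tendsto_eLpNorm_sub_of_dominated hp (fun k => (hFLp k).1) hf.1 hf.norm
      (fun k => .of_forall (hFle k)) (.of_forall fun x => le_rfl) (.of_forall hFlim)
  have l2 : Tendsto (fun k => ∫ x, F k x * ρ x ∂m) atTop (𝓝 (∫ x, f x * ρ x ∂m)) := by
    refine tendsto_integral_of_dominated_convergence (fun x => ‖f x * ρ x‖)
      (fun k => ((hFm k).mul hρm).aestronglyMeasurable) hfρ.norm
      (fun k => .of_forall fun x => ?_) (.of_forall fun x => (hFlim x).mul_const _)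
    rw [norm_mul, norm_mul]
    exact mul_le_mul_of_nonneg_right (hFle k x) (norm_nonneg _)
  refine tendsto_nhds_unique l1 (l2.congr fun k => ?_)
  have hFw : (fun x => w x * (F k x / w x)) = F k := by
    ext x; field_simp [(hw0 x).ne']
  have h1 : MemLp (fun x => w x * (F k x / w x)) (ENNReal.ofReal p) m := by
    rw [hFw]; exact hFLp k
  have h2 := hT (fun x => F k x / w x) k ((hFm k).div hwm) (fun x => by
    rw [abs_div, abs_of_pos (hw0 x), div_le_iff₀ (hw0 x)]
    by_cases hx : x ∈ A k
    · simp only [hF, Set.indicator_of_mem hx]; exact hx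
    · simp only [hF, Set.indicator_of_notMem hx, abs_zero]
      have := hw0 x; positivity) h1
  rw [MemLp.toLp_congr (hFLp k) h1 (.of_forall fun x => by rw [hFw]), h2]
  refine integral_congr_ae (.of_forall fun x => ?_)
  simp only [hρ]; ring

end LpDuality

/-! ### Weak convergence in `L^p` -/

section WeakConvergence

theorem tendsto_toWeakSpace_iff {E ι : Type*} [NormedAddCommGroup E] [NormedSpace ℝ E]
    {l : Filter ι} {f : ι → E} {x : E} :
    Tendsto (fun i => toWeakSpace ℝ E (f i)) l (𝓝 (toWeakSpace ℝ E x)) ↔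
      ∀ T : StrongDual ℝ E, Tendsto (fun i => T (f i)) l (𝓝 (T x)) := by
  refine WeakBilin.tendsto_iff_forall_eval_tendsto (topDualPairing ℝ E).flip ?_
  intro x y hxy
  rw [SeparatingDual.eq_iff_forall_dual_eq (R := ℝ)]
  exact fun g => LinearMap.congr_fun hxy g

variable {α : Type*} [MeasurableSpace α] {m : Measure α} {p q : ℝ}

/-- Integration against an `L^q` function is a bounded functional on `L^p`. -/
theorem exists_pairing (hpq : p.HolderConjugate q) [Fact (1 ≤ ENNReal.ofReal p)]
    {ρ : α → ℝ} (hρ : MemLp ρ (ENNReal.ofReal q) m) :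
    ∃ T : StrongDual ℝ (Lp ℝ (ENNReal.ofReal p) m), ∀ (f : α → ℝ)
      (hf : MemLp f (ENNReal.ofReal p) m), T hf.toLp = ∫ x, f x * ρ x ∂m := by
  have : Fact (1 ≤ ENNReal.ofReal q) := ⟨ENNReal.one_le_ofReal.2 hpq.symm.lt.le⟩
  have : (ENNReal.ofReal p).HolderConjugate (ENNReal.ofReal q) := hpq.ennrealOfReal
  refine ⟨((ContinuousLinearMap.mul ℝ ℝ).lpPairing m (ENNReal.ofReal p)
    (ENNReal.ofReal q)).flip hρ.toLp, fun f hf => ?_⟩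
  rw [ContinuousLinearMap.flip_apply, ContinuousLinearMap.lpPairing_eq_integral]
  refine integral_congr_ae ?_
  filter_upwards [hf.coeFn_toLp, hρ.coeFn_toLp] with x h1 h2
  rw [h1, h2, ContinuousLinearMap.mul_apply']

theorem TendstoWeakLp.tendsto_integral_mul {hp : 1 < p} {f : ℕ → α → ℝ} {G : α → ℝ}
    (h : TendstoWeakLp hp m f G) (hpq : p.HolderConjugate q) {ρ : α → ℝ}
    (hρ : MemLp ρ (ENNReal.ofReal q) m) :
    Tendsto (fun n => ∫ x, f n x * ρ x ∂m) atTop (𝓝 (∫ x, G x * ρ x ∂m)) := by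
  have : Fact (1 ≤ ENNReal.ofReal p) := ⟨ENNReal.one_le_ofReal.2 hp.le⟩
  obtain ⟨hf, hG, h⟩ := h
  obtain ⟨T, hT⟩ := exists_pairing hpq hρ
  simpa only [hT] using tendsto_toWeakSpace_iff.1 h T

/-- Weakly convergent sequences are bounded, by the uniform boundedness principle in the bidual. -/
theorem TendstoWeakLp.exists_eLpNorm_le {hp : 1 < p} {f : ℕ → α → ℝ} {G : α → ℝ}
    (h : TendstoWeakLp hp m f G) : ∃ K : ℝ≥0, ∀ n, eLpNorm (f n) (ENNReal.ofReal p) m ≤ K := by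
  have : Fact (1 ≤ ENNReal.ofReal p) := ⟨ENNReal.one_le_ofReal.2 hp.le⟩
  obtain ⟨hf, hG, h⟩ := h
  rw [tendsto_toWeakSpace_iff] at h
  obtain ⟨K, hK⟩ := banach_steinhaus
    (g := fun n => NormedSpace.inclusionInDoubleDual ℝ _ (hf n).toLp) (fun T => by
      obtain ⟨C, hC⟩ := (h T).norm.isBoundedUnder_le.bddAbove_range
      exact ⟨C, fun n => hC ⟨n, rfl⟩⟩)
  refine ⟨K.toNNReal, fun n => ?_⟩
  have h1 : ‖(hf n).toLp‖ ≤ K := by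
    rw [← (NormedSpace.inclusionInDoubleDualLi ℝ).norm_map]; exact hK n
  rw [Lp.norm_toLp] at h1
  exact (ENNReal.le_ofReal_iff_toReal_le (hf n).2.ne (ENNReal.toReal_nonneg.trans h1)).2 h1

/-- Bounded sequences of `L^p(m)`, `1 < p < ∞`, have weakly convergent subsequences: they are
bounded in the dual of the separable space `L^q(m)`, where the sequential Banach-Alaoglu theorem
applies. -/
theorem exists_subseq_tendstoWeakLp [SigmaFinite m] [IsSeparable m] (hp : 1 < p)
    {f : ℕ → α → ℝ} (hf : ∀ n, MemLp (f n) (ENNReal.ofReal p) m) {K : ℝ≥0}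
    (hK : ∀ n, eLpNorm (f n) (ENNReal.ofReal p) m ≤ K) :
    ∃ (φ : ℕ → ℕ) (G : α → ℝ), StrictMono φ ∧ TendstoWeakLp hp m (fun n => f (φ n)) G := by
  have hpq := Real.HolderConjugate.conjExponent hp
  set q := p.conjExponent
  have : Fact (1 ≤ ENNReal.ofReal p) := ⟨ENNReal.one_le_ofReal.2 hp.le⟩
  have : Fact (1 ≤ ENNReal.ofReal q) := ⟨ENNReal.one_le_ofReal.2 hpq.symm.lt.le⟩
  have : Fact (ENNReal.ofReal q ≠ ∞) := ⟨ENNReal.ofReal_ne_top⟩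
  have : (ENNReal.ofReal p).HolderConjugate (ENNReal.ofReal q) := hpq.ennrealOfReal
  let J : Lp ℝ (ENNReal.ofReal p) m →L[ℝ] Lp ℝ (ENNReal.ofReal q) m →L[ℝ] ℝ :=
    (ContinuousLinearMap.mul ℝ ℝ).lpPairing m (ENNReal.ofReal p) (ENNReal.ofReal q)
  have hJ : ∀ (g : α → ℝ) (hg : MemLp g (ENNReal.ofReal p) m) (ρ : α → ℝ)
      (hρ : MemLp ρ (ENNReal.ofReal q) m), J hg.toLp hρ.toLp = ∫ x, g x * ρ x ∂m := by
    intro g hg ρ hρ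
    rw [ContinuousLinearMap.lpPairing_eq_integral]
    refine integral_congr_ae ?_
    filter_upwards [hg.coeFn_toLp, hρ.coeFn_toLp] with x h1 h2
    rw [h1, h2, ContinuousLinearMap.mul_apply']
  have hmem : ∀ n, StrongDual.toWeakDual (J (hf n).toLp) ∈
      WeakDual.toStrongDual ⁻¹' Metric.closedBall (0 : StrongDual ℝ _) (‖J‖ * K) := by
    intro n
    rw [Set.mem_preimage, mem_closedBall_zero_iff]
    refine (J.le_opNorm _).trans ?_
    gcongr
    rw [Lp.norm_toLp]
    exact ENNReal.toReal_le_coe_of_le_coe (hK n)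
  obtain ⟨ℓ, -, φ, hφ, hlim⟩ := WeakDual.isSeqCompact_closedBall ℝ _ _ _ hmem
  obtain ⟨G, hG, hGr⟩ := exists_memLp_dual_repr hpq.symm (WeakDual.toStrongDual ℓ)
  refine ⟨φ, G, hφ, fun n => hf _, hG, tendsto_toWeakSpace_iff.2 fun T => ?_⟩
  obtain ⟨ρ, hρ, hTr⟩ := exists_memLp_dual_repr hpq T
  have h1 := ((WeakDual.eval_continuous hρ.toLp).tendsto ℓ).comp hlim
  have h2 : ℓ hρ.toLp = T hG.toLp := by
    rw [hTr]
    refine (hGr ρ hρ).trans ?_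
    simp_rw [mul_comm]
  rw [← h2]
  refine h1.congr fun n => ?_
  rw [hTr]
  exact hJ _ (hf _) ρ hρ

theorem TendstoWeakLp.ae_nonneg [SigmaFinite m] {hp : 1 < p} {f : ℕ → α → ℝ} {G : α → ℝ}
    (h : TendstoWeakLp hp m f G) (hf : ∀ n x, 0 ≤ f n x) : 0 ≤ᵐ[m] G := by
  have hpq := Real.HolderConjugate.conjExponent hp
  have hG := h.choose_spec.choose
  refine ae_nonneg_of_forall_setIntegral_nonneg_of_sigmaFinite (fun s hs hms => ?_)
    fun s hs hms => ?_
  · have : IsFiniteMeasure (m.restrict s) := isFiniteMeasure_restrict.2 hms.ne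
    exact (hG.restrict s).integrable (ENNReal.one_le_ofReal.2 hp.le)
  · have h1 := h.tendsto_integral_mul hpq
      (memLp_indicator_const (ENNReal.ofReal p.conjExponent) hs (1 : ℝ) (.inr hms.ne))
    have h2 : ∀ g : α → ℝ, ∫ x, g x * s.indicator (fun _ => (1 : ℝ)) x ∂m = ∫ x in s, g x ∂m := by
      intro g
      rw [← integral_indicator hs]
      congr 1; ext x
      by_cases hx : x ∈ s <;> simp [hx]
    simp_rw [h2] at h1
    exact ge_of_tendsto' h1 fun n => setIntegral_nonneg hs fun x _ => hf n x

end WeakConvergence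

/-! ### The metric speed of curves -/

section Speed

variable {X : Type*} [MetricSpace X]

/-- The difference quotient `d(γ_s, γ_t) / |s - t|` as an extended nonnegative number. -/
def speedQuotient (γ : C(I, X)) (t s : I) : ℝ≥0∞ :=
  ENNReal.ofReal (dist (γ s) (γ t) / |(s : ℝ) - t|)

open Classical in
/-- The limit of the difference quotients of `γ` at `t` in `[0,∞]`, and `∞` if there is none. Unlike
`metricSpeed` it does not refer to absolute continuity, hence it is a Borel function of `(γ, t)`. -/
def localSpeed (γ : C(I, X)) (t : I) : ℝ≥0∞ :=
  if liminf (speedQuotient γ t) (𝓝[≠] t) = limsup (speedQuotient γ t) (𝓝[≠] t) then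
    limsup (speedQuotient γ t) (𝓝[≠] t) else ∞

theorem tendsto_localSpeed {γ : C(I, X)} {t : I} (h : localSpeed γ t ≠ ∞) :
    Tendsto (speedQuotient γ t) (𝓝[≠] t) (𝓝 (localSpeed γ t)) := by
  unfold localSpeed at h ⊢
  split_ifs at h ⊢ with h1
  · exact tendsto_of_liminf_eq_limsup h1 rfl
  · exact absurd rfl h

theorem localSpeed_eq_of_tendsto {γ : C(I, X)} {t : I} {a : ℝ≥0∞}
    (h : Tendsto (speedQuotient γ t) (𝓝[≠] t) (𝓝 a)) : localSpeed γ t = a := by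
  rw [localSpeed, if_pos (h.liminf_eq.trans h.limsup_eq.symm), h.limsup_eq]

open Classical in
theorem metricSpeed_eq (γ : C(I, X)) (t : I) :
    metricSpeed γ t = if IsACCurve γ then localSpeed γ t else ∞ := by
  unfold metricSpeed
  by_cases hac : IsACCurve γ
  swap
  · rw [if_neg (fun h => hac h.1), if_neg hac]
  rw [if_pos hac]
  by_cases hL : ∃ L : ℝ, Tendsto (fun s : I => dist (γ s) (γ t) / |(s : ℝ) - t|) (𝓝[≠] t) (𝓝 L)
  · rw [if_pos ⟨hac, hL⟩]
    obtain ⟨L, hL⟩ := hL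
    rw [hL.limUnder_eq]
    exact (localSpeed_eq_of_tendsto ((ENNReal.continuous_ofReal.tendsto L).comp hL)).symm
  · rw [if_neg (fun h => hL h.2)]
    by_contra hne
    have h1 := tendsto_localSpeed (Ne.symm hne)
    apply hL
    refine ⟨(localSpeed γ t).toReal, ?_⟩
    have h2 := (ENNReal.tendsto_toReal (Ne.symm hne)).comp h1
    refine h2.congr fun s => ?_
    rw [Function.comp_apply, speedQuotient, ENNReal.toReal_ofReal (by positivity)]

theorem metricSpeed_eq_localSpeed {γ : C(I, X)} (h : IsACCurve γ) (t : I) :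
    metricSpeed γ t = localSpeed γ t := by rw [metricSpeed_eq, if_pos h]

theorem localSpeed_le_metricSpeed (γ : C(I, X)) (t : I) : localSpeed γ t ≤ metricSpeed γ t := by
  rw [metricSpeed_eq]; split_ifs
  · exact le_rfl
  · exact le_top

/-- The difference quotient at a fixed second time `s` is jointly continuous off the diagonal. Hence
suprema and infima over the uncountably many `s` near `t` are semicontinuous, and the limit superior
and the limit inferior are Borel. -/
theorem isOpen_speedQuotient_preimage {V : Set ℝ≥0∞} (hV : IsOpen V) (s : I) (δ : ℝ) :
    IsOpen {z : C(I, X) × I | (s ≠ z.2 ∧ dist s z.2 < δ) ∧ speedQuotient z.1 z.2 s ∈ V} := by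
  have hU : IsOpen {z : C(I, X) × I | s ≠ z.2 ∧ dist s z.2 < δ} :=
    (isOpen_ne_fun continuous_const continuous_snd).inter
      (isOpen_lt (continuous_const.dist continuous_snd) continuous_const)
  refine ContinuousOn.isOpen_inter_preimage (f := fun z : C(I, X) × I => speedQuotient z.1 z.2 s)
    ?_ hU hV
  refine ENNReal.continuous_ofReal.comp_continuousOn (ContinuousOn.div ?_ ?_ ?_)
  · exact Continuous.continuousOn (by fun_prop)
  · exact Continuous.continuousOn (by fun_prop)
  · rintro ⟨γ, t⟩ ⟨h, -⟩
    rw [abs_ne_zero, sub_ne_zero]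
    exact fun h' => h (Subtype.ext h')

theorem hasBasis_nhdsNE (t : I) :
    (𝓝[≠] t).HasBasis (fun _ : ℕ => True) fun n => {s | s ≠ t ∧ dist s t < 1 / ((n : ℝ) + 1)} := by
  have := nhdsWithin_hasBasis (Metric.nhds_basis_ball_inv_nat_succ (x := t)) {t}ᶜ
  refine this.congr (fun _ => Iff.rfl) fun n _ => ?_
  ext s
  simp [and_comm]

theorem measurable_limsup_speedQuotient :
    Measurable fun z : C(I, X) × I => limsup (speedQuotient z.1 z.2) (𝓝[≠] z.2) := by
  simp_rw [fun z : C(I, X) × I => (hasBasis_nhdsNE z.2).limsup_eq_iInf_iSup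
    (u := speedQuotient z.1 z.2), iInf_true]
  refine Measurable.iInf fun n => measurable_of_Ioi fun a => ?_
  have : (fun z : C(I, X) × I => ⨆ s ∈ {s | s ≠ z.2 ∧ dist s z.2 < 1 / ((n : ℝ) + 1)},
      speedQuotient z.1 z.2 s) ⁻¹' Set.Ioi a = ⋃ s : I, {z : C(I, X) × I |
        (s ≠ z.2 ∧ dist s z.2 < 1 / ((n : ℝ) + 1)) ∧ speedQuotient z.1 z.2 s ∈ Set.Ioi a} := by
    ext z
    simp [lt_iSup_iff]
  rw [this]
  exact (isOpen_iUnion fun s => isOpen_speedQuotient_preimage isOpen_Ioi s _).measurableSet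

theorem measurable_liminf_speedQuotient :
    Measurable fun z : C(I, X) × I => liminf (speedQuotient z.1 z.2) (𝓝[≠] z.2) := by
  simp_rw [fun z : C(I, X) × I => (hasBasis_nhdsNE z.2).liminf_eq_iSup_iInf
    (u := speedQuotient z.1 z.2), iSup_true]
  refine Measurable.iSup fun n => measurable_of_Iio fun a => ?_
  have : (fun z : C(I, X) × I => ⨅ s ∈ {s | s ≠ z.2 ∧ dist s z.2 < 1 / ((n : ℝ) + 1)},
      speedQuotient z.1 z.2 s) ⁻¹' Set.Iio a = ⋃ s : I, {z : C(I, X) × I |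
        (s ≠ z.2 ∧ dist s z.2 < 1 / ((n : ℝ) + 1)) ∧ speedQuotient z.1 z.2 s ∈ Set.Iio a} := by
    ext z
    simp [iInf_lt_iff]
  rw [this]
  exact (isOpen_iUnion fun s => isOpen_speedQuotient_preimage isOpen_Iio s _).measurableSet

theorem measurable_localSpeed : Measurable fun z : C(I, X) × I => localSpeed z.1 z.2 := by
  have h := measurableSet_eq_fun (measurable_liminf_speedQuotient (X := X))
    measurable_limsup_speedQuotient
  unfold localSpeed
  exact Measurable.ite h measurable_limsup_speedQuotient measurable_const

theorem measurable_localSpeed_right (γ : C(I, X)) : Measurable (localSpeed γ) :=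
  (measurable_localSpeed (X := X)).of_uncurry_left (f := localSpeed)

/-- A real function dominated in increments by an absolutely continuous one. -/
theorem AbsolutelyContinuousOnInterval.of_dist_le {f g : ℝ → ℝ} {a b : ℝ}
    (hg : AbsolutelyContinuousOnInterval g a b)
    (h : ∀ x ∈ Set.uIcc a b, ∀ y ∈ Set.uIcc a b, dist (f x) (f y) ≤ dist (g x) (g y)) :
    AbsolutelyContinuousOnInterval f a b := by
  refine squeeze_zero' (.of_forall fun E => Finset.sum_nonneg fun _ _ => dist_nonneg) ?_ hg
  have : ∀ᶠ E in AbsolutelyContinuousOnInterval.totalLengthFilter ⊓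
      𝓟 (AbsolutelyContinuousOnInterval.disjWithin a b),
      E ∈ AbsolutelyContinuousOnInterval.disjWithin a b :=
    eventually_inf_principal.2 (.of_forall fun _ h => h)
  filter_upwards [this] with E hE
  exact Finset.sum_le_sum fun i hi => h _ (hE.1 i hi).1 _ (hE.1 i hi).2

theorem lintegral_unitInterval_Ioc (f : ℝ → ℝ≥0∞) (s t : I) :
    ∫⁻ r : I in Set.Ioc s t, f r = ∫⁻ r in Set.Ioc (s : ℝ) t, f r := by
  have h1 : MeasurableEmbedding ((↑) : I → ℝ) := MeasurableEmbedding.subtype_coe measurableSet_Icc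
  have h2 : Measure.map ((↑) : I → ℝ) volume = volume.restrict (Set.Icc 0 1) :=
    map_comap_subtype_coe measurableSet_Icc volume
  have h3 : Set.Ioc s t = ((↑) : I → ℝ) ⁻¹' Set.Ioc (s : ℝ) t := by ext; simp
  rw [h3, ← h1.lintegral_map, ← h1.restrict_map, h2, Measure.restrict_restrict measurableSet_Ioc,
    Set.inter_eq_left.2]
  exact fun x hx => ⟨s.2.1.trans hx.1.le, hx.2.trans t.2.2⟩

theorem enorm_deriv_le_localSpeed {γ : C(I, X)} {g : ℝ → ℝ} {t : I}
    (hg : DifferentiableAt ℝ g t)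
    (h : ∀ s : I, |g s - g t| ≤ dist (γ s) (γ t)) : ‖deriv g t‖ₑ ≤ localSpeed γ t := by
  rcases eq_or_ne (localSpeed γ t) ∞ with htop | htop
  · rw [htop]; exact le_top
  have h1 := tendsto_localSpeed htop
  have h2 : Tendsto ((↑) : I → ℝ) (𝓝[≠] t) (𝓝[≠] (t : ℝ)) :=
    tendsto_nhdsWithin_iff.2 ⟨(continuous_subtype_val.tendsto t).mono_left nhdsWithin_le_nhds,
      by filter_upwards [self_mem_nhdsWithin] with s hs using fun h' => hs (Subtype.ext h')⟩
  have h3 := (hasDerivAt_iff_tendsto_slope.1 hg.hasDerivAt).comp h2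
  refine le_of_tendsto_of_tendsto h3.enorm h1 (.of_forall fun s => ?_)
  simp only [Function.comp_apply, slope_def_field, speedQuotient]
  rw [Real.enorm_eq_ofReal_abs, abs_div]
  gcongr
  exact h s

/-- Along an absolutely continuous curve the distance is bounded by the integral of the speed: the
function `r ↦ d(γ_r, γ_s)` is absolutely continuous with derivative bounded by the speed. -/
theorem IsACCurve.edist_le {γ : C(I, X)} (h : IsACCurve γ) {s t : I} (hst : s ≤ t) :
    edist (γ s) (γ t) ≤ ∫⁻ r in Set.Ioc s t, localSpeed γ r := by
  obtain ⟨f, hf, hd⟩ := h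
  -- curves are extended to the real line by their endpoint values
  set pr : ℝ → I := Set.projIcc 0 1 zero_le_one with hpr
  have hprI : ∀ r : I, pr r = r := fun r => Set.projIcc_val _ r
  set g : ℝ → ℝ := fun r => dist (γ (pr r)) (γ s) with hg
  have hgle : ∀ a b : I, |g a - g b| ≤ dist (γ a) (γ b) := fun a b => by
    simp only [hg, hprI]; exact abs_dist_sub_le _ _ _
  have hac : AbsolutelyContinuousOnInterval g 0 1 := by
    refine (hf.absolutelyContinuousOnInterval_intervalIntegral (c := 0)
      Set.left_mem_uIcc).of_dist_le ?_
    rw [Set.uIcc_of_le zero_le_one]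
    have hint : ∀ x ∈ Set.Icc (0 : ℝ) 1, IntervalIntegrable f volume 0 x := fun x hx =>
      hf.mono_set (by
        rw [Set.uIcc_of_le hx.1, Set.uIcc_of_le zero_le_one]; exact Set.Icc_subset_Icc_right hx.2)
    have key : ∀ x ∈ Set.Icc (0 : ℝ) 1, ∀ y ∈ Set.Icc (0 : ℝ) 1, x ≤ y →
        dist (g x) (g y) ≤ dist (∫ v in (0 : ℝ)..x, f v) (∫ v in (0 : ℝ)..y, f v) := by
      intro x hx y hy hxy
      have h1 := hgle ⟨x, hx⟩ ⟨y, hy⟩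
      have h2 := hd ⟨x, hx⟩ ⟨y, hy⟩ hxy
      rw [dist_comm (∫ v in (0 : ℝ)..x, f v), Real.dist_eq, Real.dist_eq,
        intervalIntegral.integral_interval_sub_left (hint y hy) (hint x hx)]
      exact h1.trans (h2.trans (le_abs_self _))
    intro x hx y hy
    rcases le_total x y with hxy | hxy
    · exact key x hx y hy hxy
    · rw [dist_comm (g x), dist_comm (∫ v in (0 : ℝ)..x, f v)]; exact key y hy x hx hxy
  have hac' : AbsolutelyContinuousOnInterval g s t := hac.mono (by
    rw [Set.uIcc_of_le zero_le_one, Set.uIcc_of_le (show (s : ℝ) ≤ t from hst)]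
    exact Set.Icc_subset_Icc s.2.1 t.2.2)
  have h1 : edist (γ s) (γ t) = ENNReal.ofReal (∫ r in (s : ℝ)..t, deriv g r) := by
    rw [hac'.integral_deriv_eq_sub]
    simp only [hg, hprI, dist_self, sub_zero]
    rw [dist_comm, edist_dist]
  rw [h1, intervalIntegral.integral_of_le hst]
  refine (Real.ofReal_le_enorm _).trans ((enorm_integral_le_lintegral_enorm _).trans ?_)
  rw [← lintegral_unitInterval_Ioc (fun r => ‖deriv g r‖ₑ)]
  have h2 : ∀ᵐ r : I, DifferentiableAt ℝ g r := by
    have h3 := hac.ae_differentiableAt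
    rw [Set.uIcc_of_le zero_le_one] at h3
    exact (ae_restrict_iff_subtype measurableSet_Icc).1 ((ae_restrict_iff' measurableSet_Icc).2 h3)
  exact lintegral_mono_ae (ae_restrict_of_ae (h2.mono fun r hr =>
    enorm_deriv_le_localSpeed hr fun s' => hgle s' r))

/-- A curve with integrable local speed bounding its increments is absolutely continuous. It
suffices to control the increments over a dense set of times. -/
theorem isACCurve_of_edist_le {γ : C(I, X)} {D : Set I} (hD : Dense D)
    (hfin : ∫⁻ r, localSpeed γ r ≠ ∞)
    (h : ∀ s ∈ D, ∀ t ∈ D, s ≤ t → edist (γ s) (γ t) ≤ ∫⁻ r in Set.Ioc s t, localSpeed γ r) :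
    IsACCurve γ := by
  have h' : ∀ s t : I, s ≤ t → edist (γ s) (γ t) ≤ ∫⁻ r in Set.Ioc s t, localSpeed γ r := by
    intro s t hst
    rcases hst.eq_or_lt with rfl | hst
    · simp
    obtain ⟨c, hsc, hct⟩ := exists_between hst
    obtain ⟨a, -, ha, hat⟩ := hD.exists_seq_strictAnti_tendsto_of_lt hsc
    obtain ⟨b, -, hb, hbt⟩ := hD.exists_seq_strictMono_tendsto_of_lt hct
    have h1 : Tendsto (fun n => edist (γ (a n)) (γ (b n))) atTop (𝓝 (edist (γ s) (γ t))) :=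
      ((γ.continuous.tendsto s).comp hat).edist ((γ.continuous.tendsto t).comp hbt)
    refine le_of_tendsto' h1 fun n => (h _ (ha n).2 _ (hb n).2
      ((ha n).1.2.le.trans (hb n).1.1.le)).trans ?_
    exact lintegral_mono_set (Set.Ioc_subset_Ioc (ha n).1.1.le (hb n).1.2.le)
  set pr : ℝ → I := Set.projIcc 0 1 zero_le_one with hpr
  have hprI : ∀ r : I, pr r = r := fun r => Set.projIcc_val _ r
  have hm : Measurable fun r => localSpeed γ (pr r) :=
    (measurable_localSpeed_right γ).comp continuous_projIcc.measurable
  have hint : ∀ s t : I, ∫⁻ r in Set.Ioc (s : ℝ) t, localSpeed γ (pr r) =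
      ∫⁻ r in Set.Ioc s t, localSpeed γ r := fun s t => by
    rw [← lintegral_unitInterval_Ioc]; simp_rw [hprI]
  have hlt : ∀ s t : I, ∫⁻ r in Set.Ioc (s : ℝ) t, localSpeed γ (pr r) ≠ ∞ := fun s t => by
    rw [hint]; exact ((setLIntegral_le_lintegral _ _).trans_lt hfin.lt_top).ne
  refine ⟨fun r => (localSpeed γ (pr r)).toReal, ?_, fun s t hst => ?_⟩
  · rw [intervalIntegrable_iff_integrableOn_Ioc_of_le zero_le_one]
    exact integrable_toReal_of_lintegral_ne_top hm.aemeasurable (hlt 0 1)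
  · have hst' : (s : ℝ) ≤ t := hst
    rw [intervalIntegral.integral_of_le hst', integral_toReal hm.aemeasurable
      (ae_lt_top hm (hlt s t)), hint, dist_edist]
    exact ENNReal.toReal_mono (hint s t ▸ hlt s t) (h' s t hst)

end Speed

/-! ### Test plans -/

section TestPlan

variable {X : Type*} [MetricSpace X]

theorem measurable_lintegral_localSpeed_rpow (q : ℝ) :
    Measurable fun γ : C(I, X) => ∫⁻ t, localSpeed γ t ^ q :=
  (measurable_localSpeed.pow_const q).lintegral_prod_right'

theorem lintegral_localSpeed_lt_top {γ : C(I, X)} {q : ℝ} (hq : 1 < q)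
    (h : ∫⁻ t, localSpeed γ t ^ q < ∞) : ∫⁻ t, localSpeed γ t < ∞ := by
  refine lt_of_le_of_lt (lintegral_mono (g := fun t => 1 + localSpeed γ t ^ q) fun t => ?_) ?_
  · rcases le_total (localSpeed γ t) 1 with h1 | h1
    · exact h1.trans (le_add_right le_rfl)
    · exact (ENNReal.le_rpow_self_of_one_le h1 hq.le).trans (le_add_left le_rfl)
  · rw [lintegral_add_left measurable_const]
    simpa using h

theorem isACCurve_of_lintegral_metricSpeed_lt_top {γ : C(I, X)} {q : ℝ} (hq : 0 < q)
    (h : ∫⁻ t, metricSpeed γ t ^ q < ∞) : IsACCurve γ := by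
  by_contra hac
  simp [metricSpeed_eq, hac, hq] at h

/-- The curve that follows `γ` on `[s, t]` and rests at its endpoints before and after. -/
def clampCurve (s t : I) (γ : C(I, X)) : C(I, X) :=
  γ.comp ⟨fun r => max s (min t r), by fun_prop⟩

theorem clampCurve_apply (s t : I) (γ : C(I, X)) (r : I) :
    clampCurve s t γ r = γ (max s (min t r)) := rfl

theorem continuous_clampCurve (s t : I) : Continuous (clampCurve s t : C(I, X) → C(I, X)) :=
  ContinuousMap.continuous_precomp _

theorem IsACCurve.clampCurve {γ : C(I, X)} (h : IsACCurve γ) (s t : I) :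
    IsACCurve (clampCurve s t γ) := by
  obtain ⟨f, hf, hd⟩ := h
  refine ⟨fun r => |f r|, hf.abs, fun a b hab => ?_⟩
  have hab' : (a : ℝ) ≤ b := hab
  rw [clampCurve_apply, clampCurve_apply]
  have hle : max s (min t a) ≤ max s (min t b) := by gcongr
  have h0 : 0 ≤ ∫ r in (a : ℝ)..b, |f r| :=
    intervalIntegral.integral_nonneg hab' fun _ _ => abs_nonneg _
  rcases hle.eq_or_lt with heq | hlt
  · rw [heq, dist_self]; exact h0
  refine (hd _ _ hle).trans ?_
  have hb : max s (min t b) ≤ b := by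
    rcases lt_max_iff.1 hlt with h1 | h1
    · exact absurd (le_max_left s _) h1.not_ge
    · rw [max_eq_right ((le_max_left s (min t a)).trans h1.le)]; exact min_le_right _ _
  have ha : a ≤ max s (min t a) := by
    rcases le_total a t with h1 | h1
    · rw [min_eq_right h1]; exact le_max_right _ _
    · rw [min_eq_left h1, min_eq_left (h1.trans hab)] at hlt
      exact absurd rfl hlt.ne
  have hint : ∀ x y : I, IntervalIntegrable f volume x y := fun x y => hf.mono_set (by
    rw [Set.uIcc_of_le zero_le_one]
    exact Set.uIcc_subset_Icc x.2 y.2)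
  calc ∫ r in ((max s (min t a) : I) : ℝ)..(max s (min t b) : I), f r
      ≤ ∫ r in ((max s (min t a) : I) : ℝ)..(max s (min t b) : I), |f r| :=
        intervalIntegral.integral_mono_on (show ((max s (min t a) : I) : ℝ) ≤ _ from hle)
          (hint _ _) (hint _ _).abs fun x _ => le_abs_self _
    _ ≤ ∫ r in (a : ℝ)..b, |f r| :=
        intervalIntegral.integral_mono_interval ha hle hb (.of_forall fun x => abs_nonneg _)
          (hint _ _).abs

theorem localSpeed_congr {γ η : C(I, X)} {t : I} (h : ⇑γ =ᶠ[𝓝 t] ⇑η) :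
    localSpeed γ t = localSpeed η t := by
  have h1 : speedQuotient γ t =ᶠ[𝓝[≠] t] speedQuotient η t := by
    filter_upwards [h.filter_mono nhdsWithin_le_nhds] with s hs
    rw [speedQuotient, speedQuotient, hs, h.eq_of_nhds]
  rw [localSpeed, localSpeed, limsup_congr h1, liminf_congr h1]

theorem localSpeed_eq_zero {γ : C(I, X)} {t : I} {x : X} (h : ∀ᶠ s in 𝓝 t, γ s = x) :
    localSpeed γ t = 0 := by
  apply localSpeed_eq_of_tendsto
  refine tendsto_const_nhds.congr' ?_
  filter_upwards [h.filter_mono nhdsWithin_le_nhds] with s hs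
  rw [speedQuotient, hs, h.self_of_nhds]
  simp

theorem localSpeed_clampCurve (s t : I) (hst : s ≤ t) (γ : C(I, X)) {r : I} (hs : r ≠ s)
    (ht : r ≠ t) :
    localSpeed (clampCurve s t γ) r = (Set.Ioc s t).indicator (localSpeed γ) r := by
  rcases lt_or_gt_of_ne hs with h1 | h1
  · rw [Set.indicator_of_notMem (fun h => h.1.not_gt h1)]
    refine localSpeed_eq_zero (x := γ s) ?_
    filter_upwards [Iio_mem_nhds h1] with a ha
    rw [clampCurve_apply, max_eq_left ((min_le_right _ _).trans (le_of_lt ha))]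
  rcases lt_or_gt_of_ne ht with h2 | h2
  · rw [Set.indicator_of_mem (Set.mem_Ioc.2 ⟨h1, h2.le⟩)]
    refine localSpeed_congr ?_
    filter_upwards [Ioo_mem_nhds h1 h2] with a ha
    rw [clampCurve_apply, min_eq_right ha.2.le, max_eq_right ha.1.le]
  · rw [Set.indicator_of_notMem (fun h => h.2.not_gt h2)]
    refine localSpeed_eq_zero (x := γ t) ?_
    filter_upwards [Ioi_mem_nhds h2] with a ha
    rw [clampCurve_apply, min_eq_left (le_of_lt ha), max_eq_right hst]

theorem ae_localSpeed_clampCurve (s t : I) (hst : s ≤ t) (γ : C(I, X)) :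
    ∀ᵐ r : I, localSpeed (clampCurve s t γ) r = (Set.Ioc s t).indicator (localSpeed γ) r := by
  have h : ∀ a : I, ∀ᵐ r : I, r ≠ a := fun a => by
    rw [ae_iff]; simp
  filter_upwards [h s, h t] with r hs ht using localSpeed_clampCurve s t hst γ hs ht

variable [MeasurableSpace X] {m : Measure X} {q : ℝ} {π : Measure C(I, X)}

/-- Almost every curve of a test plan is absolutely continuous with speed in `L^q`. The point is
that these curves form a Borel set, off which the energy is infinite. -/
theorem IsTestPlan.ae_isACCurve (hq : 1 < q) (hπ : IsTestPlan q m π) :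
    ∀ᵐ γ ∂π, IsACCurve γ ∧ ∫⁻ t, localSpeed γ t ^ q < ∞ := by
  obtain ⟨D, hDc, hD⟩ := TopologicalSpace.exists_countable_dense I
  set B : Set C(I, X) := {γ | ∫⁻ t, localSpeed γ t ^ q < ∞} ∩
    ⋂ s ∈ D, ⋂ t ∈ D, ⋂ _ : s ≤ t, {γ | edist (γ s) (γ t) ≤ ∫⁻ r in Set.Ioc s t, localSpeed γ r}
    with hB
  have hBm : MeasurableSet B := by
    refine (measurableSet_lt (measurable_lintegral_localSpeed_rpow q) measurable_const).inter
      (.biInter hDc fun s _ => .biInter hDc fun t _ => .iInter fun _ => ?_)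
    refine measurableSet_le (Continuous.measurable (by fun_prop)) ?_
    exact measurable_localSpeed.lintegral_prod_right'
  have hBtop : ∀ γ ∉ B, ∫⁻ t, metricSpeed γ t ^ q = ∞ := by
    intro γ hγ
    by_contra hne
    have hlt := lt_top_iff_ne_top.2 hne
    have hac := isACCurve_of_lintegral_metricSpeed_lt_top (by positivity) hlt
    apply hγ
    refine ⟨?_, ?_⟩
    · change ∫⁻ t, localSpeed γ t ^ q < ∞
      simpa only [metricSpeed_eq_localSpeed hac] using hlt
    · simp only [Set.mem_iInter]
      exact fun s _ t _ hst => hac.edist_le hst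
  have h0 : π Bᶜ = 0 := by
    by_contra hne
    have h1 : ∫⁻ _ in Bᶜ, ∞ ∂π ≤ ∫⁻ γ, (∫⁻ t : I, metricSpeed γ t ^ q) ∂π := by
      rw [← lintegral_indicator hBm.compl]
      refine lintegral_mono fun γ => ?_
      by_cases hγ : γ ∈ Bᶜ
      · rw [Set.indicator_of_mem hγ, hBtop γ hγ]
      · rw [Set.indicator_of_notMem hγ]; exact zero_le
    rw [setLIntegral_const, ENNReal.top_mul hne] at h1
    exact (h1.trans_lt hπ.energy_lt_top).ne rfl
  filter_upwards [measure_eq_zero_iff_ae_notMem.1 h0] with γ hγ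
  rw [Set.notMem_compl_iff] at hγ
  refine ⟨isACCurve_of_edist_le hD (lintegral_localSpeed_lt_top hq hγ.1).ne ?_, hγ.1⟩
  have h2 := hγ.2
  simp only [Set.mem_iInter] at h2
  exact fun s hs t ht hst => h2 s hs t ht hst

theorem IsTestPlan.lintegral_localSpeed_rpow_lt_top (hπ : IsTestPlan q m π) (hq : 0 ≤ q) :
    ∫⁻ γ, (∫⁻ t : I, localSpeed γ t ^ q) ∂π < ∞ := by
  refine lt_of_le_of_lt (lintegral_mono fun γ => lintegral_mono fun t => ?_) hπ.energy_lt_top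
  dsimp only
  gcongr
  exact localSpeed_le_metricSpeed γ t

theorem IsTestPlan.lintegral_mul_metricSpeed (hq : 1 < q) (hπ : IsTestPlan q m π)
    (Φ : C(I, X) → I → ℝ≥0∞) :
    ∫⁻ γ, (∫⁻ t : I, Φ γ t * metricSpeed γ t) ∂π = ∫⁻ γ, (∫⁻ t : I, Φ γ t * localSpeed γ t) ∂π := by
  refine lintegral_congr_ae ?_
  filter_upwards [hπ.ae_isACCurve hq] with γ hγ
  simp only [metricSpeed_eq_localSpeed hγ.1]

theorem measurable_eval [BorelSpace X] (t : I) : Measurable fun γ : C(I, X) => γ t :=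
  Continuous.measurable (by fun_prop)

theorem measurable_eval_prod [BorelSpace X] : Measurable fun z : C(I, X) × I => z.1 z.2 :=
  Continuous.measurable (by fun_prop)

theorem IsTestPlan.map_eval_ac (hπ : IsTestPlan q m π) (t : I) :
    π.map (fun γ => γ t) ≪ m := by
  obtain ⟨C, hC⟩ := hπ.exists_marginal_le
  exact (Measure.absolutelyContinuous_of_le (hC t)).trans
    (Measure.smul_absolutelyContinuous)

theorem IsTestPlan.aemeasurable_comp_eval [BorelSpace X] {β : Type*} [MeasurableSpace β]
    (hπ : IsTestPlan q m π) {f : X → β} (hf : AEMeasurable f m) (t : I) :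
    AEMeasurable (fun γ => f (γ t)) π :=
  (hf.mono_ac (hπ.map_eval_ac t)).comp_measurable (measurable_eval t)

theorem IsTestPlan.ae_eval [BorelSpace X] (hπ : IsTestPlan q m π) {P : X → Prop}
    (h : ∀ᵐ x ∂m, P x) (t : I) : ∀ᵐ γ ∂π, P (γ t) :=
  ae_of_ae_map (measurable_eval t).aemeasurable ((hπ.map_eval_ac t).ae_le h)

theorem IsTestPlan.ae_ae_eval [BorelSpace X] (hπ : IsTestPlan q m π) {P : X → Prop}
    (h : ∀ᵐ x ∂m, P x) : ∀ᵐ γ ∂π, ∀ᵐ t : I, P (γ t) := by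
  have := hπ.isProbabilityMeasure
  obtain ⟨N, hN, hNm, hN0⟩ := exists_measurable_superset_of_null (ae_iff.1 h)
  have h1 : ∀ᵐ γ ∂π, ∀ᵐ t : I, γ t ∉ N := by
    rw [Measure.ae_ae_comm (p := fun (γ : C(I, X)) (t : I) => γ t ∉ N)
      (measurable_eval_prod hNm.compl)]
    exact .of_forall fun t => hπ.ae_eval (measure_eq_zero_iff_ae_notMem.1 hN0) t
  filter_upwards [h1] with γ hγ
  filter_upwards [hγ] with t ht
  by_contra hP
  exact ht (hN hP)

/-- The time marginals of a test plan are bounded by a multiple of `m`. -/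
theorem IsTestPlan.exists_lintegral_eval_le [BorelSpace X] (hπ : IsTestPlan q m π) :
    ∃ C : ℝ≥0, ∀ (h : X → ℝ≥0∞), AEMeasurable h m → ∀ t : I,
      ∫⁻ γ, h (γ t) ∂π ≤ C * ∫⁻ x, h x ∂m := by
  obtain ⟨C, hC⟩ := hπ.exists_marginal_le
  refine ⟨C, fun h hh t => ?_⟩
  rw [← lintegral_map' (f := h) (hh.mono_ac (hπ.map_eval_ac t)) (measurable_eval t).aemeasurable]
  refine (lintegral_mono' (hC t) le_rfl).trans ?_
  rw [ENNReal.smul_def, lintegral_smul_measure, smul_eq_mul]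

/-- Restricting the curves of a test plan to a time interval gives a test plan. -/
theorem IsTestPlan.map_clampCurve [BorelSpace X] (hq : 1 < q) (hπ : IsTestPlan q m π) (s t : I)
    (hst : s ≤ t) : IsTestPlan q m (π.map (clampCurve s t)) := by
  have := hπ.isProbabilityMeasure
  have hc := (continuous_clampCurve (X := X) s t).measurable
  refine ⟨Measure.isProbabilityMeasure_map hc.aemeasurable, ?_, ?_⟩
  · refine (lintegral_map_le _ _).trans_lt ?_
    refine lt_of_le_of_lt (lintegral_mono_ae ?_) (hπ.lintegral_localSpeed_rpow_lt_top
      (by positivity))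
    filter_upwards [hπ.ae_isACCurve hq] with γ hγ
    refine lintegral_mono_ae ?_
    filter_upwards [ae_localSpeed_clampCurve s t hst γ] with r hr
    rw [metricSpeed_eq_localSpeed (hγ.1.clampCurve s t), hr]
    gcongr
    exact Set.indicator_le_self _ _ _
  · obtain ⟨C, hC⟩ := hπ.exists_marginal_le
    refine ⟨C, fun r => ?_⟩
    rw [Measure.map_map (measurable_eval r) hc]
    exact hC (max s (min t r))

/-- Conditioning a test plan to a set of curves of positive measure gives a test plan. -/
theorem IsTestPlan.cond [BorelSpace X] (hπ : IsTestPlan q m π) {Γ : Set C(I, X)} (hΓ : π Γ ≠ 0) :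
    IsTestPlan q m (ProbabilityTheory.cond π Γ) := by
  have := hπ.isProbabilityMeasure
  obtain ⟨C, hC⟩ := hπ.exists_marginal_le
  have hfin : (π Γ)⁻¹ ≠ ∞ := ENNReal.inv_ne_top.2 hΓ
  refine ⟨ProbabilityTheory.cond_isProbabilityMeasure hΓ, ?_, (π Γ)⁻¹.toNNReal * C, fun t => ?_⟩
  · rw [ProbabilityTheory.cond, lintegral_smul_measure]
    exact ENNReal.mul_lt_top hfin.lt_top
      ((lintegral_mono' Measure.restrict_le_self le_rfl).trans_lt hπ.energy_lt_top)
  · rw [ProbabilityTheory.cond, Measure.map_smul, mul_smul, ENNReal.smul_def,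
      ENNReal.coe_toNNReal hfin]
    intro A
    rw [Measure.smul_apply, Measure.smul_apply]
    exact mul_le_mul_right ((Measure.map_mono Measure.restrict_le_self
      (measurable_eval t)).trans (hC t) A) _

end TestPlan

/-! ### The speed measure of a test plan -/

section SpeedMeasure

variable {X : Type*} [MetricSpace X] [MeasurableSpace X] {m : Measure X} {p q : ℝ}
  {π : Measure C(I, X)}

/-- The measure `h ↦ ∬ h(γ_t) |γ'_t| dt dπ(γ)` on `X`. -/
def speedMeasure (π : Measure C(I, X)) : Measure X :=
  ((π.prod volume).withDensity fun z : C(I, X) × I => localSpeed z.1 z.2).map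
    fun z : C(I, X) × I => z.1 z.2

instance [SFinite π] : SFinite (speedMeasure π) := by unfold speedMeasure; infer_instance

variable [BorelSpace X]

theorem lintegral_speedMeasure_of_measurable [SFinite π] {h : X → ℝ≥0∞} (hh : Measurable h) :
    ∫⁻ x, h x ∂(speedMeasure π) = ∫⁻ γ, (∫⁻ t : I, h (γ t) * localSpeed γ t) ∂π := by
  have h1 : Measurable fun z : C(I, X) × I => h (z.1 z.2) := hh.comp measurable_eval_prod
  rw [speedMeasure, lintegral_map hh measurable_eval_prod,
    lintegral_withDensity_eq_lintegral_mul _ measurable_localSpeed h1, lintegral_prod _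
    (measurable_localSpeed.mul h1).aemeasurable]
  simp only [Pi.mul_apply, mul_comm]

theorem IsTestPlan.speedMeasure_ac (hπ : IsTestPlan q m π) : speedMeasure π ≪ m := by
  have := hπ.isProbabilityMeasure
  refine Measure.AbsolutelyContinuous.mk fun A hA h0 => ?_
  rw [← lintegral_indicator_one hA, lintegral_speedMeasure_of_measurable
    (measurable_one.indicator hA), lintegral_eq_zero_iff']
  · filter_upwards [hπ.ae_ae_eval (measure_eq_zero_iff_ae_notMem.1 h0)] with γ hγ
    rw [Pi.zero_apply, ← lintegral_zero (μ := (volume : Measure I))]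
    refine lintegral_congr_ae ?_
    filter_upwards [hγ] with t ht
    simp [ht]
  · exact (((measurable_one.indicator hA).comp measurable_eval_prod).mul
      measurable_localSpeed).lintegral_prod_right'.aemeasurable

theorem IsTestPlan.lintegral_speedMeasure (hπ : IsTestPlan q m π) {h : X → ℝ≥0∞}
    (hh : AEMeasurable h m) :
    ∫⁻ x, h x ∂(speedMeasure π) = ∫⁻ γ, (∫⁻ t : I, h (γ t) * localSpeed γ t) ∂π := by
  have := hπ.isProbabilityMeasure
  rw [lintegral_congr_ae (hπ.speedMeasure_ac.ae_le hh.ae_eq_mk),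
    lintegral_speedMeasure_of_measurable hh.measurable_mk]
  refine lintegral_congr_ae ?_
  filter_upwards [hπ.ae_ae_eval hh.ae_eq_mk] with γ hγ
  refine lintegral_congr_ae ?_
  filter_upwards [hγ] with t ht
  rw [ht]

theorem IsTestPlan.exists_lintegral_eval_prod_le (hπ : IsTestPlan q m π) :
    ∃ C : ℝ≥0, ∀ h : X → ℝ≥0∞, Measurable h →
      ∫⁻ γ, (∫⁻ t : I, h (γ t)) ∂π ≤ C * ∫⁻ x, h x ∂m := by
  have := hπ.isProbabilityMeasure
  obtain ⟨C, hC⟩ := hπ.exists_lintegral_eval_le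
  refine ⟨C, fun h hh => ?_⟩
  rw [lintegral_lintegral_swap (f := fun (γ : C(I, X)) (t : I) => h (γ t))
    (hh.comp measurable_eval_prod).aemeasurable]
  calc _ ≤ ∫⁻ _ : I, C * ∫⁻ x, h x ∂m := lintegral_mono fun t => hC h hh.aemeasurable t
    _ = _ := by simp

/-- By Hölder's inequality the speed measure of a `q`-test plan acts continuously on `L^p`. -/
theorem IsTestPlan.exists_lintegral_speedMeasure_le (hpq : p.HolderConjugate q)
    (hπ : IsTestPlan q m π) :
    ∃ K : ℝ≥0, ∀ h : X → ℝ≥0∞, AEMeasurable h m →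
      ∫⁻ x, h x ∂(speedMeasure π) ≤ K * (∫⁻ x, h x ^ p ∂m) ^ (1 / p) := by
  have := hπ.isProbabilityMeasure
  obtain ⟨C, hC⟩ := hπ.exists_lintegral_eval_prod_le
  have hE := hπ.lintegral_localSpeed_rpow_lt_top hpq.symm.nonneg
  set E := ∫⁻ γ, (∫⁻ t : I, localSpeed γ t ^ q) ∂π
  have hp0 := hpq.pos
  have hq0 := hpq.symm.pos
  have hfin : (C : ℝ≥0∞) ^ (1 / p) * E ^ (1 / q) ≠ ∞ := by
    refine ENNReal.mul_ne_top ?_ ?_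
    · exact ENNReal.rpow_ne_top_of_nonneg (by positivity) ENNReal.coe_ne_top
    · exact ENNReal.rpow_ne_top_of_nonneg (by positivity) hE.ne
  refine ⟨((C : ℝ≥0∞) ^ (1 / p) * E ^ (1 / q)).toNNReal, fun h hh => ?_⟩
  rw [ENNReal.coe_toNNReal hfin]
  wlog hm : Measurable h generalizing h
  · rw [lintegral_congr_ae (hπ.speedMeasure_ac.ae_le hh.ae_eq_mk)]
    refine (this _ hh.measurable_mk.aemeasurable hh.measurable_mk).trans_eq ?_
    have h1 : ∫⁻ x, h x ^ p ∂m = ∫⁻ x, hh.mk h x ^ p ∂m :=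
      lintegral_congr_ae (hh.ae_eq_mk.fun_comp (· ^ p))
    rw [h1]
  have h1 : Measurable fun z : C(I, X) × I => h (z.1 z.2) := hm.comp measurable_eval_prod
  rw [lintegral_speedMeasure_of_measurable hm, ← lintegral_prod (fun z : C(I, X) × I =>
    h (z.1 z.2) * localSpeed z.1 z.2) (h1.mul measurable_localSpeed).aemeasurable]
  refine (ENNReal.lintegral_mul_le_Lp_mul_Lq _ hpq h1.aemeasurable
    measurable_localSpeed.aemeasurable).trans ?_
  rw [lintegral_prod _ (h1.pow_const p).aemeasurable,
    lintegral_prod _ (measurable_localSpeed.pow_const q).aemeasurable]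
  calc _ ≤ (C * ∫⁻ x, h x ^ p ∂m) ^ (1 / p) * E ^ (1 / q) := by
        gcongr; exact hC _ (hm.pow_const p)
    _ = _ := by rw [ENNReal.mul_rpow_of_nonneg _ _ (by positivity)]; ring

theorem IsWeakUpperGradient.lintegral_le {f G : X → ℝ} (hp : 1 < p)
    (h : IsWeakUpperGradient p m f G) (hπ : IsTestPlan p.conjExponent m π) :
    ∫⁻ γ, ENNReal.ofReal |f (γ 1) - f (γ 0)| ∂π ≤
      ∫⁻ x, ENNReal.ofReal (G x) ∂(speedMeasure π) := by
  have hq := (Real.HolderConjugate.conjExponent hp).symm.lt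
  rw [hπ.lintegral_speedMeasure h.memLp.1.aemeasurable.ennreal_ofReal,
    ← hπ.lintegral_mul_metricSpeed hq fun γ t => ENNReal.ofReal (G (γ t))]
  exact h.le_of_testPlan π hπ

theorem isWeakUpperGradient_of_lintegral_le {f G : X → ℝ} (hp : 1 < p) (hf : AEMeasurable f m)
    (hG : MemLp G (ENNReal.ofReal p) m) (h0 : 0 ≤ᵐ[m] G)
    (h : ∀ π : Measure C(I, X), IsTestPlan p.conjExponent m π →
      ∫⁻ γ, ENNReal.ofReal |f (γ 1) - f (γ 0)| ∂π ≤
        ∫⁻ x, ENNReal.ofReal (G x) ∂(speedMeasure π)) : IsWeakUpperGradient p m f G := by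
  have hq := (Real.HolderConjugate.conjExponent hp).symm.lt
  refine ⟨hf, hG, h0, fun π hπ => ?_⟩
  rw [hπ.lintegral_mul_metricSpeed hq fun γ t => ENNReal.ofReal (G (γ t)),
    ← hπ.lintegral_speedMeasure hG.1.aemeasurable.ennreal_ofReal]
  exact h π hπ

theorem IsTestPlan.lintegral_ofReal_speedMeasure_lt_top (hp : 1 < p)
    (hπ : IsTestPlan p.conjExponent m π) {G : X → ℝ} (hG : MemLp G (ENNReal.ofReal p) m) :
    ∫⁻ x, ENNReal.ofReal (G x) ∂(speedMeasure π) < ∞ := by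
  have hpq := Real.HolderConjugate.conjExponent hp
  obtain ⟨K, hK⟩ := hπ.exists_lintegral_speedMeasure_le hpq
  refine (hK _ hG.1.aemeasurable.ennreal_ofReal).trans_lt (ENNReal.mul_lt_top ENNReal.coe_lt_top ?_)
  refine ENNReal.rpow_lt_top_of_nonneg (by have := hpq.pos; positivity) (ne_of_lt ?_)
  refine lt_of_le_of_lt (lintegral_mono fun x => ?_) ((memLp_ofReal_iff hpq.pos).1 hG).2
  dsimp only
  gcongr
  exact Real.ofReal_le_enorm _

/-- A weak upper gradient controls the increments of `f` along almost every curve, between any two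
given times: apply the definition to the plan restricted to that time interval and conditioned to an
arbitrary set of curves. -/
theorem IsWeakUpperGradient.ae_le {f G : X → ℝ} (hp : 1 < p)
    (h : IsWeakUpperGradient p m f G) (hπ : IsTestPlan p.conjExponent m π) {s t : I}
    (hst : s ≤ t) : ∀ᵐ γ ∂π, ENNReal.ofReal |f (γ t) - f (γ s)| ≤
      ∫⁻ r in Set.Ioc s t, ENNReal.ofReal (G (γ r)) * localSpeed γ r := by
  have hq := (Real.HolderConjugate.conjExponent hp).symm.lt
  have := hπ.isProbabilityMeasure
  have hGm := h.memLp.1.aemeasurable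
  set G' := hGm.mk G
  have hG' : Measurable G' := hGm.measurable_mk
  have hR : Measurable fun γ : C(I, X) =>
      ∫⁻ r in Set.Ioc s t, ENNReal.ofReal (G' (γ r)) * localSpeed γ r :=
    ((hG'.ennreal_ofReal.comp measurable_eval_prod).mul measurable_localSpeed).lintegral_prod_right'
  have hRR : ∀ᵐ γ ∂π, ∫⁻ r in Set.Ioc s t, ENNReal.ofReal (G (γ r)) * localSpeed γ r =
      ∫⁻ r in Set.Ioc s t, ENNReal.ofReal (G' (γ r)) * localSpeed γ r := by
    filter_upwards [hπ.ae_ae_eval hGm.ae_eq_mk] with γ hγ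
    refine lintegral_congr_ae (ae_restrict_of_ae ?_)
    filter_upwards [hγ] with r hr
    rw [hr]
  suffices hle : (fun γ : C(I, X) => ENNReal.ofReal |f (γ t) - f (γ s)|) ≤ᵐ[π]
      fun γ => ∫⁻ r in Set.Ioc s t, ENNReal.ofReal (G' (γ r)) * localSpeed γ r by
    filter_upwards [hle, hRR] with γ h1 h2
    rw [h2]; exact h1
  have habs : ∀ (a b : I) (π' : Measure C(I, X)), IsTestPlan p.conjExponent m π' →
      AEMeasurable (fun γ : C(I, X) => ENNReal.ofReal |f (γ a) - f (γ b)|) π' :=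
    fun a b π' hπ' => (measurable_norm.comp_aemeasurable ((hπ'.aemeasurable_comp_eval
      h.aemeasurable a).sub (hπ'.aemeasurable_comp_eval h.aemeasurable b))).ennreal_ofReal
  refine ae_le_of_forall_setLIntegral_le_of_sigmaFinite₀ (habs t s π hπ) fun Γ hΓ _ => ?_
  rcases eq_or_ne (π Γ) 0 with h0 | h0
  · rw [setLIntegral_measure_zero _ _ h0]; exact zero_le
  have hc : Measurable (clampCurve s t : C(I, X) → C(I, X)) :=
    (continuous_clampCurve s t).measurable
  have hcond := hπ.cond h0
  have hplan := hcond.map_clampCurve hq s t hst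
  have key := h.le_of_testPlan _ hplan
  rw [lintegral_map' (habs 1 0 _ hplan) hc.aemeasurable] at key
  have e1 : ∀ γ : C(I, X), clampCurve s t γ 1 = γ t := fun γ => by
    rw [clampCurve_apply, min_eq_left (show t ≤ 1 from t.2.2), max_eq_right hst]
  have e0 : ∀ γ : C(I, X), clampCurve s t γ 0 = γ s := fun γ => by
    rw [clampCurve_apply, min_eq_right (show 0 ≤ t from t.2.1),
      max_eq_left (show 0 ≤ s from s.2.1)]
  simp only [e1, e0] at key
  replace key := key.trans (lintegral_map_le _ _)
  have h2 : ∫⁻ γ, (∫⁻ r : I, ENNReal.ofReal (G (clampCurve s t γ r)) *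
      metricSpeed (clampCurve s t γ) r) ∂(ProbabilityTheory.cond π Γ) ≤
      ∫⁻ γ, (∫⁻ r in Set.Ioc s t, ENNReal.ofReal (G' (γ r)) * localSpeed γ r)
        ∂(ProbabilityTheory.cond π Γ) := by
    refine lintegral_mono_ae ?_
    filter_upwards [hcond.ae_isACCurve hq, hcond.ae_ae_eval hGm.ae_eq_mk] with γ hγ hγG
    rw [← lintegral_indicator measurableSet_Ioc]
    refine lintegral_mono_ae ?_
    filter_upwards [ae_localSpeed_clampCurve s t hst γ, hγG] with r hr hrG
    rw [metricSpeed_eq_localSpeed (hγ.1.clampCurve s t), hr]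
    by_cases hmem : r ∈ Set.Ioc s t
    · rw [Set.indicator_of_mem hmem, Set.indicator_of_mem hmem, clampCurve_apply,
        min_eq_right hmem.2, max_eq_right hmem.1.le, hrG]
    · simp [hmem]
  replace key := key.trans h2
  rw [ProbabilityTheory.cond, lintegral_smul_measure, lintegral_smul_measure] at key
  exact (ENNReal.mul_le_mul_iff_right (ENNReal.inv_ne_zero.2 (measure_ne_top _ _))
    (ENNReal.inv_ne_top.2 h0)).1 key

end SpeedMeasure

/-! ### Minima and decreasing limits of weak upper gradients -/

section MinUpperGradient

/-- If the increments of `F` over all intervals with rational endpoints are bounded by the integrals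
of `a` and by those of `b`, then `|F 1 - F 0| ≤ ∫ min a b`. Approximate `a` and `b` in `L¹` by
continuous functions, and on short intervals use the bound by the one that is smaller at the left endpoint. -/
theorem abs_sub_le_integral_min {D : Set I} (hD : ∀ r : ℚ, Set.projIcc (0 : ℝ) 1 zero_le_one r ∈ D)
    {F : I → ℝ} {a b : I → ℝ} (ha : Integrable a) (hb : Integrable b)
    (hFa : ∀ s ∈ D, ∀ t ∈ D, s ≤ t → |F t - F s| ≤ ∫ r in Set.Ioc s t, a r)
    (hFb : ∀ s ∈ D, ∀ t ∈ D, s ≤ t → |F t - F s| ≤ ∫ r in Set.Ioc s t, b r) :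
    |F 1 - F 0| ≤ ∫ r, min (a r) (b r) := by
  refine le_of_forall_pos_le_add fun ε hε => ?_
  set η := ε / 6 with hη
  have hη0 : 0 < η := by positivity
  obtain ⟨a', ha', ha'i⟩ := ha.exists_boundedContinuous_integral_sub_le hη0
  obtain ⟨b', hb', hb'i⟩ := hb.exists_boundedContinuous_integral_sub_le hη0
  obtain ⟨δ, hδ, hδa⟩ := Metric.uniformContinuous_iff.1
    (CompactSpace.uniformContinuous_of_continuous a'.continuous) η hη0
  obtain ⟨δ', hδ', hδb⟩ := Metric.uniformContinuous_iff.1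
    (CompactSpace.uniformContinuous_of_continuous b'.continuous) η hη0
  obtain ⟨N, hN⟩ := exists_nat_one_div_lt (lt_min hδ hδ')
  set n : ℝ := (N : ℝ) + 1 with hn
  have hn0 : 0 < n := by positivity
  set x : ℕ → I := fun i => Set.projIcc (0 : ℝ) 1 zero_le_one (i / n) with hx
  have hxD : ∀ i, x i ∈ D := fun i => by
    have := hD ((i : ℚ) / ((N : ℚ) + 1))
    simpa [hx, hn] using this
  have hxm : ∀ i, x i ≤ x (i + 1) := fun i => by
    apply Set.monotone_projIcc
    push_cast
    gcongr
    linarith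
  have hxd : ∀ i, ∀ r ∈ Set.Ioc (x i) (x (i + 1)), dist r (x i) < min δ δ' := fun i r hr => by
    refine lt_of_le_of_lt ?_ hN
    have h1 : |(x (i + 1) : ℝ) - x i| ≤ |((i + 1 : ℕ) : ℝ) / n - i / n| :=
      Set.abs_projIcc_sub_projIcc _
    have h2 : ((i + 1 : ℕ) : ℝ) / n - i / n = 1 / n := by push_cast; ring
    rw [h2, abs_of_pos (show 0 < 1 / n by positivity)] at h1
    rw [Subtype.dist_eq, Real.dist_eq,
      abs_of_nonneg (sub_nonneg.2 (show (x i : ℝ) ≤ r from hr.1.le))]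
    have h3 : (r : ℝ) ≤ x (i + 1) := hr.2
    linarith [le_abs_self ((x (i + 1) : ℝ) - x i)]
  set w : I → ℝ := fun r => min (a r) (b r) + 2 * |a r - a' r| + 2 * |b r - b' r| + 2 * η with hw
  have hmin : Integrable fun r => min (a r) (b r) := ha.inf hb
  have hA : Integrable fun r => |a r - a' r| := (ha.sub ha'i).abs
  have hB : Integrable fun r => |b r - b' r| := (hb.sub hb'i).abs
  have hwi : Integrable w :=
    ((hmin.add (hA.const_mul 2)).add (hB.const_mul 2)).add (integrable_const _)
  have hstep : ∀ i, |F (x (i + 1)) - F (x i)| ≤ ∫ r in Set.Ioc (x i) (x (i + 1)), w r := by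
    intro i
    have hbd : ∀ r ∈ Set.Ioc (x i) (x (i + 1)), |a' r - a' (x i)| < η ∧ |b' r - b' (x i)| < η :=
      fun r hr => ⟨hδa ((hxd i r hr).trans_le (min_le_left _ _)),
        hδb ((hxd i r hr).trans_le (min_le_right _ _))⟩
    -- on a short interval, the one of `a'` and `b'` smaller at the left endpoint stays nearly so
    rcases le_total (a' (x i)) (b' (x i)) with hab | hab
    · refine (hFa _ (hxD i) _ (hxD (i + 1)) (hxm i)).trans
        (setIntegral_mono_on ha.integrableOn hwi.integrableOn measurableSet_Ioc fun r hr => ?_)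
      obtain ⟨h1, h2⟩ := hbd r hr
      rw [abs_lt] at h1 h2
      have h3 := abs_le.1 (le_refl |a r - a' r|)
      have h4 := abs_le.1 (le_refl |b r - b' r|)
      have h5 := abs_nonneg (a r - a' r)
      have h6 := abs_nonneg (b r - b' r)
      rcases min_choice (a r) (b r) with h | h <;> simp only [hw, h] <;> linarith
    · refine (hFb _ (hxD i) _ (hxD (i + 1)) (hxm i)).trans
        (setIntegral_mono_on hb.integrableOn hwi.integrableOn measurableSet_Ioc fun r hr => ?_)
      obtain ⟨h1, h2⟩ := hbd r hr
      rw [abs_lt] at h1 h2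
      have h3 := abs_le.1 (le_refl |a r - a' r|)
      have h4 := abs_le.1 (le_refl |b r - b' r|)
      have h5 := abs_nonneg (a r - a' r)
      have h6 := abs_nonneg (b r - b' r)
      rcases min_choice (a r) (b r) with h | h <;> simp only [hw, h] <;> linarith
  have hx0 : x 0 = 0 := by simp [hx]
  have hx1 : x (N + 1) = 1 := by
    have : ((N + 1 : ℕ) : ℝ) / n = 1 := by rw [hn]; push_cast; field_simp
    simp only [hx, this]; simp
  have hx0le : ∀ i, 0 ≤ x i := fun i => (x i).2.1
  have hsum : ∀ i, |F (x i) - F 0| ≤ ∫ r in Set.Ioc 0 (x i), w r := by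
    intro i
    induction i with
    | zero => simp [hx0]
    | succ i ih =>
      rw [← Set.Ioc_union_Ioc_eq_Ioc (hx0le i) (hxm i), setIntegral_union
        (Set.Ioc_disjoint_Ioc_of_le le_rfl) measurableSet_Ioc hwi.integrableOn hwi.integrableOn]
      have := abs_sub_le (F (x (i + 1))) (F (x i)) (F 0)
      linarith [hstep i]
  have h01 := hsum (N + 1)
  rw [hx1] at h01
  have huniv : ∫ r in Set.Ioc (0 : I) 1, w r = ∫ r, w r := by
    rw [← setIntegral_univ (μ := volume) (f := w)]
    refine setIntegral_congr_set ?_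
    have h : ∀ᵐ r : I, r ≠ 0 := by rw [ae_iff]; simp
    refine eventuallyEq_set.2 ?_
    filter_upwards [h] with r hr
    simp only [Set.mem_univ, iff_true]
    exact ⟨lt_of_le_of_ne r.2.1 (Ne.symm hr), r.2.2⟩
  rw [huniv] at h01
  have hwint : ∫ r, w r = (∫ r, min (a r) (b r)) + 2 * (∫ r, |a r - a' r|) +
      2 * (∫ r, |b r - b' r|) + 2 * η := by
    have h1 := integral_add ((hmin.add (hA.const_mul 2)).add (hB.const_mul 2))
      (integrable_const (2 * η))
    have h2 := integral_add (hmin.add (hA.const_mul 2)) (hB.const_mul 2)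
    have h3 := integral_add hmin (hA.const_mul 2)
    simp only [Pi.add_apply] at h1 h2 h3
    simp only [hw]
    rw [h1, h2, h3, integral_const_mul, integral_const_mul]
    simp
  rw [hwint] at h01
  simp only [Real.norm_eq_abs] at ha' hb'
  linarith

variable {X : Type*} [MetricSpace X] [MeasurableSpace X] [BorelSpace X] {m : Measure X} {p : ℝ}

/-- The pointwise minimum of two weak upper gradients is a weak upper gradient: along almost every
curve both control the increments over all intervals with rational endpoints, and on short intervals
the smaller one may be chosen. -/
theorem IsWeakUpperGradient.inf {f G₁ G₂ : X → ℝ} (hp : 1 < p)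
    (h₁ : IsWeakUpperGradient p m f G₁) (h₂ : IsWeakUpperGradient p m f G₂) :
    IsWeakUpperGradient p m f (fun x => min (G₁ x) (G₂ x)) := by
  refine isWeakUpperGradient_of_lintegral_le hp h₁.aemeasurable (h₁.memLp.inf h₂.memLp)
    (by filter_upwards [h₁.nonneg, h₂.nonneg] with x h1 h2 using le_min h1 h2) fun π hπ => ?_
  have hq := (Real.HolderConjugate.conjExponent hp).symm.lt
  have := hπ.isProbabilityMeasure
  have hMm : AEMeasurable (fun x => min (G₁ x) (G₂ x)) m :=
    h₁.memLp.1.aemeasurable.min h₂.memLp.1.aemeasurable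
  rw [hπ.lintegral_speedMeasure hMm.ennreal_ofReal]
  set D : Set I := Set.range fun r : ℚ => Set.projIcc (0 : ℝ) 1 zero_le_one r with hD
  have hDc : D.Countable := Set.countable_range _
  have hall : ∀ {G : X → ℝ}, IsWeakUpperGradient p m f G → ∀ᵐ γ ∂π, ∀ s ∈ D, ∀ t ∈ D, s ≤ t →
      ENNReal.ofReal |f (γ t) - f (γ s)| ≤
        ∫⁻ r in Set.Ioc s t, ENNReal.ofReal (G (γ r)) * localSpeed γ r := by
    intro G hG
    rw [ae_ball_iff hDc]
    intro s hs
    rw [ae_ball_iff hDc]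
    intro t ht
    by_cases hst : s ≤ t
    · filter_upwards [hG.ae_le hp hπ hst] with γ hγ _ using hγ
    · exact .of_forall fun γ h => absurd h hst
  have hfin : ∀ {G : X → ℝ}, IsWeakUpperGradient p m f G → ∀ᵐ γ ∂π,
      AEMeasurable (fun r : I => ENNReal.ofReal (G (γ r)) * localSpeed γ r) ∧
      ∫⁻ r, ENNReal.ofReal (G (γ r)) * localSpeed γ r ≠ ∞ := by
    intro G hG
    have hGm := hG.memLp.1.aemeasurable
    have h1 := hπ.lintegral_ofReal_speedMeasure_lt_top hp hG.memLp
    have h2 : Measurable fun z : C(I, X) × I =>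
        ENNReal.ofReal (hGm.mk G (z.1 z.2)) * localSpeed z.1 z.2 :=
      (hGm.measurable_mk.ennreal_ofReal.comp measurable_eval_prod).mul measurable_localSpeed
    have h0 : ∫⁻ x, ENNReal.ofReal (G x) ∂(speedMeasure π) =
        ∫⁻ x, ENNReal.ofReal (hGm.mk G x) ∂(speedMeasure π) :=
      lintegral_congr_ae (hπ.speedMeasure_ac.ae_le (hGm.ae_eq_mk.fun_comp ENNReal.ofReal))
    rw [h0, lintegral_speedMeasure_of_measurable hGm.measurable_mk.ennreal_ofReal] at h1
    filter_upwards [ae_lt_top h2.lintegral_prod_right' h1.ne, hπ.ae_ae_eval hGm.ae_eq_mk]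
      with γ hγ hγ'
    have h3 : (fun r : I => ENNReal.ofReal (G (γ r)) * localSpeed γ r) =ᵐ[volume]
        fun r => ENNReal.ofReal (hGm.mk G (γ r)) * localSpeed γ r := by
      filter_upwards [hγ'] with r hr
      rw [hr]
    refine ⟨(h2.of_uncurry_left (f := fun γ r => ENNReal.ofReal (hGm.mk G (γ r)) *
      localSpeed γ r)).aemeasurable.congr h3.symm, ?_⟩
    rw [lintegral_congr_ae h3]
    exact hγ.ne
  refine lintegral_mono_ae ?_
  filter_upwards [hall h₁, hall h₂, hfin h₁, hfin h₂] with γ a₁ a₂ b₁ b₂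
  have hconv : ∀ {w : I → ℝ≥0∞}, AEMeasurable w → ∫⁻ r, w r ≠ ∞ → ∀ s t : I,
      ENNReal.ofReal |f (γ t) - f (γ s)| ≤ ∫⁻ r in Set.Ioc s t, w r →
      |f (γ t) - f (γ s)| ≤ ∫ r in Set.Ioc s t, (w r).toReal := by
    intro w hw hwfin s t hle
    have h1 : ∫⁻ r in Set.Ioc s t, w r ≠ ∞ :=
      ((setLIntegral_le_lintegral _ _).trans_lt hwfin.lt_top).ne
    rw [integral_toReal hw.restrict (ae_lt_top' hw.restrict h1)]
    exact (ENNReal.ofReal_le_iff_le_toReal h1).1 hle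
  have key := abs_sub_le_integral_min (D := D) (F := fun t => f (γ t)) (fun r => ⟨r, rfl⟩)
    (integrable_toReal_of_lintegral_ne_top b₁.1 b₁.2)
    (integrable_toReal_of_lintegral_ne_top b₂.1 b₂.2)
    (fun s hs t ht hst => hconv b₁.1 b₁.2 s t (a₁ s hs t ht hst))
    (fun s hs t ht hst => hconv b₂.1 b₂.2 s t (a₂ s hs t ht hst))
  refine (ENNReal.ofReal_le_ofReal key).trans ?_
  have hmini : Integrable fun r : I => min (ENNReal.ofReal (G₁ (γ r)) * localSpeed γ r).toReal
      (ENNReal.ofReal (G₂ (γ r)) * localSpeed γ r).toReal :=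
    (integrable_toReal_of_lintegral_ne_top b₁.1 b₁.2).inf
      (integrable_toReal_of_lintegral_ne_top b₂.1 b₂.2)
  rw [ofReal_integral_eq_lintegral_ofReal hmini
    (.of_forall fun r => le_min ENNReal.toReal_nonneg ENNReal.toReal_nonneg)]
  refine lintegral_mono fun r => ?_
  dsimp only
  rw [ENNReal.ofReal_min, ENNReal.ofReal_min]
  rcases min_choice (ENNReal.ofReal (G₁ (γ r))) (ENNReal.ofReal (G₂ (γ r))) with h | h <;> rw [h]
  · exact (min_le_left _ _).trans ENNReal.ofReal_toReal_le
  · exact (min_le_right _ _).trans ENNReal.ofReal_toReal_le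

/-- Weak upper gradients are stable under decreasing limits. -/
theorem IsWeakUpperGradient.of_antitone {f G : X → ℝ} (hp : 1 < p) {H : ℕ → X → ℝ}
    (hH : ∀ n, IsWeakUpperGradient p m f (H n)) (hanti : ∀ x, Antitone fun n => H n x)
    (hlim : ∀ᵐ x ∂m, Tendsto (fun n => H n x) atTop (𝓝 (G x))) : IsWeakUpperGradient p m f G := by
  have hG0 : 0 ≤ᵐ[m] G := by
    filter_upwards [hlim, ae_all_iff.2 fun n => (hH n).nonneg] with x h1 h2
    exact ge_of_tendsto' h1 h2
  have hGm : AEStronglyMeasurable G m :=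
    aestronglyMeasurable_of_tendsto_ae atTop (fun n => (hH n).memLp.1) hlim
  have hle : ∀ᵐ x ∂m, G x ≤ H 0 x := by
    filter_upwards [hlim] with x h1
    exact le_of_tendsto' h1 fun n => hanti x (Nat.zero_le n)
  have hGLp : MemLp G (ENNReal.ofReal p) m := by
    refine (hH 0).memLp.mono hGm ?_
    filter_upwards [hG0, hle] with x h1 h2
    rw [Real.norm_of_nonneg h1]
    exact h2.trans (le_abs_self _)
  refine isWeakUpperGradient_of_lintegral_le hp (hH 0).aemeasurable hGLp hG0 fun π hπ => ?_
  have hac := hπ.speedMeasure_ac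
  have h1 : Tendsto (fun n => ∫⁻ x, ENNReal.ofReal (H n x) ∂(speedMeasure π)) atTop
      (𝓝 (∫⁻ x, ENNReal.ofReal (G x) ∂(speedMeasure π))) := by
    refine tendsto_lintegral_of_dominated_convergence' (fun x => ENNReal.ofReal (H 0 x))
      (fun n => ((hH n).memLp.1.aemeasurable.mono_ac hac).ennreal_ofReal)
      (fun n => .of_forall fun x => ENNReal.ofReal_le_ofReal (hanti x (Nat.zero_le n)))
      (hπ.lintegral_ofReal_speedMeasure_lt_top hp (hH 0).memLp).ne ?_
    filter_upwards [hac.ae_le hlim] with x hx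
    exact (ENNReal.continuous_ofReal.tendsto _).comp hx
  exact ge_of_tendsto' h1 fun n => (hH n).lintegral_le hp hπ

end MinUpperGradient

/-! ### Almost everywhere minimal elements -/

section Minimal

variable {α : Type*} [MeasurableSpace α] {m : Measure α} {p : ℝ}

/-- A nonempty class of nonnegative `L^p` functions that is stable under pairwise minima and
decreasing limits has an almost everywhere smallest element, namely one of minimal norm. -/
theorem exists_ae_least (hp : 0 < p) {𝒢 : (α → ℝ) → Prop} (hne : ∃ G, 𝒢 G)
    (hmem : ∀ G, 𝒢 G → MemLp G (ENNReal.ofReal p) m) (hpos : ∀ G, 𝒢 G → 0 ≤ᵐ[m] G)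
    (hinf : ∀ G H, 𝒢 G → 𝒢 H → 𝒢 fun x => min (G x) (H x))
    (hlim : ∀ (H : ℕ → α → ℝ) (G : α → ℝ), (∀ n, 𝒢 (H n)) → (∀ x, Antitone fun n => H n x) →
      (∀ᵐ x ∂m, Tendsto (fun n => H n x) atTop (𝓝 (G x))) → 𝒢 G) :
    ∃ g, 𝒢 g ∧ ∀ G, 𝒢 G → g ≤ᵐ[m] G := by
  set E : (α → ℝ) → ℝ≥0∞ := fun G => ∫⁻ x, ‖G x‖ₑ ^ p ∂m with hE
  have hEmono : ∀ G H, 𝒢 G → G ≤ᵐ[m] H → E G ≤ E H := fun G H hG hGH => by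
    refine lintegral_mono_ae ?_
    filter_upwards [hpos G hG, hGH] with x h1 h2
    gcongr
    rw [enorm_le_iff_norm_le, Real.norm_of_nonneg h1]
    exact h2.trans (le_abs_self _)
  obtain ⟨u, -, hu, huS⟩ := exists_seq_tendsto_sInf (S := E '' {G | 𝒢 G})
    (hne.elim fun G hG => ⟨_, G, hG, rfl⟩) (OrderBot.bddBelow _)
  choose K hK hKu using huS
  let H : ℕ → α → ℝ := fun n => Nat.rec (K 0) (fun n h x => min (h x) (K (n + 1) x)) n
  have hHs : ∀ n x, H (n + 1) x = min (H n x) (K (n + 1) x) := fun n x => rfl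
  have hH : ∀ n, 𝒢 (H n) := by
    intro n
    induction n with
    | zero => exact hK 0
    | succ n ih => exact hinf _ _ ih (hK (n + 1))
  have hHK : ∀ n x, H n x ≤ K n x := by
    intro n x
    cases n with
    | zero => exact le_rfl
    | succ n => exact min_le_right _ _
  have hanti : ∀ x, Antitone fun n => H n x := fun x =>
    antitone_nat_of_succ_le fun n => (hHs n x).trans_le (min_le_left _ _)
  have hconv : ∀ᵐ x ∂m, Tendsto (fun n => H n x) atTop (𝓝 (⨅ n, H n x)) := by
    filter_upwards [ae_all_iff.2 fun n => hpos _ (hH n)] with x hx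
    exact tendsto_atTop_ciInf (hanti x) ⟨0, by rintro _ ⟨n, rfl⟩; exact hx n⟩
  have hg := hlim H _ hH hanti hconv
  refine ⟨_, hg, fun G hG => ?_⟩
  set g := fun x => ⨅ n, H n x with hgdef
  have hgmin : E g ≤ sInf (E '' {G | 𝒢 G}) := by
    refine ge_of_tendsto' hu fun n => ?_
    rw [← hKu n]
    refine hEmono _ _ hg ?_
    filter_upwards [hconv] with x hx
    exact ((hanti x).le_of_tendsto hx n).trans (hHK n x)
  have hmin := hinf g G hg hG
  have h1 : (fun x => ‖min (g x) (G x)‖ₑ ^ p) =ᵐ[m] fun x => ‖g x‖ₑ ^ p := by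
    refine ae_eq_of_ae_le_of_lintegral_le ?_ ((memLp_ofReal_iff hp).1 (hmem _ hmin)).2.ne
      ((hmem g hg).1.enorm.pow_const p) (hgmin.trans (sInf_le ⟨_, hmin, rfl⟩))
    filter_upwards [hpos _ hmin] with x hx
    gcongr
    rw [enorm_le_iff_norm_le, Real.norm_of_nonneg hx]
    exact (min_le_left _ _).trans (le_abs_self _)
  filter_upwards [h1, hpos g hg, hpos G hG] with x hx h2 h3
  have h4 := ENNReal.rpow_left_injective hp.ne' hx
  rw [Real.enorm_of_nonneg (le_min h2 h3), Real.enorm_of_nonneg h2,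
    ENNReal.ofReal_eq_ofReal_iff (le_min h2 h3) h2] at h4
  exact h4 ▸ min_le_right _ _

end Minimal

/-! ### Existence of minimal weak upper gradients -/

section MinimalUpperGradient

variable {X : Type*} [MetricSpace X] [MeasurableSpace X] {m : Measure X} {p : ℝ}

theorem exists_isMinimalWeakUpperGradient [BorelSpace X] (hp : 1 < p) {f G : X → ℝ}
    (h : IsWeakUpperGradient p m f G) : ∃ g, IsMinimalWeakUpperGradient p m f g :=
  exists_ae_least (by positivity) ⟨G, h⟩ (fun _ h => h.memLp) (fun _ h => h.nonneg)
    (fun _ _ h₁ h₂ => h₁.inf hp h₂) fun _ _ hH ha hl => .of_antitone hp hH ha hl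

theorem exists_isMinimalMetricWeakUpperGradient (hp : 1 < p) {Y : Type*} [MetricSpace Y]
    {u : X → Y} {G : X → ℝ} (h : IsMetricWeakUpperGradient p m u G) :
    ∃ g, IsMinimalMetricWeakUpperGradient p m u g := by
  refine exists_ae_least (by positivity) ⟨G, h⟩ (fun _ h => h.memLp) (fun _ h => h.nonneg) ?_ ?_
  · intro G H hG hH
    refine ⟨hG.memLp.inf hH.memLp, ?_, fun φ hφ => ?_⟩
    · filter_upwards [hG.nonneg, hH.nonneg] with x h1 h2 using le_min h1 h2
    · obtain ⟨g, hg, hgG⟩ := hG.comp_lipschitz φ hφ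
      obtain ⟨g', hg', hgH⟩ := hH.comp_lipschitz φ hφ
      refine ⟨g, hg, ?_⟩
      filter_upwards [hgG, hgH, hg.2 g' hg'.1] with x h1 h2 h3 using le_min h1 (h3.trans h2)
  · intro H G hH ha hl
    have hG0 : 0 ≤ᵐ[m] G := by
      filter_upwards [hl, ae_all_iff.2 fun n => (hH n).nonneg] with x h1 h2
      exact ge_of_tendsto' h1 h2
    refine ⟨?_, hG0, fun φ hφ => ?_⟩
    · refine (hH 0).memLp.mono
        (aestronglyMeasurable_of_tendsto_ae atTop (fun n => (hH n).memLp.1) hl) ?_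
      filter_upwards [hG0, hl] with x h1 h2
      rw [Real.norm_of_nonneg h1]
      exact (le_of_tendsto' h2 fun n => ha x (Nat.zero_le n)).trans (le_abs_self _)
    · choose g hg hgH using fun n => (hH n).comp_lipschitz φ hφ
      refine ⟨g 0, hg 0, ?_⟩
      filter_upwards [hl, ae_all_iff.2 hgH, ae_all_iff.2 fun n => (hg 0).2 _ (hg n).1]
        with x h1 h2 h3
      exact ge_of_tendsto' h1 fun n => (h3 n).trans (h2 n)

end MinimalUpperGradient

/-! ### Averages over balls -/

section BallAverage

variable {X : Type*} [MetricSpace X] [MeasurableSpace X]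

/-- The average of `h` over the ball of radius `s` around `x`, meaningful if this ball has positive
finite measure. -/
def ballAvg (m : Measure X) (s : ℝ) (h : X → ℝ≥0∞) (x : X) : ℝ≥0∞ :=
  (∫⁻ y in Metric.ball x s, h y ∂m) / m (Metric.ball x s)

/-- The balls of `m` have positive finite measure, and the doubling inequality holds with constant
`D` at the scales below `R`. -/
structure IsDoublingBelow (m : Measure X) (D : ℝ≥0∞) (R : ℝ) : Prop where
  measure_ball_pos : ∀ (x : X) {r : ℝ}, 0 < r → m (Metric.ball x r) ≠ 0
  measure_ball_lt_top : ∀ (x : X) (r : ℝ), m (Metric.ball x r) ≠ ∞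
  doubling : ∀ (x : X) {r : ℝ}, 0 < r → r < R →
    m (Metric.ball x (2 * r)) ≤ D * m (Metric.ball x r)

variable {m : Measure X} {D : ℝ≥0∞} {R s : ℝ}

theorem ballAvg_mono {h h' : X → ℝ≥0∞} {x : X} [OpensMeasurableSpace X]
    (H : ∀ y ∈ Metric.ball x s, h y ≤ h' y) : ballAvg m s h x ≤ ballAvg m s h' x := by
  unfold ballAvg
  exact ENNReal.div_le_div_right (setLIntegral_mono' Metric.isOpen_ball.measurableSet H) _

theorem ballAvg_congr_ae {h h' : X → ℝ≥0∞} {x : X} (H : h =ᵐ[m] h') :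
    ballAvg m s h x = ballAvg m s h' x := by
  unfold ballAvg
  rw [lintegral_congr_ae (ae_restrict_of_ae H)]

theorem ballAvg_const (hm : IsDoublingBelow m D R) (hs : 0 < s) (c : ℝ≥0∞) (x : X) :
    ballAvg m s (fun _ => c) x = c := by
  rw [ballAvg, setLIntegral_const, ENNReal.mul_div_cancel_right (hm.measure_ball_pos x hs)
    (hm.measure_ball_lt_top x s)]

theorem ballAvg_add {h h' : X → ℝ≥0∞} (hh : Measurable h) (x : X) :
    ballAvg m s (fun y => h y + h' y) x = ballAvg m s h x + ballAvg m s h' x := by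
  rw [ballAvg, lintegral_add_left hh, ENNReal.add_div]; rfl

theorem ballAvg_const_mul {h : X → ℝ≥0∞} (hh : Measurable h) (c : ℝ≥0∞) (x : X) :
    ballAvg m s (fun y => c * h y) x = c * ballAvg m s h x := by
  rw [ballAvg, lintegral_const_mul _ hh, mul_div_assoc]; rfl

/-- Averages over comparable nested balls are comparable. -/
theorem ballAvg_le_mul_ballAvg {h : X → ℝ≥0∞} {x v : X} {t : ℝ} {K : ℝ≥0∞}
    (hx : m (Metric.ball x s) ≠ 0) (hx' : m (Metric.ball x s) ≠ ∞)
    (hv : m (Metric.ball v t) ≠ 0) (hv' : m (Metric.ball v t) ≠ ∞)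
    (hsub : Metric.ball x s ⊆ Metric.ball v t)
    (hK : m (Metric.ball v t) ≤ K * m (Metric.ball x s)) :
    ballAvg m s h x ≤ K * ballAvg m t h v := by
  unfold ballAvg
  rw [ENNReal.div_le_iff hx hx']
  calc ∫⁻ y in Metric.ball x s, h y ∂m ≤ ∫⁻ y in Metric.ball v t, h y ∂m := lintegral_mono_set hsub
    _ = m (Metric.ball v t) * ((∫⁻ y in Metric.ball v t, h y ∂m) / m (Metric.ball v t)) :=
        (ENNReal.mul_div_cancel hv hv').symm
    _ ≤ K * m (Metric.ball x s) * ((∫⁻ y in Metric.ball v t, h y ∂m) / m (Metric.ball v t)) := by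
        gcongr
    _ = _ := by ring

/-- Jensen's inequality for averages over balls. -/
theorem ballAvg_le_rpow (hm : IsDoublingBelow m D R) (hs : 0 < s) {p : ℝ} (hp : 1 < p)
    {h : X → ℝ≥0∞} (hh : Measurable h) (x : X) :
    ballAvg m s h x ≤ (ballAvg m s (fun y => h y ^ p) x) ^ (1 / p) := by
  have hpq := Real.HolderConjugate.conjExponent hp
  have hb := hm.measure_ball_pos x hs
  have hb' := hm.measure_ball_lt_top x s
  have h1 := ENNReal.lintegral_mul_le_Lp_mul_Lq (m.restrict (Metric.ball x s)) hpq
    hh.aemeasurable (measurable_const (a := (1 : ℝ≥0∞))).aemeasurable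
  simp only [Pi.mul_apply, mul_one, ENNReal.one_rpow, lintegral_const, Measure.restrict_apply_univ,
    one_mul] at h1
  unfold ballAvg
  rw [ENNReal.div_rpow_of_nonneg _ _ (by have := hpq.pos; positivity), ENNReal.div_le_iff hb hb']
  refine h1.trans_eq ?_
  have h2 : m (Metric.ball x s) ^ (1 / p.conjExponent) =
      m (Metric.ball x s) / m (Metric.ball x s) ^ (1 / p) := by
    have h3 : 1 / p.conjExponent = 1 - 1 / p := by
      have := hpq.inv_add_inv_eq_one; simp only [one_div]; linarith
    rw [h3, ENNReal.rpow_sub _ _ hb hb', ENNReal.rpow_one]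
  rw [h2]
  simp only [div_eq_mul_inv]
  ring

variable [BorelSpace X] [SecondCountableTopology X] [SFinite m]

theorem measurableSet_dist_lt (s : ℝ) : MeasurableSet {z : X × X | dist z.2 z.1 < s} :=
  (isOpen_lt (by fun_prop) continuous_const).measurableSet

theorem measurable_measure_ball (s : ℝ) : Measurable fun x => m (Metric.ball x s) :=
  measurable_measure_prodMk_left (measurableSet_dist_lt s)

theorem measurable_lintegral_ball {F : X → X → ℝ≥0∞} (hF : Measurable fun z : X × X => F z.1 z.2) :
    Measurable fun x => ∫⁻ y in Metric.ball x s, F x y ∂m := by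
  have h1 : ∀ x, ∫⁻ y in Metric.ball x s, F x y ∂m =
      ∫⁻ y, {z : X × X | dist z.2 z.1 < s}.indicator (fun z => F z.1 z.2) (x, y) ∂m := fun x => by
    rw [← lintegral_indicator Metric.isOpen_ball.measurableSet]
    rfl
  simp_rw [h1]
  exact (hF.indicator (measurableSet_dist_lt s)).lintegral_prod_right'

theorem measurable_ballAvg_prod {F : X → X → ℝ≥0∞} (hF : Measurable fun z : X × X => F z.1 z.2) :
    Measurable fun x => ballAvg m s (F x) x :=
  (measurable_lintegral_ball hF).div (measurable_measure_ball s)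

theorem measurable_ballAvg {h : X → ℝ≥0∞} (hh : Measurable h) : Measurable (ballAvg m s h) :=
  measurable_ballAvg_prod (F := fun _ => h) (hh.comp measurable_snd)

/-- Averaging over balls is self-adjoint up to the doubling constant. -/
theorem lintegral_ballAvg_mul_le (hm : IsDoublingBelow m D R) (hs : 0 < s) (hsR : s < R)
    {h ρ : X → ℝ≥0∞} (hh : Measurable h) (hρ : Measurable ρ) :
    ∫⁻ v, ballAvg m s h v * ρ v ∂m ≤ D * ∫⁻ z, h z * ballAvg m s ρ z ∂m := by
  set b : X → ℝ≥0∞ := fun x => m (Metric.ball x s) with hb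
  have hbm : Measurable b := measurable_measure_ball s
  set S : Set (X × X) := {z | dist z.2 z.1 < s} with hS
  have hSm : MeasurableSet S := measurableSet_dist_lt s
  have e1 : ∀ v, ballAvg m s h v * ρ v =
      ∫⁻ z, S.indicator (fun a => h a.2 * (b a.1)⁻¹ * ρ a.1) (v, z) ∂m := fun v => by
    have h1 : ∀ z, S.indicator (fun a => h a.2 * (b a.1)⁻¹ * ρ a.1) (v, z) =
        (Metric.ball v s).indicator h z * ((b v)⁻¹ * ρ v) := fun z => by
      by_cases hz : z ∈ Metric.ball v s
      · rw [Set.indicator_of_mem hz, Set.indicator_of_mem (show (v, z) ∈ S from hz), mul_assoc]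
      · rw [Set.indicator_of_notMem hz, Set.indicator_of_notMem (show (v, z) ∉ S from hz), zero_mul]
    simp_rw [h1]
    rw [lintegral_mul_const _ (hh.indicator Metric.isOpen_ball.measurableSet),
      lintegral_indicator Metric.isOpen_ball.measurableSet, ballAvg, div_eq_mul_inv, mul_assoc]
  simp_rw [e1]
  rw [lintegral_lintegral_swap
    (f := fun v z => S.indicator (fun a => h a.2 * (b a.1)⁻¹ * ρ a.1) (v, z))
    ((((hh.comp measurable_snd).mul (hbm.inv.comp measurable_fst)).mul
      (hρ.comp measurable_fst)).indicator hSm).aemeasurable]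
  rw [← lintegral_const_mul _ (show Measurable fun z => h z * ballAvg m s ρ z from
    hh.mul (measurable_ballAvg hρ))]
  refine lintegral_mono fun z => ?_
  have e2 : ∀ v, S.indicator (fun a => h a.2 * (b a.1)⁻¹ * ρ a.1) (v, z) ≤
      (D * h z * (b z)⁻¹) * (Metric.ball z s).indicator ρ v := fun v => by
    by_cases hv : v ∈ Metric.ball z s
    · have hv' : (v, z) ∈ S := (dist_comm z v).trans_lt hv
      rw [Set.indicator_of_mem hv, Set.indicator_of_mem hv']
      dsimp only
      have h2 : b z ≤ D * b v := by
        refine le_trans (measure_mono ?_) (hm.doubling v hs hsR)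
        intro w hw
        rw [Metric.mem_ball] at hw hv ⊢
        have := dist_triangle w z v
        rw [dist_comm z v] at this
        linarith
      have h3 : (b v)⁻¹ ≤ D * (b z)⁻¹ := by
        have hv0 := hm.measure_ball_pos v hs
        have hvt := hm.measure_ball_lt_top v s
        have hz0 := hm.measure_ball_pos z hs
        have hzt := hm.measure_ball_lt_top z s
        rw [← div_eq_mul_inv, ENNReal.le_div_iff_mul_le (.inl hz0) (.inl hzt), mul_comm,
          ← div_eq_mul_inv, ENNReal.div_le_iff hv0 hvt]
        exact h2
      calc h z * (b v)⁻¹ * ρ v ≤ h z * (D * (b z)⁻¹) * ρ v := by gcongr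
        _ = _ := by ring
    · have hv' : (v, z) ∉ S := fun h' => hv ((dist_comm v z).trans_lt h')
      rw [Set.indicator_of_notMem hv']; exact zero_le
  refine (lintegral_mono e2).trans_eq ?_
  rw [lintegral_const_mul _ (hρ.indicator Metric.isOpen_ball.measurableSet),
    lintegral_indicator Metric.isOpen_ball.measurableSet]
  simp only [ballAvg, div_eq_mul_inv, hb]
  ring

theorem lintegral_ballAvg_rpow_le (hm : IsDoublingBelow m D R) (hs : 0 < s) (hsR : s < R) {p : ℝ}
    (hp : 1 < p) {h : X → ℝ≥0∞} (hh : Measurable h) :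
    ∫⁻ v, ballAvg m s h v ^ p ∂m ≤ D * ∫⁻ z, h z ^ p ∂m := by
  have h1 := lintegral_ballAvg_mul_le hm hs hsR (hh.pow_const p)
    (measurable_const (a := (1 : ℝ≥0∞)))
  simp only [mul_one, ballAvg_const hm hs] at h1
  refine le_trans (lintegral_mono fun v => ?_) h1
  calc ballAvg m s h v ^ p ≤ ((ballAvg m s (fun y => h y ^ p) v) ^ (1 / p)) ^ p := by
        gcongr; exact ballAvg_le_rpow hm hs hp hh v
    _ = _ := by rw [← ENNReal.rpow_mul, one_div_mul_cancel (by positivity), ENNReal.rpow_one]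

end BallAverage

/-! ### Mean oscillation -/

section Oscillation

variable {X : Type*} [MetricSpace X] [MeasurableSpace X] [BorelSpace X]
  {m : Measure X} {D : ℝ≥0∞} {R s : ℝ} {q : ℝ}

/-- The mean oscillation `⨍_{B_s(x)} |ρ(y) - ρ(x)| dm(y)`. -/
def meanOsc (m : Measure X) (s : ℝ) (ρ : X → ℝ) (x : X) : ℝ≥0∞ :=
  ballAvg m s (fun y => ‖ρ y - ρ x‖ₑ) x

theorem meanOsc_le_add (hm : IsDoublingBelow m D R) (hs : 0 < s) {ρ f : X → ℝ} (hρ : Measurable ρ)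
    (hf : Measurable f) (x : X) :
    meanOsc m s ρ x ≤ meanOsc m s f x + (ballAvg m s (fun y => ‖ρ y - f y‖ₑ) x + ‖ρ x - f x‖ₑ) := by
  have h1 : Measurable fun y => ‖f y - f x‖ₑ := (hf.sub_const _).enorm
  have h2 : Measurable fun y => ‖ρ y - f y‖ₑ := (hρ.sub hf).enorm
  conv_rhs => rw [← ballAvg_const hm hs ‖ρ x - f x‖ₑ x, ← ballAvg_add h2, meanOsc, ← ballAvg_add h1]
  refine ballAvg_mono fun y _ => ?_
  have : ρ y - ρ x = (f y - f x) + ((ρ y - f y) + (f x - ρ x)) := by ring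
  rw [this, enorm_sub_rev (ρ x)]
  exact (enorm_add_le _ _).trans (by gcongr; exact enorm_add_le _ _)

/-- `L^q` functions are approximated by bounded continuous functions that vanish off a ball. No
compactness is assumed, so the supports are merely bounded. -/
theorem exists_continuous_bounded_support (hq : 0 < q) [m.WeaklyRegular]
    {ρ : X → ℝ} (hρ : MemLp ρ (ENNReal.ofReal q) m) (x₀ : X) {η : ℝ≥0∞} (hη : η ≠ 0) :
    ∃ (f : X → ℝ) (M r : ℝ), Continuous f ∧ (∀ x, |f x| ≤ M) ∧
      (∀ x, x ∉ Metric.ball x₀ r → f x = 0) ∧ eLpNorm (ρ - f) (ENNReal.ofReal q) m ≤ η := by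
  obtain ⟨η₁, hη₁, hη₁'⟩ := exists_Lp_half ℝ m (ENNReal.ofReal q) hη
  obtain ⟨g, hg, hgLp⟩ := hρ.exists_boundedContinuous_eLpNorm_sub_le ENNReal.ofReal_ne_top hη₁.ne'
  -- cut `g` off at the ball of radius `n + 1`
  let χ : ℕ → X → ℝ := fun n x => max 0 (min 1 (n + 1 - dist x x₀))
  have hχ0 : ∀ n x, 0 ≤ χ n x := fun n x => le_max_left _ _
  have hχ1 : ∀ n x, χ n x ≤ 1 := fun n x => max_le zero_le_one (min_le_left _ _)
  have hχc : ∀ n, Continuous (χ n) := fun n => by fun_prop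
  let F : ℕ → X → ℝ := fun n x => χ n x * g x
  have hFc : ∀ n, Continuous (F n) := fun n => (hχc n).mul g.continuous
  have hFle : ∀ n x, |F n x| ≤ |g x| := fun n x => by
    simp only [F, abs_mul, abs_of_nonneg (hχ0 n x)]
    exact mul_le_of_le_one_left (abs_nonneg _) (hχ1 n x)
  have hlim : Tendsto (fun n => eLpNorm (F n - ⇑g) (ENNReal.ofReal q) m) atTop (𝓝 0) := by
    refine tendsto_eLpNorm_sub_of_dominated hq (b := fun x => |g x|)
      (fun n => (hFc n).measurable.aestronglyMeasurable)
      hgLp.1 hgLp.abs (fun n => .of_forall (hFle n)) (.of_forall fun x => le_rfl)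
      (.of_forall fun x => ?_)
    obtain ⟨N, hN⟩ := exists_nat_ge (dist x x₀)
    refine tendsto_const_nhds.congr' ?_
    filter_upwards [eventually_ge_atTop N] with n hn
    have hn' : (N : ℝ) ≤ n := by exact_mod_cast hn
    have : χ n x = 1 := by
      simp only [χ]
      rw [min_eq_left (by linarith), max_eq_right zero_le_one]
    simp only [F, this, one_mul]
  obtain ⟨n, hn⟩ := ((ENNReal.tendsto_nhds_zero.1 hlim) η₁ hη₁).exists
  refine ⟨F n, ‖g‖, n + 1, hFc n, fun x => (hFle n x).trans (g.norm_coe_le_norm x),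
    fun x hx => ?_, ?_⟩
  · have h1 : (n : ℝ) + 1 ≤ dist x x₀ := not_lt.1 hx
    have : χ n x = 0 := by
      simp only [χ]
      exact max_eq_left ((min_le_right _ _).trans (by linarith))
    simp only [F, this, zero_mul]
  · have h1 : ρ - F n = (ρ - ⇑g) + (⇑g - F n) := by abel
    rw [h1]
    refine (hη₁' _ _ (hρ.1.sub hgLp.1)
      (hgLp.1.sub (hFc n).measurable.aestronglyMeasurable) hg ?_).le
    rw [eLpNorm_sub_comm]; exact hn

variable [SecondCountableTopology X] [SFinite m]

theorem measurable_meanOsc {ρ : X → ℝ} (hρ : Measurable ρ) : Measurable (meanOsc m s ρ) :=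
  measurable_ballAvg_prod (F := fun x y => ‖ρ y - ρ x‖ₑ)
    ((hρ.comp measurable_snd).sub (hρ.comp measurable_fst)).enorm

/-- Mean oscillations of a bounded continuous function that vanishes off a ball tend to zero
pointwise, hence in `L^q` by dominated convergence. -/
theorem tendsto_lintegral_meanOsc_of_continuous (hm : IsDoublingBelow m D R) (hq : 0 < q)
    {f : X → ℝ} (hf : Continuous f) {M r : ℝ} (hM : ∀ x, |f x| ≤ M) {x₀ : X}
    (hsupp : ∀ x, x ∉ Metric.ball x₀ r → f x = 0) :
    Tendsto (fun s => ∫⁻ x, meanOsc m s f x ^ q ∂m) (𝓝[>] 0) (𝓝 0) := by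
  have key : Tendsto (fun s => ∫⁻ x, meanOsc m s f x ^ q ∂m) (𝓝[>] 0) (𝓝 (∫⁻ _, 0 ∂m)) := by
    refine tendsto_lintegral_filter_of_dominated_convergence
      ((Metric.ball x₀ (r + 1)).indicator fun _ => (ENNReal.ofReal (2 * M)) ^ q)
      (.of_forall fun s => (measurable_meanOsc hf.measurable).pow_const q) ?_ ?_ ?_
    · filter_upwards [Ioo_mem_nhdsGT zero_lt_one] with s hs
      refine .of_forall fun x => ?_
      by_cases hx : x ∈ Metric.ball x₀ (r + 1)
      · rw [Set.indicator_of_mem hx]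
        gcongr
        rw [← ballAvg_const hm hs.1 (ENNReal.ofReal (2 * M)) x]
        refine ballAvg_mono fun y _ => ?_
        rw [Real.enorm_eq_ofReal_abs]
        gcongr
        linarith [abs_sub (f y) (f x), hM x, hM y]
      · rw [Set.indicator_of_notMem hx]
        have h0 : meanOsc m s f x ≤ 0 := by
          rw [← ballAvg_const hm hs.1 0 x]
          refine ballAvg_mono fun y hy => ?_
          have hx' : x ∉ Metric.ball x₀ r := fun h => hx (Metric.ball_subset_ball (by linarith) h)
          have hy' : y ∉ Metric.ball x₀ r := fun h => hx (by
            rw [Metric.mem_ball] at h hy ⊢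
            have := dist_triangle x y x₀
            rw [dist_comm x y] at this
            linarith [hs.2])
          rw [hsupp x hx', hsupp y hy']
          simp
        rw [nonpos_iff_eq_zero.1 h0, ENNReal.zero_rpow_of_pos hq]
    · rw [lintegral_indicator Metric.isOpen_ball.measurableSet, setLIntegral_const]
      exact ENNReal.mul_ne_top (ENNReal.rpow_ne_top_of_nonneg hq.le ENNReal.ofReal_ne_top)
        (hm.measure_ball_lt_top _ _)
    · refine .of_forall fun x => ?_
      have h1 : Tendsto (fun s => meanOsc m s f x) (𝓝[>] 0) (𝓝 0) := by
        refine ENNReal.tendsto_nhds_zero.2 fun ε hε => ?_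
        have h2 : Tendsto (fun y => ‖f y - f x‖ₑ) (𝓝 x) (𝓝 0) := by
          have := ((hf.sub continuous_const).enorm (f := fun y => f y - f x)).tendsto x
          simpa using this
        obtain ⟨δ, hδ, hδf⟩ := Metric.eventually_nhds_iff_ball.1
          (ENNReal.tendsto_nhds_zero.1 h2 ε hε)
        filter_upwards [Ioo_mem_nhdsGT hδ] with s hs
        rw [← ballAvg_const hm hs.1 ε x]
        exact ballAvg_mono fun y hy => hδf y (Metric.ball_subset_ball hs.2.le hy)
      have := (ENNReal.continuous_rpow_const (y := q)).tendsto 0 |>.comp h1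
      simpa [ENNReal.zero_rpow_of_pos hq, Function.comp_def] using this
  simpa using key

/-- Mean oscillations of an `L^q` function tend to zero in `L^q` as the radius tends to zero:
averages over balls are bounded on `L^q` uniformly in the radius, so it is enough to consider a
dense class. -/
theorem tendsto_lintegral_meanOsc [m.WeaklyRegular] (hm : IsDoublingBelow m D R) (hR : 0 < R)
    (hD : D ≠ ∞) (hq : 1 < q) {ρ : X → ℝ} (hρm : Measurable ρ) (hρ : MemLp ρ (ENNReal.ofReal q) m) :
    Tendsto (fun s => ∫⁻ x, meanOsc m s ρ x ^ q ∂m) (𝓝[>] 0) (𝓝 0) := by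
  have hq0 : 0 < q := by positivity
  rcases isEmpty_or_nonempty X with he | ⟨⟨x₀⟩⟩
  · have : m = 0 := Measure.eq_zero_of_isEmpty m
    simp [this]
  suffices h : Tendsto (fun s => (∫⁻ x, meanOsc m s ρ x ^ q ∂m) ^ (1 / q)) (𝓝[>] 0) (𝓝 0) by
    have h2 := (ENNReal.continuous_rpow_const (y := q)).tendsto 0 |>.comp h
    simp only [ENNReal.zero_rpow_of_pos hq0, Function.comp_def, ← ENNReal.rpow_mul,
      one_div_mul_cancel hq0.ne', ENNReal.rpow_one] at h2
    exact h2
  refine ENNReal.tendsto_nhds_zero.2 fun ε hε => ?_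
  rcases eq_or_ne ε ∞ with rfl | hεt
  · exact .of_forall fun _ => le_top
  set c : ℝ≥0∞ := D ^ (1 / q) + 1 with hc
  have hct : c ≠ ∞ := ENNReal.add_ne_top.2
    ⟨ENNReal.rpow_ne_top_of_nonneg (by positivity) hD, ENNReal.one_ne_top⟩
  have hη : ε / 2 / c ≠ 0 := by
    simp [ENNReal.div_eq_zero_iff, hε.ne', hct]
  obtain ⟨f, M, r, hfc, hfM, hfr, hfρ⟩ := exists_continuous_bounded_support hq0 hρ x₀ hη
  rw [eLpNorm_ofReal_eq hq0] at hfρ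
  have hfm := hfc.measurable
  have hosc := tendsto_lintegral_meanOsc_of_continuous hm hq0 hfc hfM hfr
  have hosc' : Tendsto (fun s => (∫⁻ x, meanOsc m s f x ^ q ∂m) ^ (1 / q)) (𝓝[>] 0) (𝓝 0) := by
    have h2 := (ENNReal.continuous_rpow_const (y := 1 / q)).tendsto 0 |>.comp hosc
    simpa only [ENNReal.zero_rpow_of_pos (show 0 < 1 / q by positivity), Function.comp_def] using h2
  have hdm : Measurable fun x => ‖ρ x - f x‖ₑ := (hρm.sub hfm).enorm
  filter_upwards [ENNReal.tendsto_nhds_zero.1 hosc' (ε / 2) (by simpa using hε.ne'),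
    Ioo_mem_nhdsGT hR] with s hs hsR
  calc (∫⁻ x, meanOsc m s ρ x ^ q ∂m) ^ (1 / q)
      ≤ (∫⁻ x, (meanOsc m s f + (ballAvg m s (fun y => ‖ρ y - f y‖ₑ) +
          fun x => ‖ρ x - f x‖ₑ)) x ^ q ∂m) ^ (1 / q) := by
        gcongr with x
        exact meanOsc_le_add hm hsR.1 hρm hfm x
    _ ≤ (∫⁻ x, meanOsc m s f x ^ q ∂m) ^ (1 / q) +
        (∫⁻ x, (ballAvg m s (fun y => ‖ρ y - f y‖ₑ) + fun x => ‖ρ x - f x‖ₑ) x ^ q ∂m) ^ (1 / q) :=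
        ENNReal.lintegral_Lp_add_le (measurable_meanOsc hfm).aemeasurable
          ((measurable_ballAvg hdm).add hdm).aemeasurable hq.le
    _ ≤ ε / 2 + ((∫⁻ x, ballAvg m s (fun y => ‖ρ y - f y‖ₑ) x ^ q ∂m) ^ (1 / q) +
        (∫⁻ x, ‖ρ x - f x‖ₑ ^ q ∂m) ^ (1 / q)) := by
        gcongr
        exact ENNReal.lintegral_Lp_add_le (measurable_ballAvg hdm).aemeasurable
          hdm.aemeasurable hq.le
    _ ≤ ε / 2 + (D ^ (1 / q) * (ε / 2 / c) + ε / 2 / c) := by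
        gcongr
        · calc _ ≤ (D * ∫⁻ x, ‖ρ x - f x‖ₑ ^ q ∂m) ^ (1 / q) := by
                gcongr
                exact lintegral_ballAvg_rpow_le hm hsR.1 hsR.2 hq hdm
            _ = D ^ (1 / q) * (∫⁻ x, ‖ρ x - f x‖ₑ ^ q ∂m) ^ (1 / q) :=
                ENNReal.mul_rpow_of_nonneg _ _ (by positivity)
            _ ≤ _ := by gcongr; exact hfρ
        · exact hfρ
    _ = ε / 2 + c * (ε / 2 / c) := by rw [hc]; ring
    _ ≤ ε / 2 + ε / 2 := by gcongr; exact ENNReal.mul_div_le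
    _ = ε := ENNReal.add_halves ε

end Oscillation

/-! ### The averaged distance -/

section BallDist

variable {X : Type*} [MetricSpace X] [MeasurableSpace X]
  {Y : Type*} [MetricSpace Y] {m : Measure X} {D : ℝ≥0∞} {R s p : ℝ} {u : X → Y}

theorem IsDoublingBelow.measure_ball_pow_le (hm : IsDoublingBelow m D R) (hs : 0 < s) (x : X) :
    ∀ n : ℕ, 2 ^ n * s < 2 * R → m (Metric.ball x (2 ^ n * s)) ≤ D ^ n * m (Metric.ball x s)
  | 0, _ => by simp
  | n + 1, h => by
    have h1 : 2 ^ n * s < R := by rw [pow_succ] at h; linarith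
    have h2 : 0 < 2 ^ n * s := by positivity
    calc m (Metric.ball x (2 ^ (n + 1) * s)) = m (Metric.ball x (2 * (2 ^ n * s))) := by
          congr 2; ring
      _ ≤ D * m (Metric.ball x (2 ^ n * s)) := hm.doubling x h2 h1
      _ ≤ D * (D ^ n * m (Metric.ball x s)) := by
          gcongr; exact hm.measure_ball_pow_le hs x n (by linarith)
      _ = _ := by ring

/-- The Korevaar-Schoen density with values in `[0,∞]`, defined with the extended distance. It needs
no integrability, and agrees with `ksDensity` for maps in `L^p` (`ofReal_ksDensity`). -/
def eksDensity (p : ℝ) (m : Measure X) (u : X → Y) (r : ℝ) (x : X) : ℝ≥0∞ :=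
  (ballAvg m r (fun y => (edist (u x) (u y) / ENNReal.ofReal r) ^ p) x) ^ (1 / p)

/-- The average of `d(u(z), u(w))` over `z ∈ B_s(x)` and `w ∈ B_s(y)`. -/
def ballDist (m : Measure X) (u : X → Y) (s : ℝ) (x y : X) : ℝ≥0∞ :=
  ballAvg m s (fun z => ballAvg m s (fun w => edist (u z) (u w)) y) x

theorem MeasureTheory.StronglyMeasurable.measurable_edist_prod {Ω : Type*} [MeasurableSpace Ω]
    {v : Ω → Y} (hv : StronglyMeasurable v) : Measurable fun z : Ω × Ω => edist (v z.1) (v z.2) :=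
  ((hv.comp_measurable measurable_fst).edist (hv.comp_measurable measurable_snd)).measurable

theorem MeasureTheory.StronglyMeasurable.measurable_edist_left {Ω : Type*} [MeasurableSpace Ω]
    {v : Ω → Y} (hv : StronglyMeasurable v) (x : Ω) : Measurable fun y => edist (v x) (v y) :=
  hv.measurable_edist_prod.comp measurable_prodMk_left

/-- The average distance of `u` from its value at the centre of a ball of radius `r` is at most `r`
times the density. -/
theorem ballAvg_edist_le (hm : IsDoublingBelow m D R) (hp : 1 < p) (hu : StronglyMeasurable u)
    (hs : 0 < s) (x : X) :
    ballAvg m s (fun y => edist (u x) (u y)) x ≤ ENNReal.ofReal s * eksDensity p m u s x := by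
  have hs0 : ENNReal.ofReal s ≠ 0 := by simpa using hs
  have h1 : (fun y => edist (u x) (u y)) =
      fun y => ENNReal.ofReal s * (edist (u x) (u y) / ENNReal.ofReal s) := by
    ext y; rw [ENNReal.mul_div_cancel hs0 ENNReal.ofReal_ne_top]
  have hmeas : Measurable fun y => edist (u x) (u y) / ENNReal.ofReal s :=
    (hu.measurable_edist_left x).div_const _
  rw [h1, ballAvg_const_mul hmeas]
  gcongr
  exact ballAvg_le_rpow hm hs hp hmeas x

theorem ballAvg_edist_le_four (hm : IsDoublingBelow m D R) (hp : 1 < p) (hu : StronglyMeasurable u)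
    (hs : 0 < s) (hsR : 4 * s < R) (x : X) :
    ballAvg m s (fun y => edist (u x) (u y)) x ≤
      D ^ 2 * (ENNReal.ofReal (4 * s) * eksDensity p m u (4 * s) x) := by
  refine le_trans (ballAvg_le_mul_ballAvg (v := x) (t := 4 * s) (hm.measure_ball_pos x hs)
    (hm.measure_ball_lt_top x s) (hm.measure_ball_pos x (by positivity))
    (hm.measure_ball_lt_top x _) (Metric.ball_subset_ball (by linarith)) (K := D ^ 2) ?_) ?_
  · have := hm.measure_ball_pow_le hs x 2 (by linarith)
    norm_num at this
    exact this
  · gcongr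
    exact ballAvg_edist_le hm hp hu (by positivity) x

theorem measurable_ballAvg_edist [SFinite m] (hu : StronglyMeasurable u) (y : X) :
    Measurable fun z => ballAvg m s (fun w => edist (u z) (u w)) y := by
  unfold ballAvg
  exact (hu.measurable_edist_prod.lintegral_prod_right').div_const _

variable [BorelSpace X]

theorem measurable_eksDensity [SecondCountableTopology X] [SFinite m] (hu : StronglyMeasurable u)
    (r : ℝ) : Measurable (eksDensity p m u r) :=
  (measurable_ballAvg_prod (F := fun x y => (edist (u x) (u y) / ENNReal.ofReal r) ^ p)
    ((hu.measurable_edist_prod.div_const _).pow_const p)).pow_const _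

theorem ballDist_triangle [SFinite m] (hm : IsDoublingBelow m D R) (hu : StronglyMeasurable u)
    (hs : 0 < s) (x y z : X) : ballDist m u s x z ≤ ballDist m u s x y + ballDist m u s y z := by
  set F : X → X → ℝ≥0∞ := fun z a => ballAvg m s (fun w => edist (u a) (u w)) z with hF
  have h1 : ∀ a b, F z a ≤ edist (u a) (u b) + F z b := fun a b => by
    rw [← ballAvg_const hm hs (edist (u a) (u b)) z]
    simp only [hF]
    rw [← ballAvg_add measurable_const]
    exact ballAvg_mono fun w _ => edist_triangle _ _ _
  have h2 : ∀ a, F z a ≤ F y a + ballDist m u s y z := fun a => by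
    rw [← ballAvg_const hm hs (F z a) y]
    simp only [hF, ballDist]
    rw [← ballAvg_add (hu.measurable_edist_left a)]
    exact ballAvg_mono fun b _ => h1 a b
  calc ballDist m u s x z ≤ ballAvg m s (fun a => F y a + ballDist m u s y z) x :=
        ballAvg_mono fun a _ => h2 a
    _ = _ := by
        rw [ballAvg_add (measurable_ballAvg_edist hu y), ballAvg_const hm hs]; rfl

/-- The averaged distance differs from the distance by mean distances from the values at the two
centres. -/
theorem edist_le_ballDist [SFinite m] (hm : IsDoublingBelow m D R) (hu : StronglyMeasurable u)
    (hs : 0 < s) (x y : X) :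
    edist (u x) (u y) ≤ ballAvg m s (fun z => edist (u x) (u z)) x +
      (ballDist m u s x y + ballAvg m s (fun z => edist (u y) (u z)) y) := by
  have h1 : ∀ a, edist (u a) (u y) ≤ ballAvg m s (fun w => edist (u a) (u w)) y +
      ballAvg m s (fun w => edist (u y) (u w)) y := fun a => by
    rw [← ballAvg_add (hu.measurable_edist_left a), ← ballAvg_const hm hs (edist (u a) (u y)) y]
    refine ballAvg_mono fun w _ => ?_
    rw [edist_comm (u y)]
    exact edist_triangle _ _ _
  calc edist (u x) (u y) = ballAvg m s (fun _ => edist (u x) (u y)) x :=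
        (ballAvg_const hm hs _ _).symm
    _ ≤ ballAvg m s (fun a => edist (u x) (u a) + (ballAvg m s (fun w => edist (u a) (u w)) y +
      ballAvg m s (fun w => edist (u y) (u w)) y)) x := ballAvg_mono fun a _ =>
        (edist_triangle _ (u a) _).trans (by gcongr; exact h1 a)
    _ = _ := by
        rw [ballAvg_add (hu.measurable_edist_left x), ballAvg_add (measurable_ballAvg_edist hu y),
          ballAvg_const hm hs]; rfl

/-- For nearby points the averaged distance is controlled by the average of the Korevaar-Schoen
density around any third nearby point. The power of `D` is `3 + 2`: the ball `B_{4s}(z)`, for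
`z ∈ B_s(x)`, is compared with `B_s(y)`, and then `B_{2s}(v)` with `B_s(x)`. -/
theorem ballDist_le [SecondCountableTopology X] [SFinite m] (hm : IsDoublingBelow m D R)
    (hp : 1 < p) (hu : StronglyMeasurable u)
    (hs : 0 < s) (hsR : 4 * s < R) {v x y : X} (hvx : dist v x ≤ s)
    (hxy : dist x y ≤ s) :
    ballDist m u s x y ≤
      D ^ 5 * ENNReal.ofReal (4 * s) * ballAvg m (2 * s) (eksDensity p m u (4 * s)) v := by
  have h1 : ∀ z ∈ Metric.ball x s, ballAvg m s (fun w => edist (u z) (u w)) y ≤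
      D ^ 3 * ENNReal.ofReal (4 * s) * eksDensity p m u (4 * s) z := fun z hz => by
    rw [Metric.mem_ball] at hz
    have hzy : dist z y ≤ 2 * s := by have := dist_triangle z x y; linarith
    refine le_trans (ballAvg_le_mul_ballAvg (v := z) (t := 4 * s) (hm.measure_ball_pos y hs)
      (hm.measure_ball_lt_top y s) (hm.measure_ball_pos z (by positivity))
      (hm.measure_ball_lt_top z _) ?_ (K := D ^ 3) ?_) ?_
    · exact Metric.ball_subset_ball' (by rw [dist_comm]; linarith)
    · refine le_trans (measure_mono ?_) (hm.measure_ball_pow_le hs y 3 (by linarith))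
      exact Metric.ball_subset_ball' (by linarith)
    · rw [mul_assoc]
      gcongr
      exact ballAvg_edist_le hm hp hu (by positivity) z
  calc ballDist m u s x y
      ≤ ballAvg m s (fun z => D ^ 3 * ENNReal.ofReal (4 * s) * eksDensity p m u (4 * s) z) x :=
        ballAvg_mono h1
    _ = D ^ 3 * ENNReal.ofReal (4 * s) * ballAvg m s (eksDensity p m u (4 * s)) x :=
        ballAvg_const_mul (measurable_eksDensity hu _) _ _
    _ ≤ D ^ 3 * ENNReal.ofReal (4 * s) *
        (D ^ 2 * ballAvg m (2 * s) (eksDensity p m u (4 * s)) v) := by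
        gcongr
        refine ballAvg_le_mul_ballAvg (hm.measure_ball_pos x hs)
          (hm.measure_ball_lt_top x s) (hm.measure_ball_pos v (by positivity))
          (hm.measure_ball_lt_top v _) ?_ ?_
        · exact Metric.ball_subset_ball' (by rw [dist_comm]; linarith)
        · refine le_trans (measure_mono ?_) (hm.measure_ball_pow_le hs x 2 (by linarith))
          exact Metric.ball_subset_ball' (by linarith)
    _ = _ := by ring

end BallDist

/-! ### Chaining along curves -/

section Chain

theorem continuous_lintegral_Ioc {f : I → ℝ≥0∞} (hf : Measurable f) (hfin : ∫⁻ r, f r ≠ ∞) :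
    Continuous fun t : I => ∫⁻ r in Set.Ioc 0 t, f r := by
  simp_rw [← lintegral_indicator measurableSet_Ioc]
  refine continuous_iff_continuousAt.2 fun t => ?_
  refine tendsto_lintegral_filter_of_dominated_convergence f
    (.of_forall fun t => hf.indicator measurableSet_Ioc)
    (.of_forall fun t => .of_forall fun r => Set.indicator_le_self _ _ _) hfin ?_
  have h : ∀ᵐ r : I, r ≠ t := by simp [ae_iff]
  filter_upwards [h] with r hr
  refine tendsto_const_nhds.congr' ?_
  rcases lt_or_gt_of_ne hr with h1 | h1
  · filter_upwards [Ioi_mem_nhds h1] with a ha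
    simp [Set.indicator, h1.le, (show r ≤ a from le_of_lt ha)]
  · filter_upwards [Iio_mem_nhds h1] with a ha
    simp [Set.indicator, h1.not_ge, (show ¬ r ≤ a from not_le.2 ha)]

/-- Chaining along a curve: a function `Δ` of two points that satisfies the triangle inequality and
has `Δ x y ≤ A * g v` whenever `v` and `y` are `s`-close to `x` is bounded by the integral of `g`
along the curve. The curve is cut into pieces of equal length, between `s / 2` and `s`, hence the factor
`2`; a curve shorter than `s` contributes the additional term at its starting point. -/
theorem chain_le {X : Type*} [MetricSpace X] {γ : C(I, X)} (hγ : IsACCurve γ)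
    (hfin : ∫⁻ r, localSpeed γ r ≠ ∞) {Δ : X → X → ℝ≥0∞} (htri : ∀ x y z, Δ x z ≤ Δ x y + Δ y z)
    {A : ℝ≥0∞} {g : X → ℝ≥0∞} {s : ℝ} (hs : 0 < s)
    (hg : ∀ v x y, dist v x ≤ s → dist x y ≤ s → Δ x y ≤ A * g v) :
    ENNReal.ofReal s * Δ (γ 0) (γ 1) ≤
      A * (ENNReal.ofReal s * g (γ 0)) + 2 * ∫⁻ r, A * g (γ r) * localSpeed γ r := by
  have hmeas := measurable_localSpeed_right γ
  have hdist : ∀ {a b : I} {c : ℝ}, a ≤ b → 0 ≤ c →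
      ∫⁻ r in Set.Ioc a b, localSpeed γ r ≤ ENNReal.ofReal c → dist (γ a) (γ b) ≤ c :=
    fun {a b c} hab hc h => by
      have := (hγ.edist_le hab).trans h
      rwa [edist_dist, ENNReal.ofReal_le_ofReal_iff hc] at this
  set L := ∫⁻ r, localSpeed γ r with hL
  have hLI : ∫⁻ r in Set.Ioc (0 : I) 1, localSpeed γ r = L := by
    have h : (Set.Ioc (0 : I) 1) =ᵐ[volume] Set.univ := by
      have : (Set.Icc (0 : I) 1) = Set.univ := by ext x; simp [unitInterval.le_one']
      rw [← this]; exact Ioc_ae_eq_Icc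
    rw [setLIntegral_congr h, setLIntegral_univ]
  rcases le_total L (ENNReal.ofReal s) with hLs | hLs
  · refine le_add_right ?_
    rw [mul_left_comm]
    gcongr
    exact hg _ _ _ (by simpa using hs.le) (hdist zero_le_one hs.le (hLI.trans_le hLs))
  refine le_add_left ?_
  lift L to ℝ≥0 using hfin with ℓ hℓ
  have hsℓ : s ≤ ℓ := by
    have := (ENNReal.ofReal_le_iff_le_toReal ENNReal.coe_ne_top).1 hLs
    simpa using this
  -- the number of pieces
  set N := ⌈(ℓ : ℝ) / s⌉₊ with hN
  have hℓ0 : (0 : ℝ) < ℓ := hs.trans_le hsℓ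
  have hN1 : (ℓ : ℝ) / s ≤ N := Nat.le_ceil _
  have hN2 : (N : ℝ) < ℓ / s + 1 := Nat.ceil_lt_add_one (by positivity)
  have hN0 : 0 < N := Nat.ceil_pos.2 (by positivity)
  have hN0' : (0 : ℝ) < N := by exact_mod_cast hN0
  have hone : 1 ≤ (ℓ : ℝ) / s := (one_le_div hs).2 hsℓ
  set δ : ℝ := ℓ / N with hδ
  have hδ0 : 0 < δ := by positivity
  have hδs : δ ≤ s := by
    rw [hδ, div_le_iff₀ hN0']; rw [div_le_iff₀ hs] at hN1; linarith
  have hsδ : s ≤ 2 * δ := by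
    rw [hδ, ← mul_div_assoc, le_div_iff₀ hN0']
    have : (N : ℝ) * s ≤ (ℓ / s + ℓ / s) * s := by gcongr; linarith
    rw [add_mul, div_mul_cancel₀ _ hs.ne'] at this
    linarith
  set J : I → I → ℝ≥0∞ := fun a b => ∫⁻ r in Set.Ioc a b, A * g (γ r) * localSpeed γ r with hJ
  have hpiece : ∀ a b : I, a ≤ b → ∫⁻ r in Set.Ioc a b, localSpeed γ r = ENNReal.ofReal δ →
      ENNReal.ofReal δ * Δ (γ a) (γ b) ≤ J a b := fun a b hab h => by
    rw [← h, mul_comm, ← lintegral_const_mul _ hmeas]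
    refine setLIntegral_mono' measurableSet_Ioc fun r hr => ?_
    gcongr
    refine hg _ _ _ ?_ (hdist hab hs.le (h.trans_le (ENNReal.ofReal_le_ofReal hδs)))
    rw [dist_comm]
    refine hdist hr.1.le hs.le (le_trans ?_ (h.trans_le (ENNReal.ofReal_le_ofReal hδs)))
    exact lintegral_mono_set (Set.Ioc_subset_Ioc_right hr.2)
  have hsplit : ∀ {a b : I} (f : I → ℝ≥0∞), a ≤ b → ∫⁻ r in Set.Ioc (0 : I) b, f r =
      (∫⁻ r in Set.Ioc (0 : I) a, f r) + ∫⁻ r in Set.Ioc a b, f r := fun {a b} f hab => by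
    have h0 : (0 : I) ≤ a := unitInterval.nonneg'
    rw [← Set.Ioc_union_Ioc_eq_Ioc h0 hab]
    exact lintegral_union measurableSet_Ioc (Set.Ioc_disjoint_Ioc_of_le (b := a) le_rfl)
  have hind : ∀ (n : ℕ) (t : I),
      ∫⁻ r in Set.Ioc 0 t, localSpeed γ r = ENNReal.ofReal ((n + 1) * δ) →
      ENNReal.ofReal δ * Δ (γ 0) (γ t) ≤ J 0 t := by
    intro n
    induction n with
    | zero => exact fun t ht => hpiece 0 t t.2.1 (by simpa using ht)
    | succ n ih =>
      intro t ht
      have hc : ENNReal.ofReal ((n + 1) * δ) ∈ Set.Icc (∫⁻ r in Set.Ioc (0 : I) 0, localSpeed γ r)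
          (∫⁻ r in Set.Ioc 0 t, localSpeed γ r) := by
        rw [ht]
        refine ⟨by simp, ENNReal.ofReal_le_ofReal ?_⟩
        push_cast
        gcongr
        linarith
      obtain ⟨t', ht', ht'eq⟩ := intermediate_value_Icc (show (0 : I) ≤ t from unitInterval.nonneg')
        (continuous_lintegral_Ioc hmeas (by rw [← hL]; exact ENNReal.coe_ne_top)).continuousOn hc
      dsimp only at ht'eq
      have hrest : ∫⁻ r in Set.Ioc t' t, localSpeed γ r = ENNReal.ofReal δ := by
        have h1 := hsplit (localSpeed γ) ht'.2
        rw [ht, ht'eq, show (((n + 1 : ℕ) : ℝ) + 1) * δ = (n + 1) * δ + δ by push_cast; ring,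
          ENNReal.ofReal_add (by positivity) hδ0.le] at h1
        exact ((ENNReal.add_right_inj ENNReal.ofReal_ne_top).1 h1).symm
      calc ENNReal.ofReal δ * Δ (γ 0) (γ t)
          ≤ ENNReal.ofReal δ * (Δ (γ 0) (γ t') + Δ (γ t') (γ t)) := by gcongr; exact htri _ _ _
        _ ≤ J 0 t' + J t' t := by
            rw [mul_add]; exact add_le_add (ih t' ht'eq) (hpiece t' t ht'.2 hrest)
        _ = J 0 t := (hsplit _ ht'.2).symm
  have hfinal := hind (N - 1) 1 (by
    rw [hLI, Nat.cast_sub hN0, Nat.cast_one, sub_add_cancel, hδ, mul_div_cancel₀ _ hN0'.ne',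
      ENNReal.ofReal_coe_nnreal])
  calc ENNReal.ofReal s * Δ (γ 0) (γ 1) ≤ ENNReal.ofReal (2 * δ) * Δ (γ 0) (γ 1) := by gcongr
    _ = 2 * (ENNReal.ofReal δ * Δ (γ 0) (γ 1)) := by
        rw [ENNReal.ofReal_mul zero_le_two, mul_assoc]; norm_num
    _ ≤ 2 * J 0 1 := by gcongr
    _ ≤ _ := by gcongr; exact setLIntegral_le_lintegral _ _

end Chain

/-! ### Variation of maps along test plans -/

section TestPlanEstimate

variable {X : Type*} [MetricSpace X] [MeasurableSpace X] [BorelSpace X] {m : Measure X} {p q : ℝ}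
  {π : Measure C(I, X)}

/-- The speed measure of a `q`-test plan has a density in `L^q`, as it acts boundedly on `L^p`. -/
theorem IsTestPlan.exists_density [SigmaFinite m] (hpq : p.HolderConjugate q)
    (hπ : IsTestPlan q m π) :
    ∃ ρ : X → ℝ, Measurable ρ ∧ (∀ x, 0 ≤ ρ x) ∧ MemLp ρ (ENNReal.ofReal q) m ∧
      ∀ h : X → ℝ≥0∞, AEMeasurable h m →
        ∫⁻ x, h x ∂(speedMeasure π) = ∫⁻ x, h x * ENNReal.ofReal (ρ x) ∂m := by
  have := hπ.isProbabilityMeasure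
  have hq0 : 0 < q := hpq.symm.pos
  have hq1 : 0 < q - 1 := by have := hpq.symm.lt; linarith
  set ρ := (speedMeasure π).rnDeriv m with hρ
  have hρm : Measurable ρ := Measure.measurable_rnDeriv _ _
  have hac := hπ.speedMeasure_ac
  have hden : m.withDensity ρ = speedMeasure π := Measure.withDensity_rnDeriv_eq _ _ hac
  have hint : ∀ h : X → ℝ≥0∞, AEMeasurable h m →
      ∫⁻ x, h x ∂(speedMeasure π) = ∫⁻ x, h x * ρ x ∂m := fun h hh => by
    rw [← hden, lintegral_withDensity_eq_lintegral_mul₀ hρm.aemeasurable hh]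
    simp only [Pi.mul_apply, mul_comm]
  obtain ⟨K, hK⟩ := hπ.exists_lintegral_speedMeasure_le hpq
  have hfin : ∫⁻ x, ρ x ^ q ∂m ≤ (K : ℝ≥0∞) ^ q := by
    refine lintegral_rpow_le_of_truncation hpq hρm (measurableSet_spanningSets m)
      (monotone_spanningSets m) (iUnion_spanningSets m) (measure_spanningSets_lt_top m) fun k => ?_
    have hS := measurableSet_spanningSets m k
    set S := spanningSets m k
    have hmin : Measurable fun x => min (ρ x) (k : ℝ≥0∞) := hρm.min measurable_const
    have hh : Measurable (S.indicator fun x => (min (ρ x) (k : ℝ≥0∞)) ^ (q - 1)) :=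
      (hmin.pow_const _).indicator hS
    have h1 := hK _ hh.aemeasurable
    rw [hint _ hh.aemeasurable] at h1
    refine (le_of_eq ?_).trans (h1.trans_eq ?_)
    · rw [← lintegral_indicator hS]
      congr 1; ext x
      by_cases hx : x ∈ S <;> simp [hx]
    · rw [← lintegral_indicator hS]
      congr 3; ext x
      by_cases hx : x ∈ S
      · simp only [Set.indicator_of_mem hx]
        rw [← ENNReal.rpow_mul, show (q - 1) * p = q from hpq.symm.sub_one_mul_conj]
      · simp [hx, hpq.pos]
  have hfin' : ∫⁻ x, ρ x ^ q ∂m < ∞ :=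
    hfin.trans_lt (ENNReal.rpow_lt_top_of_nonneg hq0.le ENNReal.coe_ne_top)
  have hlt : ∀ᵐ x ∂m, ρ x < ∞ := by
    filter_upwards [ae_lt_top (hρm.pow_const q) hfin'.ne] with x hx
    exact (ENNReal.rpow_lt_top_iff_of_pos hq0).1 hx
  have hofReal : ∀ᵐ x ∂m, ENNReal.ofReal (ρ x).toReal = ρ x := by
    filter_upwards [hlt] with x hx using ENNReal.ofReal_toReal hx.ne
  refine ⟨fun x => (ρ x).toReal, hρm.ennreal_toReal, fun x => ENNReal.toReal_nonneg,
    (memLp_ofReal_iff hq0).2 ⟨hρm.ennreal_toReal.aestronglyMeasurable, ?_⟩, fun h hh => ?_⟩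
  · refine lt_of_le_of_lt (lintegral_mono_ae ?_) hfin'
    filter_upwards [hofReal] with x hx
    rw [Real.enorm_of_nonneg ENNReal.toReal_nonneg, hx]
  · rw [hint h hh]
    refine lintegral_congr_ae ?_
    filter_upwards [hofReal] with x hx
    rw [hx]

/-- The time marginals of a test plan act boundedly on `L^p`. -/
theorem IsTestPlan.exists_lintegral_eval_le_rpow (hp : 1 < p) (hπ : IsTestPlan q m π) :
    ∃ c : ℝ≥0, ∀ h : X → ℝ≥0∞, Measurable h → ∀ t : I,
      ∫⁻ γ, h (γ t) ∂π ≤ c * (∫⁻ x, h x ^ p ∂m) ^ (1 / p) := by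
  have := hπ.isProbabilityMeasure
  obtain ⟨C, hC⟩ := hπ.exists_lintegral_eval_le
  have hp0 : 0 ≤ 1 / p := by positivity
  refine ⟨C ^ (1 / p), fun h hh t => ?_⟩
  have h1 := ENNReal.lintegral_mul_le_Lp_mul_Lq π (Real.HolderConjugate.conjExponent hp)
    (hh.comp (measurable_eval t)).aemeasurable (measurable_const (a := (1 : ℝ≥0∞))).aemeasurable
  simp only [Pi.mul_apply, mul_one, ENNReal.one_rpow, lintegral_const, measure_univ,
    Function.comp_apply] at h1
  refine h1.trans ?_
  rw [ENNReal.coe_rpow_of_nonneg _ hp0, ← ENNReal.mul_rpow_of_nonneg _ _ hp0]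
  gcongr
  exact hC (fun x => h x ^ p) (hh.pow_const p).aemeasurable t

variable {Y : Type*} [MetricSpace Y] {D : ℝ≥0∞} {R s : ℝ} {u : X → Y}
  [SecondCountableTopology X]

/-- The chain estimate for `u` along one curve. -/
theorem edist_le_of_isACCurve [SFinite m] (hm : IsDoublingBelow m D R) (hp : 1 < p)
    (hu : StronglyMeasurable u) (hs : 0 < s) (hsR : 4 * s < R) {γ : C(I, X)} (hγ : IsACCurve γ)
    (hfin : ∫⁻ r, localSpeed γ r ≠ ∞) :
    edist (u (γ 0)) (u (γ 1)) ≤ ENNReal.ofReal (4 * s) *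
      (D ^ 2 * eksDensity p m u (4 * s) (γ 0) + D ^ 2 * eksDensity p m u (4 * s) (γ 1) +
        D ^ 5 * ballAvg m (2 * s) (eksDensity p m u (4 * s)) (γ 0)) +
      8 * D ^ 5 * ∫⁻ r, ballAvg m (2 * s) (eksDensity p m u (4 * s)) (γ r) * localSpeed γ r := by
  set k := eksDensity p m u (4 * s)
  set g := ballAvg m (2 * s) k with hg
  have hgm : Measurable g := measurable_ballAvg (measurable_eksDensity hu _)
  have hgI : Measurable fun r : I => g (γ r) * localSpeed γ r :=
    (hgm.comp γ.continuous.measurable).mul (measurable_localSpeed_right γ)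
  have h4 : ENNReal.ofReal (4 * s) = 4 * ENNReal.ofReal s := by
    rw [ENNReal.ofReal_mul (by norm_num)]; norm_num
  have hs0 : ENNReal.ofReal s ≠ 0 := by simpa using hs
  have hΔ : ballDist m u s (γ 0) (γ 1) ≤ D ^ 5 * ENNReal.ofReal (4 * s) * g (γ 0) +
      8 * D ^ 5 * ∫⁻ r, g (γ r) * localSpeed γ r := by
    have h := chain_le hγ hfin (ballDist_triangle hm hu hs) hs
      (fun v x y h1 h2 => ballDist_le hm hp hu hs hsR h1 h2)
    simp_rw [mul_assoc _ (ballAvg m (2 * s) _ _) (localSpeed _ _)] at h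
    rw [lintegral_const_mul _ hgI] at h
    refine (ENNReal.mul_le_mul_iff_right hs0 ENNReal.ofReal_ne_top).1 (h.trans_eq ?_)
    rw [h4]
    ring
  refine (edist_le_ballDist hm hu hs (γ 0) (γ 1)).trans ?_
  calc _ ≤ D ^ 2 * (ENNReal.ofReal (4 * s) * k (γ 0)) + ((D ^ 5 * ENNReal.ofReal (4 * s) * g (γ 0) +
        8 * D ^ 5 * ∫⁻ r, g (γ r) * localSpeed γ r) +
        D ^ 2 * (ENNReal.ofReal (4 * s) * k (γ 1))) := by
        gcongr
        · exact ballAvg_edist_le_four hm hp hu hs hsR _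
        · exact ballAvg_edist_le_four hm hp hu hs hsR _
    _ = _ := by ring

/-- The chain estimate integrated over a test plan. -/
theorem IsTestPlan.exists_lintegral_edist_le [SFinite m] (hm : IsDoublingBelow m D R) (hD : D ≠ ∞)
    (hp : 1 < p) (hu : StronglyMeasurable u) (hq : 1 < q) (hπ : IsTestPlan q m π) :
    ∃ B : ℝ≥0∞, B ≠ ∞ ∧ ∀ s, 0 < s → 4 * s < R →
      ∫⁻ γ, edist (u (γ 0)) (u (γ 1)) ∂π ≤ ENNReal.ofReal (4 * s) *
        (B * (∫⁻ x, eksDensity p m u (4 * s) x ^ p ∂m) ^ (1 / p)) +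
      8 * D ^ 5 * ∫⁻ x, ballAvg m (2 * s) (eksDensity p m u (4 * s)) x ∂(speedMeasure π) := by
  have := hπ.isProbabilityMeasure
  have hp0 : 0 ≤ 1 / p := by positivity
  obtain ⟨c, hc⟩ := hπ.exists_lintegral_eval_le_rpow hp
  refine ⟨D ^ 2 * c + D ^ 2 * c + D ^ 5 * (c * D ^ (1 / p)), ?_, fun s hs hsR => ?_⟩
  · have h2 : D ^ 2 * (c : ℝ≥0∞) ≠ ∞ :=
      ENNReal.mul_ne_top (ENNReal.pow_ne_top hD) ENNReal.coe_ne_top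
    exact ENNReal.add_ne_top.2 ⟨ENNReal.add_ne_top.2 ⟨h2, h2⟩,
      ENNReal.mul_ne_top (ENNReal.pow_ne_top hD) (ENNReal.mul_ne_top ENNReal.coe_ne_top
        (ENNReal.rpow_ne_top_of_nonneg hp0 hD))⟩
  set k := eksDensity p m u (4 * s)
  have hkm : Measurable k := measurable_eksDensity hu _
  set g := ballAvg m (2 * s) k with hg
  have hgm : Measurable g := measurable_ballAvg hkm
  set N := (∫⁻ x, k x ^ p ∂m) ^ (1 / p)
  have hgN : (∫⁻ x, g x ^ p ∂m) ^ (1 / p) ≤ D ^ (1 / p) * N := by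
    rw [← ENNReal.mul_rpow_of_nonneg _ _ hp0]
    gcongr
    exact lintegral_ballAvg_rpow_le hm (by positivity) (by linarith) hp hkm
  have hk0 : Measurable fun γ : C(I, X) => k (γ 0) := hkm.comp (measurable_eval 0)
  have hk1 : Measurable fun γ : C(I, X) => k (γ 1) := hkm.comp (measurable_eval 1)
  have hg0 : Measurable fun γ : C(I, X) => g (γ 0) := hgm.comp (measurable_eval 0)
  have hgI : Measurable fun γ : C(I, X) => ∫⁻ r, g (γ r) * localSpeed γ r :=
    ((hgm.comp measurable_eval_prod).mul measurable_localSpeed).lintegral_prod_right'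
  calc ∫⁻ γ, edist (u (γ 0)) (u (γ 1)) ∂π
      ≤ ∫⁻ γ, (ENNReal.ofReal (4 * s) * (D ^ 2 * k (γ 0) + D ^ 2 * k (γ 1) + D ^ 5 * g (γ 0)) +
          8 * D ^ 5 * ∫⁻ r, g (γ r) * localSpeed γ r) ∂π := by
        refine lintegral_mono_ae ?_
        filter_upwards [hπ.ae_isACCurve hq] with γ hγ
        exact edist_le_of_isACCurve hm hp hu hs hsR hγ.1 (lintegral_localSpeed_lt_top hq hγ.2).ne
    _ = ENNReal.ofReal (4 * s) * (D ^ 2 * ∫⁻ γ, k (γ 0) ∂π + D ^ 2 * ∫⁻ γ, k (γ 1) ∂π +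
          D ^ 5 * ∫⁻ γ, g (γ 0) ∂π) + 8 * D ^ 5 * ∫⁻ x, g x ∂(speedMeasure π) := by
        have hsum : Measurable fun γ : C(I, X) =>
            D ^ 2 * k (γ 0) + D ^ 2 * k (γ 1) + D ^ 5 * g (γ 0) :=
          ((hk0.const_mul _).add (hk1.const_mul _)).add (hg0.const_mul _)
        rw [lintegral_add_right _ (hgI.const_mul _), lintegral_const_mul _ hgI,
          lintegral_const_mul _ hsum,
          lintegral_add_right _ (hg0.const_mul _), lintegral_add_right _ (hk1.const_mul _),
          lintegral_const_mul _ hk0, lintegral_const_mul _ hk1, lintegral_const_mul _ hg0,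
          lintegral_speedMeasure_of_measurable hgm]
    _ ≤ ENNReal.ofReal (4 * s) * (D ^ 2 * (c * N) + D ^ 2 * (c * N) +
          D ^ 5 * (c * (D ^ (1 / p) * N))) + 8 * D ^ 5 * ∫⁻ x, g x ∂(speedMeasure π) := by
        gcongr
        · exact hc k hkm 0
        · exact hc k hkm 1
        · exact (hc g hgm 0).trans (by gcongr)
    _ = _ := by ring

/-- Weak limits of the Korevaar-Schoen densities control the variation of `u` along test plans. -/
theorem IsTestPlan.lintegral_edist_le_of_tendstoWeakLp [SigmaFinite m] [m.WeaklyRegular]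
    (hm : IsDoublingBelow m D R) (hR : 0 < R) (hD : D ≠ ∞) {hp : 1 < p} (hu : StronglyMeasurable u)
    (hπ : IsTestPlan p.conjExponent m π) {ε : ℕ → ℝ} (hε : ∀ n, 0 < ε n)
    (hε0 : Tendsto ε atTop (𝓝 0)) {f : ℕ → X → ℝ} {G : X → ℝ} (hf0 : ∀ n x, 0 ≤ f n x)
    (hf : ∀ n, ∀ᵐ x ∂m, ENNReal.ofReal (f n x) = eksDensity p m u (ε n) x)
    (h : TendstoWeakLp hp m f G) :
    ∫⁻ γ, edist (u (γ 0)) (u (γ 1)) ∂π ≤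
      8 * D ^ 6 * ∫⁻ x, ENNReal.ofReal (G x) ∂(speedMeasure π) := by
  have hpq := Real.HolderConjugate.conjExponent hp
  set q := p.conjExponent
  have hq := hpq.symm.lt
  have hp0 := hpq.pos
  have : (ENNReal.ofReal p).HolderConjugate (ENNReal.ofReal q) := hpq.ennrealOfReal
  obtain ⟨B, hB, hBs⟩ := hπ.exists_lintegral_edist_le hm hD hp hu hq
  obtain ⟨ρ, hρm, hρ0, hρ, hρint⟩ := hπ.exists_density hpq
  obtain ⟨K, hK⟩ := h.exists_eLpNorm_le
  have hG0 := h.ae_nonneg hf0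
  have hfm : ∀ n, MemLp (f n) (ENNReal.ofReal p) m := h.choose
  have hGm : MemLp G (ENNReal.ofReal p) m := h.choose_spec.choose
  have hKk : ∀ n, (∫⁻ x, eksDensity p m u (ε n) x ^ p ∂m) ^ (1 / p) ≤ K := fun n => by
    have h1 := hK n
    rw [eLpNorm_ofReal_eq hp0] at h1
    convert h1 using 2
    refine lintegral_congr_ae ?_
    filter_upwards [hf n] with x hx
    rw [← hx, Real.enorm_of_nonneg (hf0 n x)]
  have hofReal : ∀ g : X → ℝ, MemLp g (ENNReal.ofReal p) m → 0 ≤ᵐ[m] g →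
      ∫⁻ x, ENNReal.ofReal (g x) * ENNReal.ofReal (ρ x) ∂m =
        ENNReal.ofReal (∫ x, g x * ρ x ∂m) := fun g hg hg0 => by
    have hint : Integrable (fun x => g x * ρ x) m := hg.integrable_mul hρ
    rw [ofReal_integral_eq_lintegral_ofReal hint]
    · refine lintegral_congr_ae ?_
      filter_upwards [hg0] with x hx
      rw [ENNReal.ofReal_mul hx]
    · filter_upwards [hg0] with x hx using mul_nonneg hx (hρ0 x)
  set osc : ℕ → ℝ≥0∞ := fun n => (∫⁻ x, meanOsc m (ε n / 2) ρ x ^ q ∂m) ^ (1 / q) with hosc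
  have hosc0 : Tendsto osc atTop (𝓝 0) := by
    have h1 : Tendsto (fun n => ε n / 2) atTop (𝓝[>] 0) := by
      refine tendsto_nhdsWithin_iff.2 ⟨by simpa using hε0.div_const 2, .of_forall fun n => ?_⟩
      exact half_pos (hε n)
    have h2 := (ENNReal.continuous_rpow_const (y := 1 / q)).tendsto 0 |>.comp
      ((tendsto_lintegral_meanOsc hm hR hD hq hρm hρ).comp h1)
    rwa [ENNReal.zero_rpow_of_pos (show 0 < 1 / q by have := hpq.symm.pos; positivity)] at h2
  have hbound : ∀ n, ε n < R → ∫⁻ γ, edist (u (γ 0)) (u (γ 1)) ∂π ≤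
      ENNReal.ofReal (ε n) * (B * K) +
        8 * D ^ 5 * (D * (ENNReal.ofReal (∫ x, f n x * ρ x ∂m) + K * osc n)) := fun n hn => by
    have h1 := hBs (ε n / 4) (by have := hε n; positivity) (by linarith)
    rw [show 4 * (ε n / 4) = ε n by ring, show 2 * (ε n / 4) = ε n / 2 by ring] at h1
    have hkm : Measurable (eksDensity p m u (ε n)) := measurable_eksDensity hu _
    have hε2 : 0 < ε n / 2 := half_pos (hε n)
    refine h1.trans ?_
    gcongr
    · exact hKk n
    -- move the average from the energy density to `ρ`, then replace it by `ρ` itself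
    rw [hρint _ (measurable_ballAvg hkm).aemeasurable]
    refine (lintegral_ballAvg_mul_le hm hε2 (by have := hε n; linarith) hkm
      hρm.ennreal_ofReal).trans ?_
    gcongr
    calc ∫⁻ x, eksDensity p m u (ε n) x * ballAvg m (ε n / 2) (fun y => ENNReal.ofReal (ρ y)) x ∂m
        ≤ ∫⁻ x, (ENNReal.ofReal (f n x) * ENNReal.ofReal (ρ x) +
            eksDensity p m u (ε n) x * meanOsc m (ε n / 2) ρ x) ∂m := by
          refine lintegral_mono_ae ?_
          filter_upwards [hf n] with x hx
          rw [hx, ← mul_add]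
          gcongr
          unfold meanOsc
          rw [← ballAvg_const hm hε2 (ENNReal.ofReal (ρ x)) x, ← ballAvg_add measurable_const]
          refine ballAvg_mono fun y _ => ?_
          rw [← Real.enorm_of_nonneg (hρ0 y), ← Real.enorm_of_nonneg (hρ0 x)]
          calc ‖ρ y‖ₑ = ‖ρ x + (ρ y - ρ x)‖ₑ := by congr 1; ring
            _ ≤ _ := enorm_add_le _ _
      _ = ENNReal.ofReal (∫ x, f n x * ρ x ∂m) +
            ∫⁻ x, eksDensity p m u (ε n) x * meanOsc m (ε n / 2) ρ x ∂m := by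
          have hko : Measurable fun x => eksDensity p m u (ε n) x * meanOsc m (ε n / 2) ρ x :=
            hkm.mul (measurable_meanOsc hρm)
          rw [lintegral_add_right _ hko, hofReal _ (hfm n) (.of_forall (hf0 n))]
      _ ≤ _ := by
          gcongr
          refine (ENNReal.lintegral_mul_le_Lp_mul_Lq m hpq hkm.aemeasurable
            (measurable_meanOsc hρm).aemeasurable).trans ?_
          gcongr
          exact hKk n
  rw [hρint _ hGm.1.aemeasurable.ennreal_ofReal, hofReal G hGm hG0]
  have hD5 : 8 * D ^ 5 ≠ ∞ := ENNReal.mul_ne_top (by norm_num) (ENNReal.pow_ne_top hD)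
  have hlim : Tendsto (fun n => ENNReal.ofReal (ε n) * (B * K) +
        8 * D ^ 5 * (D * (ENNReal.ofReal (∫ x, f n x * ρ x ∂m) + K * osc n))) atTop
      (𝓝 (ENNReal.ofReal 0 * (B * K) +
        8 * D ^ 5 * (D * (ENNReal.ofReal (∫ x, G x * ρ x ∂m) + K * 0)))) := by
    refine Tendsto.add (ENNReal.Tendsto.mul_const (ENNReal.tendsto_ofReal hε0)
      (.inr (ENNReal.mul_ne_top hB ENNReal.coe_ne_top))) (ENNReal.Tendsto.const_mul
      (ENNReal.Tendsto.const_mul (Tendsto.add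
        (ENNReal.tendsto_ofReal (h.tendsto_integral_mul hpq hρ))
        (ENNReal.Tendsto.const_mul hosc0 (.inr ENNReal.coe_ne_top))) (.inr hD)) (.inr hD5))
  refine (ge_of_tendsto hlim ?_).trans_eq ?_
  · filter_upwards [hε0.eventually_lt_const hR] with n hn using hbound n hn
  · simp only [ENNReal.ofReal_zero, zero_mul, mul_zero, zero_add, add_zero]
    ring

end TestPlanEstimate

/-! ### Korevaar-Schoen maps -/

section KorevaarSchoen

variable {X : Type*} [MetricSpace X] [MeasurableSpace X] {m : Measure X}

/-- Doubling holds at all scales, with constants that depend on the scale, so a null ball would make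
the whole space a null set. -/
theorem IsUniformlyLocallyDoubling.measure_ball_ne_zero {Doub : ℝ → ℝ}
    (h : IsUniformlyLocallyDoubling m Doub) (hm : m ≠ 0) (x : X) {r : ℝ} (hr : 0 < r) :
    m (Metric.ball x r) ≠ 0 := by
  intro h0
  have h1 : ∀ n : ℕ, m (Metric.ball x (2 ^ n * r)) = 0 := by
    intro n
    induction n with
    | zero => simpa using h0
    | succ n ih =>
      have hn : 0 < 2 ^ n * r := by positivity
      have h2 := (h (2 ^ n * r + 1) (by positivity)).2 x (2 ^ n * r) hn (by linarith)
      rw [ih, mul_zero, nonpos_iff_eq_zero] at h2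
      rw [pow_succ, mul_comm _ (2 : ℝ), mul_assoc]
      exact h2
  refine hm (Measure.measure_univ_eq_zero.1 ?_)
  have h2 : (Set.univ : Set X) = ⋃ n : ℕ, Metric.ball x (2 ^ n * r) := by
    refine (Set.eq_univ_of_forall fun y => ?_).symm
    obtain ⟨n, hn⟩ := pow_unbounded_of_one_lt (dist y x / r) (one_lt_two (α := ℝ))
    exact Set.mem_iUnion.2 ⟨n, (div_lt_iff₀ hr).1 hn⟩
  rw [h2]
  exact measure_iUnion_null h1

/-- At sufficiently small scales the doubling inequality holds with any constant larger than the
infimum of the doubling constants. The absolute value only serves to make the constant positive as a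
function of an arbitrary real number. -/
theorem IsUniformlyLocallyDoubling.isDoublingBelow {Doub : ℝ → ℝ}
    (h : IsUniformlyLocallyDoubling m Doub) (hm : m ≠ 0)
    (hfin : ∀ s : Set X, Bornology.IsBounded s → m s < ∞) :
    ∃ R, 0 < R ∧
      IsDoublingBelow m (ENNReal.ofReal (|⨅ R : Set.Ioi (0 : ℝ), Doub R| + 1)) R := by
  obtain ⟨⟨R, hR⟩, hRlt⟩ := exists_lt_of_ciInf_lt
    (show (⨅ R : Set.Ioi (0 : ℝ), Doub R) < |⨅ R : Set.Ioi (0 : ℝ), Doub R| + 1 by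
      have := le_abs_self (⨅ R : Set.Ioi (0 : ℝ), Doub R); linarith)
  refine ⟨R, hR, fun x r hr => h.measure_ball_ne_zero hm x hr,
    fun x r => (hfin _ Metric.isBounded_ball).ne, fun x r hr hrR => ?_⟩
  refine ((h R hR).2 x r hr hrR).trans ?_
  gcongr

variable {Y : Type*} [MetricSpace Y] {D : ℝ≥0∞} {R p : ℝ} {u : X → Y} {ybar : Y}

theorem eksDensity_eq {r : ℝ} (hr : 0 < r) (hp : 0 < p) (x : X) :
    eksDensity p m u r x = (ballAvg m r (fun y => ENNReal.ofReal
      (dist (u x) (u y) ^ p / r ^ p)) x) ^ (1 / p) := by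
  unfold eksDensity
  congr 3; ext y
  rw [edist_dist, ENNReal.div_rpow_of_nonneg _ _ hp.le, ENNReal.ofReal_div_of_pos (by positivity),
    ENNReal.ofReal_rpow_of_nonneg dist_nonneg hp.le, ENNReal.ofReal_rpow_of_pos hr]

theorem lintegral_ball_edist_rpow_lt_top (hm : IsDoublingBelow m D R) (hp : 1 ≤ p)
    (hu : MemLpPointed p m ybar u) (x : X) (r : ℝ) :
    ∫⁻ y in Metric.ball x r, edist (u x) (u y) ^ p ∂m < ∞ := by
  have hp0 : 0 ≤ p := zero_le_one.trans hp
  calc ∫⁻ y in Metric.ball x r, edist (u x) (u y) ^ p ∂m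
      ≤ ∫⁻ y in Metric.ball x r,
          2 ^ (p - 1) * (edist (u x) ybar ^ p + edist (u y) ybar ^ p) ∂m := by
        refine lintegral_mono fun y => ?_
        dsimp only
        refine le_trans ?_ (ENNReal.rpow_add_le_mul_rpow_add_rpow _ _ hp)
        gcongr
        exact edist_triangle_right _ _ _
    _ = 2 ^ (p - 1) * (edist (u x) ybar ^ p * m (Metric.ball x r) +
          ∫⁻ y in Metric.ball x r, edist (u y) ybar ^ p ∂m) := by
        rw [lintegral_const_mul' _ _ (ENNReal.rpow_ne_top_of_nonneg (by linarith) (by norm_num)),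
          lintegral_add_left measurable_const, setLIntegral_const]
    _ < ∞ := by
        refine ENNReal.mul_lt_top (ENNReal.rpow_lt_top_of_nonneg (by linarith) (by norm_num))
          (ENNReal.add_lt_top.2 ⟨ENNReal.mul_lt_top
            (ENNReal.rpow_lt_top_of_nonneg hp0 (edist_ne_top _ _))
            (hm.measure_ball_lt_top x r).lt_top, (setLIntegral_le_lintegral _ _).trans_lt hu.2⟩)

/-- The real-valued density agrees with the `[0,∞]`-valued one; the integrals are finite since
`u ∈ L^p`. -/
theorem ofReal_ksDensity (hm : IsDoublingBelow m D R) (hp : 1 ≤ p) (hu : MemLpPointed p m ybar u)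
    {r : ℝ} (hr : 0 < r) (x : X) :
    ENNReal.ofReal (ksDensity p m u r x) = eksDensity p m u r x := by
  have hp0 : 0 < p := zero_lt_one.trans_le hp
  have hF0 : ∀ y, 0 ≤ dist (u x) (u y) ^ p / r ^ p := fun y => by positivity
  have hFm : AEStronglyMeasurable (fun y => dist (u x) (u y) ^ p / r ^ p) m :=
    ((((aestronglyMeasurable_const (b := u x)).dist hu.1).aemeasurable.pow_const p).div_const
      _).aestronglyMeasurable
  have hfin : ∫⁻ y in Metric.ball x r, ENNReal.ofReal (dist (u x) (u y) ^ p / r ^ p) ∂m ≠ ∞ := by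
    have h1 : ∀ y, ENNReal.ofReal (dist (u x) (u y) ^ p / r ^ p) =
        (ENNReal.ofReal (r ^ p))⁻¹ * edist (u x) (u y) ^ p := fun y => by
      rw [ENNReal.ofReal_div_of_pos (by positivity), mul_comm, edist_dist,
        ENNReal.ofReal_rpow_of_nonneg dist_nonneg hp0.le, div_eq_mul_inv]
    have h2 : (ENNReal.ofReal (r ^ p))⁻¹ ≠ ∞ :=
      ENNReal.inv_ne_top.2 (by simpa using Real.rpow_pos_of_pos hr p)
    simp_rw [h1]
    rw [lintegral_const_mul' _ _ h2]
    exact ENNReal.mul_ne_top h2 (lintegral_ball_edist_rpow_lt_top hm hp hu x r).ne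
  have hb := hm.measure_ball_pos x hr
  have hb' := hm.measure_ball_lt_top x r
  have havg0 : 0 ≤ ⨍ y in Metric.ball x r, dist (u x) (u y) ^ p / r ^ p ∂m := integral_nonneg hF0
  rw [eksDensity_eq hr hp0, ksDensity, ← ENNReal.ofReal_rpow_of_nonneg havg0 (by positivity)]
  congr 1
  rw [setAverage_eq, integral_eq_lintegral_of_nonneg_ae (.of_forall hF0) hFm.restrict, ballAvg,
    smul_eq_mul, ENNReal.ofReal_mul (by positivity), ENNReal.ofReal_toReal hfin, div_eq_mul_inv,
    mul_comm, ← ENNReal.ofReal_toReal (ENNReal.inv_ne_top.2 hb), ENNReal.toReal_inv]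
  rfl

theorem eksDensity_congr_ae {v : X → Y} (h : u =ᵐ[m] v) (r : ℝ) :
    ∀ᵐ x ∂m, eksDensity p m u r x = eksDensity p m v r x := by
  filter_upwards [h] with x hx
  unfold eksDensity
  rw [hx]
  congr 1
  refine ballAvg_congr_ae ?_
  filter_upwards [h] with y hy
  rw [hy]

theorem ksDensity_nonneg {r : ℝ} (hr : 0 < r) (x : X) : 0 ≤ ksDensity p m u r x :=
  Real.rpow_nonneg (integral_nonneg fun y => by positivity) _

variable [BorelSpace X] [SecondCountableTopology X]

theorem memLp_ksDensity [SFinite m] (hm : IsDoublingBelow m D R) (hp : 1 ≤ p)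
    (hu : MemLpPointed p m ybar u) {r : ℝ} (hr : 0 < r)
    (h : ∫⁻ x, ENNReal.ofReal (ksDensity p m u r x ^ p) ∂m < ∞) :
    MemLp (ksDensity p m u r) (ENNReal.ofReal p) m := by
  have hp0 : 0 < p := zero_lt_one.trans_le hp
  refine (memLp_ofReal_iff hp0).2 ⟨AEMeasurable.aestronglyMeasurable
    ⟨fun x => (eksDensity p m (hu.1.mk u) r x).toReal,
      (measurable_eksDensity hu.1.stronglyMeasurable_mk r).ennreal_toReal, ?_⟩, ?_⟩
  · filter_upwards [eksDensity_congr_ae (p := p) hu.1.ae_eq_mk r] with x hx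
    rw [← hx, ← ofReal_ksDensity hm hp hu hr, ENNReal.toReal_ofReal (ksDensity_nonneg hr x)]
  · refine lt_of_eq_of_lt (lintegral_congr fun x => ?_) h
    have h0 := ksDensity_nonneg (p := p) (m := m) (u := u) hr x
    rw [Real.enorm_of_nonneg h0, ENNReal.ofReal_rpow_of_nonneg h0 hp0.le]

/-- Along some sequence of scales the Korevaar-Schoen densities converge weakly. -/
theorem MemKorevaarSchoen.exists_tendstoWeakLp [SigmaFinite m] [IsSeparable m]
    (hm : IsDoublingBelow m D R) (hp : 1 < p) (hu : MemKorevaarSchoen p m ybar u) :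
    ∃ (ε : ℕ → ℝ) (G : X → ℝ), (∀ n, 0 < ε n) ∧ Tendsto ε atTop (𝓝 0) ∧
      TendstoWeakLp hp m (fun n => ksDensity p m u (ε n)) G := by
  have hp0 : 0 < p := zero_lt_one.trans hp
  obtain ⟨M, hM, hMt⟩ := exists_between hu.2
  have hfreq := frequently_lt_of_liminf_lt (by isBoundedDefault) hM
  obtain ⟨ε, hε0, hε⟩ := exists_seq_forall_of_frequently
    (hfreq.and_eventually self_mem_nhdsWithin)
  have hpos : ∀ n, 0 < ε n := fun n => (hε n).2
  have hmem : ∀ n, MemLp (ksDensity p m u (ε n)) (ENNReal.ofReal p) m := fun n =>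
    memLp_ksDensity hm hp.le hu.1 (hpos n) ((hε n).1.trans hMt)
  have hKt : M ^ (1 / p) ≠ ∞ := ENNReal.rpow_ne_top_of_nonneg (by positivity) hMt.ne
  have hK : ∀ n, eLpNorm (ksDensity p m u (ε n)) (ENNReal.ofReal p) m ≤ (M ^ (1 / p)).toNNReal :=
    fun n => by
      rw [ENNReal.coe_toNNReal hKt, eLpNorm_ofReal_eq hp0]
      gcongr
      refine le_trans (le_of_eq (lintegral_congr fun x => ?_)) (hε n).1.le
      have h0 := ksDensity_nonneg (p := p) (m := m) (u := u) (hpos n) x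
      rw [Real.enorm_of_nonneg h0, ENNReal.ofReal_rpow_of_nonneg h0 hp0.le]
  obtain ⟨φ, G, hφ, hG⟩ := exists_subseq_tendstoWeakLp hp hmem hK
  exact ⟨ε ∘ φ, G, fun n => hpos _,
    (hε0.mono_right nhdsWithin_le_nhds).comp hφ.tendsto_atTop, hG⟩

/-- A multiple of each weak limit of the Korevaar-Schoen densities is a weak upper gradient. -/
theorem isMetricWeakUpperGradient_of_tendstoWeakLp [SigmaFinite m] [m.WeaklyRegular] {d : ℝ}
    (hd : 0 ≤ d) (hm : IsDoublingBelow m (ENNReal.ofReal d) R) (hR : 0 < R) {hp : 1 < p}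
    (hu : MemLpPointed p m ybar u) {ε : ℕ → ℝ} {G : X → ℝ} (hε : ∀ n, 0 < ε n)
    (hε0 : Tendsto ε atTop (𝓝 0))
    (h : TendstoWeakLp hp m (fun n => ksDensity p m u (ε n)) G) :
    IsMetricWeakUpperGradient p m u (fun x => 8 * d ^ 6 * G x) := by
  have hf0 : ∀ n x, 0 ≤ ksDensity p m u (ε n) x := fun n x => ksDensity_nonneg (hε n) x
  have hG : MemLp (fun x => 8 * d ^ 6 * G x) (ENNReal.ofReal p) m :=
    h.choose_spec.choose.const_mul _
  have hG0 : 0 ≤ᵐ[m] fun x => 8 * d ^ 6 * G x := by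
    filter_upwards [h.ae_nonneg hf0] with x hx
    have : 0 ≤ G x := hx
    show 0 ≤ 8 * d ^ 6 * G x
    positivity
  refine ⟨hG, hG0, fun φ hφ => ?_⟩
  have hW : IsWeakUpperGradient p m (φ ∘ u) (fun x => 8 * d ^ 6 * G x) := by
    refine isWeakUpperGradient_of_lintegral_le hp
      (hφ.continuous.comp_aestronglyMeasurable hu.1).aemeasurable hG hG0 fun π hπ => ?_
    set v := hu.1.mk u with hv
    have huv : u =ᵐ[m] v := hu.1.ae_eq_mk
    calc ∫⁻ γ, ENNReal.ofReal |(φ ∘ u) (γ 1) - (φ ∘ u) (γ 0)| ∂π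
        ≤ ∫⁻ γ, edist (v (γ 0)) (v (γ 1)) ∂π := by
          refine lintegral_mono_ae ?_
          filter_upwards [hπ.ae_eval huv 0, hπ.ae_eval huv 1] with γ h0 h1
          rw [← h0, ← h1, ← Real.dist_eq, ← edist_dist, edist_comm (u (γ 0))]
          simpa using hφ (u (γ 1)) (u (γ 0))
      _ ≤ 8 * ENNReal.ofReal d ^ 6 * ∫⁻ x, ENNReal.ofReal (G x) ∂(speedMeasure π) := by
          refine hπ.lintegral_edist_le_of_tendstoWeakLp hm hR ENNReal.ofReal_ne_top
            hu.1.stronglyMeasurable_mk hε hε0 hf0 (fun n => ?_) h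
          filter_upwards [eksDensity_congr_ae (p := p) huv (ε n)] with x hx
          rw [ofReal_ksDensity hm hp.le hu (hε n), hx]
      _ = ∫⁻ x, ENNReal.ofReal (8 * d ^ 6 * G x) ∂(speedMeasure π) := by
          have h8 : ENNReal.ofReal (8 * d ^ 6) = 8 * ENNReal.ofReal d ^ 6 := by
            rw [ENNReal.ofReal_mul (by norm_num), ENNReal.ofReal_pow hd]; norm_num
          simp_rw [ENNReal.ofReal_mul (show 0 ≤ 8 * d ^ 6 by positivity)]
          rw [lintegral_const_mul' _ _ ENNReal.ofReal_ne_top, h8]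
  obtain ⟨g, hg⟩ := exists_isMinimalWeakUpperGradient hp hW
  exact ⟨g, hg, hg.2 _ hW⟩

end KorevaarSchoen

end

theorem proposition3p5 :
    ∃ C : ℝ → ℝ, (∀ D, 0 < C D) ∧
      ∀ (X : Type*) [MetricSpace X] [CompleteSpace X] [TopologicalSpace.SeparableSpace X]
        [MeasurableSpace X] [BorelSpace X] (m : Measure X) (_hm : m ≠ 0)
        (_hfin : ∀ s : Set X, Bornology.IsBounded s → m s < ∞)
        (Doub : ℝ → ℝ) (_hdoub : IsUniformlyLocallyDoubling m Doub)
        (Y : Type*) [MetricSpace Y] [CompleteSpace Y] (ybar : Y)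
        (p : ℝ) (hp : 1 < p) (u : X → Y) (_hu : MemKorevaarSchoen p m ybar u),
        MemSobolev p m ybar u ∧
        (∃ (ε : ℕ → ℝ) (G : X → ℝ), (∀ n, 0 < ε n) ∧ Tendsto ε atTop (𝓝 0) ∧
          TendstoWeakLp hp m (fun n => ksDensity p m u (ε n)) G) ∧
        ∃ Du : X → ℝ, IsMinimalMetricWeakUpperGradient p m u Du ∧
          ∀ (ε : ℕ → ℝ) (G : X → ℝ), (∀ n, 0 < ε n) → Tendsto ε atTop (𝓝 0) →
            TendstoWeakLp hp m (fun n => ksDensity p m u (ε n)) G →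
            ∀ᵐ x ∂m, Du x ≤ C (⨅ R : Set.Ioi (0 : ℝ), Doub R) * G x := by
  refine ⟨fun D => 8 * (|D| + 1) ^ 6, fun D => by positivity, ?_⟩
  intro X _ _ _ _ _ m hm hfin Doub hdoub Y _ _ ybar p hp u hu
  have : SecondCountableTopology X := UniformSpace.secondCountable_of_separable X
  have : IsLocallyFiniteMeasure m :=
    ⟨fun x => ⟨Metric.ball x 1, Metric.ball_mem_nhds x one_pos, hfin _ Metric.isBounded_ball⟩⟩
  obtain ⟨R, hR, hmD⟩ := hdoub.isDoublingBelow hm hfin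
  have hwug : ∀ (ε : ℕ → ℝ) (G : X → ℝ), (∀ n, 0 < ε n) → Tendsto ε atTop (𝓝 0) →
      TendstoWeakLp hp m (fun n => ksDensity p m u (ε n)) G → IsMetricWeakUpperGradient p m u
        (fun x => 8 * (|⨅ R : Set.Ioi (0 : ℝ), Doub R| + 1) ^ 6 * G x) := fun ε G hε hε0 hG =>
    isMetricWeakUpperGradient_of_tendstoWeakLp (by positivity) hmD hR hu.1 hε hε0 hG
  obtain ⟨ε, G, hε, hε0, hG⟩ := hu.exists_tendstoWeakLp hmD hp
  obtain ⟨Du, hDu⟩ := exists_isMinimalMetricWeakUpperGradient hp (hwug ε G hε hε0 hG)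
  exact ⟨⟨hu.1, _, hwug ε G hε hε0 hG⟩, ⟨ε, G, hε, hε0, hG⟩, Du, hDu,
    fun ε G hε hε0 hG => hDu.2 _ (hwug ε G hε hε0 hG)⟩
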